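/- Let $q$ be a prime power, let $\overline{\mathbb F_q}$ be an algebraic closure of $\mathbb F_q$, and let $F(x:y:z)=(x^q:y^q:z^q)$ be the Frobenius map on $\mathbb P^2(\overline{\mathbb F_q})$. A $7$-arc over $\mathbb F_q$ is an (unordered) set $S\subset\mathbb P^2(\overline{\mathbb F_q})$ of $7$ points, no three of them on a line, with $F(S)\subseteq S$. For a cycle type $\lambda$ of $S_7$ let $B_7^\lambda$ be the set of $7$-arcs $S$ over $\mathbb F_q$ on which $F$ acts as a permutation of cycle type $\lambda$. Each $B_7^\lambda$ is finite; put $N_\lambda(q)=|B_7^\lambda|/|\mathrm{PGL}(3,\mathbb F_q)|$. **Theorem 1.21.** If $q$ is a power of $2$, then - $N_{e}(q)=\frac1{5040}(q^6-28q^5+323q^4-1952q^3+6462q^2-11004q+7440)$, - $N_{(12)(34)}(q)=\frac1{48}(q^6-4q^5-q^4+16q^3-6q^2-12q)$, - $N_{(123)(456)}(q)=\frac1{18}(q^6-q^5-q^4-8q^3+9q^2+6q+12)$, - $N_{(1234)(56)}(q)=\frac18(q^6-3q^4)$, - $N_{(1234567)}(q)=\frac17(q^6+q^4+q^3+q^2-1)$.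 These five counts differ from those in odd characteristic: for odd $q$, - $N_{e}(q)=\frac1{5040}(q^6-28q^5+323q^4-1952q^3+6462q^2-11004q+7470)$, - $N_{(12)(34)}(q)=\frac1{48}(q^6-4q^5-q^4+16q^3-6q^2-12q+6)$, - $N_{(123)(456)}(q)=\frac1{18}(q^6-q^5-q^4-8q^3+9q^2+6q+18)$, - $N_{(1234)(56)}(q)=\frac18(q^6-3q^4+2)$, - $N_{(1234567)}(q)=\frac17(q^6+q^4+q^3+q^2+1)$. For the other ten cycle types the counts are the same in even and in odd characteristic: for every prime power $q$, - $N_{(12)}(q)=\frac1{240}(q^6-10q^5+41q^4-86q^3+90q^2-36q)$, - $N_{(12)(34)(56)}(q)=\frac1{48}(q^6-2q^5-11q^4+18q^3+38q^2-36q-48)$, - $N_{(123)}(q)=\frac1{72}(q^6-q^5-q^4+q^3)$, - $N_{(123)(45)}(q)=\frac1{12}(q^6-q^5-q^4+q^3)$, - $N_{(123)(45)(67)}(q)=\frac1{24}(q^6-q^5-q^4+q^3)$, - $N_{(1234)}(q)=\frac1{24}(q^6+2q^5-q^4-2q^3)$, - $N_{(1234)(567)}(q)=\frac1{12}(q^6-q^5-q^4+q^3)$,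 - $N_{(12345)}(q)=\frac1{10}(q^6+2q^5+3q^4+3q^3+2q^2+q)$, - $N_{(12345)(67)}(q)=\frac1{10}(q^6+q^4-q^3-q)$, - $N_{(123456)}(q)=\frac16(q^6+q^5+q^4-q^2)$. -/

import Mathlib

open scoped LinearAlgebra.Projectivization

namespace PlaneArcs

/-- The coordinatewise `q`-power map `(x, y, z) ↦ (x ^ q, y ^ q, z ^ q)` on `K³`, where
`q = #F` and `K` is an extension of the finite field `F`. It is semilinear with respect to the
`q`-power Frobenius of `K`. -/
def frobVec (F K : Type*) [Field F] [Fintype F] [Field K] [Algebra F K] :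
    (Fin 3 → K) →ₛₗ[(FiniteField.frobeniusAlgHom F K : K →+* K)] (Fin 3 → K) where
  toFun v i := v i ^ Fintype.card F
  map_add' v w := by
    funext i
    exact map_add (FiniteField.frobeniusAlgHom F K) (v i) (w i)
  map_smul' c v := by
    funext i
    exact map_mul (FiniteField.frobeniusAlgHom F K) c (v i)

theorem frobVec_injective (F K : Type*) [Field F] [Fintype F] [Field K] [Algebra F K] :
    Function.Injective (frobVec F K) := by
  intro v w h
  funext i
  exact (FiniteField.frobeniusAlgHom F K).toRingHom.injective (congrFun h i)

/-- The Frobenius `F_q` on the projective plane: `(x : y : z) ↦ (x ^ q : y ^ q : z ^ q)`. -/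
def frob (F K : Type*) [Field F] [Fintype F] [Field K] [Algebra F K] :
    ℙ K (Fin 3 → K) → ℙ K (Fin 3 → K) :=
  Projectivization.map (frobVec F K) (frobVec_injective F K)

/-- Three points lie on a common line `{αx + βy + γz = 0}`; the line is recorded by the point
`l = (α : β : γ)` of the dual plane, and incidence is `αx + βy + γz = 0`. -/
def Collinear {K : Type*} [Field K] (a b c : ℙ K (Fin 3 → K)) : Prop :=
  ∃ l : ℙ K (Fin 3 → K), a.orthogonal l ∧ b.orthogonal l ∧ c.orthogonal l

/-- An (unordered) `n`-arc defined over `F`: a Frobenius-invariant set of `n` points in the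
projective plane over `K` (an algebraic closure of `F`), no three of which are collinear. -/
structure IsArc (F : Type*) {K : Type*} [Field F] [Fintype F] [Field K] [Algebra F K]
    (n : ℕ) (S : Finset (ℙ K (Fin 3 → K))) : Prop where
  card_eq : S.card = n
  frob_mem : ∀ a ∈ S, frob F K a ∈ S
  not_collinear : ∀ a ∈ S, ∀ b ∈ S, ∀ c ∈ S, a ≠ b → a ≠ c → b ≠ c → ¬ Collinear a b c

open Classical in
/-- The Frobenius restricts to a permutation of `S` whose cycle lengths, fixed points included
as cycles of length `1`, form the multiset `lam`. -/
def HasFrobCycleType (F : Type*) {K : Type*} [Field F] [Fintype F] [Field K] [Algebra F K]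
    (S : Finset (ℙ K (Fin 3 → K))) (lam : Multiset ℕ) : Prop :=
  ∃ σ : Equiv.Perm {a // a ∈ S},
    (∀ a, (σ a : ℙ K (Fin 3 → K)) = frob F K a) ∧ σ.partition.parts = lam

/-- The set `B_n^λ` of `n`-arcs over `F` on which Frobenius acts with cycle type `lam`
(a partition of `n`, as the multiset of its parts). -/
def arcs (F K : Type*) [Field F] [Fintype F] [Field K] [Algebra F K]
    (n : ℕ) (lam : Multiset ℕ) : Set (Finset (ℙ K (Fin 3 → K))) :=
  {S | IsArc F n S ∧ HasFrobCycleType F S lam}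

/-- The normalized count `|B_7^λ| / |PGL(3, F)|`. -/
noncomputable def count7 (F K : Type*) [Field F] [Fintype F] [Field K] [Algebra F K]
    (lam : Multiset ℕ) : ℚ :=
  ((arcs F K 7 lam).ncard : ℚ) / (Nat.card (Matrix.ProjGenLinGroup (Fin 3) F) : ℚ)

end PlaneArcs

/-!
The plane over an algebraic closure of `𝔽_q` is replaced by the finite plane `FinPlane` of its
points fixed by the `7!`-th power of the Frobenius; every arc of seven points lies in it, because
the Frobenius permutes the seven points. Its lines are named by points through their coefficient
vectors, which makes it a `PolarPlane`: incidence is a symmetric relation and every count of points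
is also a count of lines. The Frobenius becomes an automorphism `F` whose powers `F ^ k`, `k ≤ 7`,
have a plane of order `q ^ k` as their fixed points (`IsFrob`, `isFrob_frobPerm`). Everything else
about fields enters through three facts, listed below.

For a permutation `s` of the labels, `numTw F s` counts the labelled arcs `P` with
`F (P i) = P (s i)`. Unlabelled arcs have as many labellings as the centralizer of `s` has
elements (`numTw_eq_ncard_mul`), and `PGL₃` has order `pglCard q` (`natCard_projGenLinGroup`), so
each claim is a formula `numTw F s = pglCard q * N` (`count7_eq`). For every cycle type of four
points the number of labelled frames is `pglCard q`, which produces this factor unless there is a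
cycle of length `5`, `6` or `7`. The following arguments cover the fifteen types.

* A conjugate triple on no fixed line is automatically in general position to any four points with
  cycle lengths dividing `4` (`numTw_frame_triple`): the types with one cycle of length `3`, other
  than `(3, 3, 1)`.
* For the types without cycles of length `3`, `6` and `7`, two points are added to an arc of five
  points. A point off the lines of at most five points lies on at most two lines of the arc, so
  inclusion-exclusion stops at the second step (`off_indicator`, `cnt_fix_off`). From the pairs of
  such points one has to remove those whose line passes through a point of the arc (`numTw_pair`).
  Their line is a fixed line avoiding the other four points, and the number of admissible points on
  it depends only on the diagonal points of the frame that it contains (`alignedTriples_eq`,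
  `alignedConj_eq`).
* An orbit of length `6` is an arc unless its points lie on lines fixed by `F ^ 2` (`tw_six`), and a
  fixed point completes it unless it lies on a line through opposite points (`offC_six`).
* An orbit of length `7` on no fixed line is an arc unless it is a Fano plane, in one of two cyclic
  orders (`tw_seven`); the two orders are exchanged by the duality `x ↦ join x (F x)`
  (`cnt_fano_dual`).
* For the type `(3, 3, 1)` the conjugate triples on no fixed line with a point on a line of the
  frame, or a side through a point of it, are counted directly (`frame_three_off`,
  `cnt_frame_three_aligned`). Those with both defects are the triangle of the frame itself and that
  of `Circum`, if there is one.

The characteristic matters in three ways. The diagonal points of a frame are collinear exactly in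
characteristic two (`FanoIff`, `fanoIff_finPlane`), where a frame and its diagonal points form a
Fano plane; this changes the number of fixed lines through diagonal points, and excludes Fano
planes in odd characteristic (`fano_of_seven`). A frame has a circumscribed triangle in the sense
of `Circum` exactly in odd characteristic (`circumIff_finPlane`). In characteristic two the points
whose orbit is a Fano plane in a given cyclic order have representatives in the kernel of
`φ ^ 3 + φ + 1`, a three-dimensional space over `𝔽_q`, whose bases up to scalars are as many as the
elements of `PGL₃` (`cnt_conjugate_fano`).
-/

open scoped LinearAlgebra.Projectivization

namespace PlaneArcs

set_option linter.unusedSectionVars false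

/-! ### Counting in finite types -/

/-- The number of elements of a finite type satisfying `p`, as an integer, so that counts can be
subtracted freely. -/
noncomputable def cnt {α : Type*} [Fintype α] (p : α → Prop) : ℤ := by
  classical exact ((Finset.univ.filter p).card : ℤ)

section cnt

variable {α β : Type*} [Fintype α] [Fintype β]

open Classical in
theorem cnt_eq_sum (p : α → Prop) : cnt p = ∑ x, if p x then (1 : ℤ) else 0 := by
  simp [cnt]

theorem cnt_congr {p r : α → Prop} (h : ∀ x, p x ↔ r x) : cnt p = cnt r := by
  rw [funext fun x => propext (h x)]

theorem cnt_eq_card (p : α → Prop) [DecidablePred p] :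
    cnt p = ((Finset.univ.filter p).card : ℤ) := by
  unfold cnt
  congr

theorem cnt_eq_natCard (p : α → Prop) : cnt p = (Nat.card {x // p x} : ℤ) := by
  classical
  rw [cnt_eq_card, Nat.card_eq_fintype_card, Fintype.card_subtype]

theorem cnt_split (p r : α → Prop) : cnt p = cnt (fun x => p x ∧ r x) + cnt (fun x => p x ∧ ¬ r x) := by
  classical
  simp only [cnt_eq_sum, ← Finset.sum_add_distrib]
  refine Finset.sum_congr rfl fun x _ => ?_
  by_cases h : p x <;> by_cases h' : r x <;> simp [h, h']

theorem cnt_or {p r : α → Prop} (h : ∀ x, p x → ¬ r x) :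
    cnt (fun x => p x ∨ r x) = cnt p + cnt r := by
  rw [cnt_split (fun x => p x ∨ r x) p]
  congr 1 <;> refine cnt_congr fun x => ?_ <;> have := h x <;> tauto

theorem cnt_eq_zero {p : α → Prop} (h : ∀ x, ¬ p x) : cnt p = 0 := by
  classical
  simp [cnt_eq_sum, h]

theorem cnt_eq_one {p : α → Prop} (a : α) (h : ∀ x, p x ↔ x = a) : cnt p = 1 := by
  classical
  simp [cnt_eq_sum, h]

theorem cnt_eq_ite {p : α → Prop} (a : α) (P : Prop) [Decidable P] (h : ∀ x, p x ↔ x = a ∧ P) :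
    cnt p = if P then 1 else 0 := by
  split_ifs with hP
  · exact cnt_eq_one a fun x => by simp [h, hP]
  · exact cnt_eq_zero fun x => by simp [h, hP]

open Classical in
/-- Counting along the fibres of a map. -/
theorem cnt_fiber_sum {p : α → Prop} {r : β → Prop} (f : α → β) (hf : ∀ a, p a → r (f a)) :
    cnt p = ∑ b, if r b then cnt (fun a => p a ∧ f a = b) else 0 := by
  have h : ∀ b, (if r b then cnt (fun a => p a ∧ f a = b) else 0) =
      ∑ a, if p a ∧ f a = b then (1 : ℤ) else 0 := by
    intro b
    split_ifs with hb
    · rw [cnt_eq_sum]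
      exact Finset.sum_congr rfl fun _ _ => by congr
    · refine (Finset.sum_eq_zero fun a _ => if_neg ?_).symm
      rintro ⟨h, rfl⟩
      exact hb (hf a h)
  rw [Finset.sum_congr rfl fun b _ => h b, Finset.sum_comm, cnt_eq_sum]
  refine Finset.sum_congr rfl fun a _ => ?_
  by_cases ha : p a <;> simp [ha]

/-- Double counting along a map all of whose fibres have `c` elements. -/
theorem cnt_fiber {p : α → Prop} {r : β → Prop} (f : α → β) (c : ℤ) (hf : ∀ a, p a → r (f a))
    (hc : ∀ b, r b → cnt (fun a => p a ∧ f a = b) = c) : cnt p = cnt r * c := by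
  classical
  rw [cnt_fiber_sum f hf, cnt_eq_sum, Finset.sum_mul]
  refine Finset.sum_congr rfl fun b _ => ?_
  split_ifs with h
  · simp [hc b h]
  · simp

theorem cnt_bij {p : α → Prop} {r : β → Prop} (f : α → β) (g : β → α) (hf : ∀ a, p a → r (f a))
    (hg : ∀ b, r b → p (g b)) (hgf : ∀ a, p a → g (f a) = a) (hfg : ∀ b, r b → f (g b) = b) :
    cnt p = cnt r := by
  rw [cnt_fiber f 1 hf, mul_one]
  intro b hb
  refine cnt_eq_one (g b) fun a => ?_
  constructor
  · rintro ⟨h, rfl⟩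
    exact (hgf a h).symm
  · rintro rfl
    exact ⟨hg b hb, hfg b hb⟩

open Classical in
theorem cnt_sigma_sum (p : α → Prop) (r : α → β → Prop) :
    cnt (fun x : α × β => p x.1 ∧ r x.1 x.2) = ∑ a, if p a then cnt (r a) else 0 := by
  rw [cnt_fiber_sum (r := p) (fun x => x.1) (fun a h => h.1)]
  refine Finset.sum_congr rfl fun a _ => ?_
  split_ifs with h
  · refine cnt_bij (fun x => x.2) (fun b => (a, b)) ?_ ?_ ?_ ?_
    · rintro ⟨x, y⟩ ⟨⟨_, h'⟩, rfl⟩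
      exact h'
    · exact fun b hb => ⟨⟨h, hb⟩, rfl⟩
    · rintro ⟨x, y⟩ ⟨_, rfl⟩
      rfl
    · exact fun b _ => rfl
  · rfl

/-- The product rule: every `a` with `p a` has `c` partners. -/
theorem cnt_sigma (p : α → Prop) (r : α → β → Prop) (c : ℤ) (h : ∀ a, p a → cnt (r a) = c) :
    cnt (fun x : α × β => p x.1 ∧ r x.1 x.2) = cnt p * c := by
  classical
  rw [cnt_sigma_sum, cnt_eq_sum, Finset.sum_mul]
  refine Finset.sum_congr rfl fun b _ => ?_
  split_ifs with h'
  · simp [h b h']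
  · simp

theorem cnt_ne {p : α → Prop} {a : α} (ha : p a) : cnt (fun x => p x ∧ x ≠ a) = cnt p - 1 := by
  rw [cnt_split p (fun x => x = a), cnt_eq_one (p := fun x => p x ∧ x = a) a]
  · simp
  · intro x
    constructor
    · exact fun h => h.2
    · rintro rfl
      exact ⟨ha, rfl⟩

end cnt

/-! ### Self-dual planes and Frobenius permutations -/

/-- A projective plane whose lines are named by its points, as the lines of `ℙ²` are by their
coefficient vectors: `Inc a l` says that `a` lies on the line named `l`. Incidence is symmetric,
so every statement about points on lines is also one about lines through points. -/
class PolarPlane (X : Type*) where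
  Inc : X → X → Prop
  symm : ∀ {a b}, Inc a b → Inc b a
  exists_line : ∀ {a b}, a ≠ b → ∃ l, Inc a l ∧ Inc b l
  eq_or_eq : ∀ {a b l m}, Inc a l → Inc b l → Inc a m → Inc b m → a = b ∨ l = m

open PolarPlane (Inc)

section plane

variable {X : Type*} [PolarPlane X]

theorem inc_comm {a b : X} : Inc a b ↔ Inc b a := ⟨PolarPlane.symm, PolarPlane.symm⟩

theorem line_unique {a b l m : X} (h : a ≠ b) (al : Inc a l) (bl : Inc b l) (am : Inc a m)
    (bm : Inc b m) : l = m :=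
  (PolarPlane.eq_or_eq al bl am bm).resolve_left h

open Classical in
/-- The line through two distinct points, which is also the intersection point of two distinct
lines. The junk value `join a a = a` keeps `join` symmetric and compatible with
automorphisms. -/
noncomputable def join (a b : X) : X :=
  if h : a = b then a else (PolarPlane.exists_line h).choose

theorem inc_join_left {a b : X} (h : a ≠ b) : Inc a (join a b) := by
  rw [join, dif_neg h]
  exact (PolarPlane.exists_line h).choose_spec.1

theorem inc_join_right {a b : X} (h : a ≠ b) : Inc b (join a b) := by
  rw [join, dif_neg h]
  exact (PolarPlane.exists_line h).choose_spec.2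

theorem join_inc_left {a b : X} (h : a ≠ b) : Inc (join a b) a := PolarPlane.symm (inc_join_left h)

theorem join_inc_right {a b : X} (h : a ≠ b) : Inc (join a b) b := PolarPlane.symm (inc_join_right h)

theorem eq_join {a b l : X} (h : a ≠ b) (al : Inc a l) (bl : Inc b l) : l = join a b :=
  line_unique h al bl (inc_join_left h) (inc_join_right h)

theorem eq_join' {a b l : X} (h : a ≠ b) (al : Inc l a) (bl : Inc l b) : l = join a b :=
  eq_join h (PolarPlane.symm al) (PolarPlane.symm bl)

theorem join_self (a : X) : join a a = a := by simp [join]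

theorem join_comm (a b : X) : join a b = join b a := by
  by_cases h : a = b
  · rw [h]
  · exact eq_join (Ne.symm h) (inc_join_right h) (inc_join_left h)

/-- Three points on a common line, or dually three lines through a common point. -/
def Coll (a b c : X) : Prop := ∃ l, Inc a l ∧ Inc b l ∧ Inc c l

theorem Coll.swap₁₂ {a b c : X} (h : Coll a b c) : Coll b a c :=
  let ⟨l, x, y, z⟩ := h; ⟨l, y, x, z⟩

theorem Coll.swap₂₃ {a b c : X} (h : Coll a b c) : Coll a c b :=
  let ⟨l, x, y, z⟩ := h; ⟨l, x, z, y⟩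

theorem coll_iff {a b c : X} (h : a ≠ b) : Coll a b c ↔ Inc c (join a b) := by
  constructor
  · rintro ⟨l, x, y, z⟩
    rwa [← eq_join h x y]
  · exact fun hc => ⟨_, inc_join_left h, inc_join_right h, hc⟩

/-- An automorphism of the plane that behaves like the Frobenius of the field with `q` elements:
its fixed points form a plane of order `q`. -/
structure IsFrob [Fintype X] (F : Equiv.Perm X) (q : ℤ) : Prop where
  one_lt : 1 < q
  inc_iff : ∀ a b, Inc (F a) (F b) ↔ Inc a b
  card_fix : cnt (fun x => F x = x) = q ^ 2 + q + 1
  card_line : ∀ l, F l = l → cnt (fun x => F x = x ∧ Inc x l) = q + 1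

end plane

section plane

variable {X : Type*} [PolarPlane X]

/-! ### Labelled arcs -/

theorem coll_self_left [Nontrivial X] (a b : X) : Coll a a b := by
  by_cases h : a = b
  · obtain ⟨c, hc⟩ := exists_ne a
    subst h
    exact ⟨join a c, inc_join_left hc.symm, inc_join_left hc.symm, inc_join_left hc.symm⟩
  · exact ⟨join a b, inc_join_left h, inc_join_left h, inc_join_right h⟩

theorem not_coll_ne [Nontrivial X] {a b c : X} (h : ¬ Coll a b c) : a ≠ b ∧ a ≠ c ∧ b ≠ c := by
  refine ⟨?_, ?_, ?_⟩ <;> rintro rfl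
  · exact h (coll_self_left _ _)
  · exact h (coll_self_left _ _).swap₂₃
  · exact h (coll_self_left _ _).swap₂₃.swap₁₂

/-- `Tw F s P` says that the points `P i` form an arc (no three on a line) which the
automorphism `F` permutes the way `s` permutes their labels. -/
def Tw (F : Equiv.Perm X) {n : ℕ} (s : Fin n → Fin n) (P : Fin n → X) : Prop :=
  (∀ i, F (P i) = P (s i)) ∧ ∀ i j k, i < j → j < k → ¬ Coll (P i) (P j) (P k)

theorem Tw.not_coll {F : Equiv.Perm X} {n : ℕ} {s : Fin n → Fin n} {P : Fin n → X} (h : Tw F s P)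
    {i j k : Fin n} (hij : i ≠ j) (hik : i ≠ k) (hjk : j ≠ k) : ¬ Coll (P i) (P j) (P k) := by
  have h2 := h.2
  rcases lt_or_gt_of_ne hij with a | a <;> rcases lt_or_gt_of_ne hik with b | b <;>
    rcases lt_or_gt_of_ne hjk with c | c
  · exact h2 _ _ _ a c
  · exact fun h => h2 _ _ _ b c h.swap₂₃
  · exact absurd (a.trans c) (not_lt.2 b.le)
  · exact fun h => h2 _ _ _ b a h.swap₂₃.swap₁₂
  · exact fun h => h2 _ _ _ a b h.swap₁₂
  · exact absurd (b.trans c) (not_lt.2 a.le)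
  · exact fun h => h2 _ _ _ c b h.swap₁₂.swap₂₃
  · exact fun h => h2 _ _ _ c a h.swap₁₂.swap₂₃.swap₁₂

theorem Tw.injective [Nontrivial X] {F : Equiv.Perm X} {n : ℕ} {s : Fin n → Fin n} {P : Fin n → X}
    (h : Tw F s P) (hn : 3 ≤ n) : Function.Injective P := by
  intro i j hij
  by_contra hne
  obtain ⟨k, hk⟩ : ∃ k : Fin n, k ∉ ({i, j} : Finset (Fin n)) := by
    by_contra! hall
    have := Finset.card_le_card (fun x _ => hall x : (Finset.univ : Finset (Fin n)) ⊆ {i, j})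
    have h2 := Finset.card_le_two (a := i) (b := j)
    simp at this
    omega
  simp only [Finset.mem_insert, Finset.mem_singleton, not_or] at hk
  exact (not_coll_ne (h.not_coll hne (Ne.symm hk.1) (Ne.symm hk.2))).1 hij

/-- The number of labelled arcs on which `F` acts through `s`. -/
noncomputable def numTw [Fintype X] (F : Equiv.Perm X) {n : ℕ} (s : Fin n → Fin n) : ℤ :=
  cnt (fun P : Fin n → X => Tw F s P)

/-- `x` lies on none of the lines joining two of the points `P i`. -/
def Off {n : ℕ} (P : Fin n → X) (x : X) : Prop :=
  ∀ i j, i < j → ¬ Inc x (join (P i) (P j))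

/-! ### Inclusion-exclusion over the lines of an arc -/

/-- The edges: increasing pairs of labels. -/
def edges (n : ℕ) : Finset (Fin n × Fin n) := Finset.univ.filter fun e => e.1 < e.2

/-- Two edges without a common end, each such pair being listed once. -/
def edgePairs (n : ℕ) : Finset ((Fin n × Fin n) × (Fin n × Fin n)) :=
  (edges n ×ˢ edges n).filter fun p => p.1.1 < p.2.1 ∧ p.1.2 ≠ p.2.1 ∧ p.1.2 ≠ p.2.2

/-- `s` carries the edge `e` to the edge `f`. -/
def Carries {n : ℕ} (s : Fin n → Fin n) (e f : Fin n × Fin n) : Prop :=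
  (s e.1 = f.1 ∧ s e.2 = f.2) ∨ (s e.1 = f.2 ∧ s e.2 = f.1)

instance {n : ℕ} (s : Fin n → Fin n) (e f : Fin n × Fin n) : Decidable (Carries s e f) := by
  unfold Carries; infer_instance

/-- The line of an arc labelled by an edge. -/
noncomputable def line {n : ℕ} (P : Fin n → X) (e : Fin n × Fin n) : X := join (P e.1) (P e.2)

theorem map_join [Fintype X] {F : Equiv.Perm X} {q : ℤ} (hF : IsFrob F q) (a b : X) :
    F (join a b) = join (F a) (F b) := by
  by_cases h : a = b
  · rw [h, join_self, join_self]
  · refine eq_join (F.injective.ne h) ?_ ?_ <;> rw [hF.inc_iff]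
    · exact inc_join_left h
    · exact inc_join_right h

theorem map_coll [Fintype X] {F : Equiv.Perm X} {q : ℤ} (hF : IsFrob F q) (a b c : X) :
    Coll (F a) (F b) (F c) ↔ Coll a b c := by
  constructor
  · rintro ⟨l, h⟩
    refine ⟨F.symm l, ?_⟩
    rwa [← hF.inc_iff, ← hF.inc_iff b, ← hF.inc_iff c, F.apply_symm_apply]
  · rintro ⟨l, h⟩
    exact ⟨F l, by rwa [hF.inc_iff, hF.inc_iff, hF.inc_iff]⟩

/-- Among the lines of an arc of at most five points, those through a point `x` off the arc have
no common ends, so there are at most two of them; they are permuted by `s` if `x` is fixed. In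
each of the possible cases inclusion-exclusion over the `s`-stable sets of such lines, with the
sign counting orbits, detects whether there are none. -/
theorem off_indicator [Nontrivial X] [Fintype X] {F : Equiv.Perm X} {q : ℤ} (hF : IsFrob F q)
    {n : ℕ} (hn : n ≤ 5) (hn3 : 3 ≤ n) {s : Fin n → Fin n} {P : Fin n → X} (hP : Tw F s P) {x : X}
    (hx : F x = x) (hxP : ∀ i, x ≠ P i) (E : Finset (Fin n × Fin n))
    (hE : ∀ e, e ∈ E ↔ e ∈ edges n ∧ Inc x (line P e)) :
    (if E = ∅ then (1 : ℤ) else 0) = 1 - ((E.filter fun e => Carries s e e).card : ℤ)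
      + (((edgePairs n).filter fun p => (Carries s p.1 p.1 ∧ Carries s p.2 p.2) ∧
          p.1 ∈ E ∧ p.2 ∈ E).card : ℤ)
      - (((edgePairs n).filter fun p => (Carries s p.1 p.2 ∧ Carries s p.2 p.1) ∧
          p.1 ∈ E ∧ p.2 ∈ E).card : ℤ) := by
  have hinj := hP.injective hn3
  have hs : Function.Injective s := by
    intro i j hij
    apply hinj
    apply F.injective
    rw [hP.1, hP.1, hij]
  have hlt : ∀ e ∈ E, e.1 < e.2 := fun e he => by
    have := ((hE e).1 he).1
    simpa [edges] using this
  have hon : ∀ i j, i ≠ j → (Inc x (join (P i) (P j)) ↔ (i, j) ∈ E ∨ (j, i) ∈ E) := by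
    intro i j hij
    rw [hE, hE]
    simp only [edges, Finset.mem_filter, Finset.mem_univ, true_and, line]
    rcases lt_or_gt_of_ne hij with h | h
    · simp [h, h.le]
    · rw [join_comm]
      simp [h, h.le]
  -- two lines of the arc through `x` with a common end coincide
  have hshare : ∀ i j k, i ≠ j → i ≠ k → Inc x (join (P i) (P j)) → Inc x (join (P i) (P k)) →
      j = k := by
    intro i j k hij hik h1 h2
    by_contra hjk
    have := line_unique (hxP i) h1 (inc_join_left (hinj.ne hij)) h2 (inc_join_left (hinj.ne hik))
    refine hP.not_coll hij hik hjk ((coll_iff (hinj.ne hij)).2 ?_)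
    rw [this]
    exact inc_join_right (hinj.ne hik)
  have hdisj : ∀ e ∈ E, ∀ f ∈ E, e ≠ f → e.1 ≠ f.1 ∧ e.1 ≠ f.2 ∧ e.2 ≠ f.1 ∧ e.2 ≠ f.2 := by
    rintro ⟨a, b⟩ he ⟨c, d⟩ hf hne
    have h1 := hlt _ he
    have h2 := hlt _ hf
    simp only at h1 h2 ⊢
    have e1 := (hon a b h1.ne).2 (Or.inl he)
    have e2 := (hon b a h1.ne').2 (Or.inr he)
    have e3 := (hon c d h2.ne).2 (Or.inl hf)
    have e4 := (hon d c h2.ne').2 (Or.inr hf)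
    have hshare := hshare
    refine ⟨?_, ?_, ?_, ?_⟩ <;> rintro rfl
    · exact hne (by rw [hshare _ _ _ h1.ne h2.ne e1 e3])
    · have := hshare _ _ _ h1.ne h2.ne' e1 e4
      subst this
      exact absurd h1 h2.not_gt
    · have := hshare _ _ _ h1.ne' h2.ne e2 e3
      subst this
      exact absurd h1 h2.not_gt
    · exact hne (by rw [hshare _ _ _ h1.ne' h2.ne' e2 e4])
  -- the lines of the arc through the fixed point `x` are permuted
  have hmap : ∀ e ∈ E, ∃ f ∈ E, Carries s e f := by
    rintro ⟨a, b⟩ he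
    have h1 := hlt _ he
    have := (hon a b h1.ne).2 (Or.inl he)
    rw [← hF.inc_iff, hx, map_join hF, hP.1, hP.1, hon _ _ (hs.ne h1.ne)] at this
    rcases this with h | h
    · exact ⟨_, h, Or.inl ⟨rfl, rfl⟩⟩
    · exact ⟨_, h, Or.inr ⟨rfl, rfl⟩⟩
  -- three such lines would need six labels
  have hthree : ∀ e ∈ E, ∀ f ∈ E, ∀ g ∈ E, e ≠ f → e ≠ g → f ≠ g → False := by
    intro e he f hf g hg hef heg hfg
    have := hdisj e he f hf hef
    have h2 := hdisj e he g hg heg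
    have h3 := hdisj f hf g hg hfg
    have h4 := (hlt e he).ne
    have h5 := (hlt f hf).ne
    have h6 := (hlt g hg).ne
    have hnd : [e.1, e.2, f.1, f.2, g.1, g.2].Nodup := by
      simp only [List.nodup_cons, List.mem_cons, List.not_mem_nil, not_or]
      tauto
    have := hnd.length_le_card
    simp at this
    omega
  -- no line, two lines (both stable or exchanged), or one line (stable)
  rcases E.eq_empty_or_nonempty with rfl | ⟨e, he⟩
  · simp
  rw [if_neg (Finset.ne_empty_of_mem he)]
  by_cases h2 : ∃ f ∈ E, f ≠ e
  · obtain ⟨f, hf, hfe⟩ := h2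
    wlog hlt' : e.1 < f.1 generalizing e f
    · exact this f hf e he hfe.symm
        (lt_of_le_of_ne (not_lt.1 hlt') (hdisj f hf e he hfe).1)
    have hEeq : E = {e, f} := by
      ext g
      simp only [Finset.mem_insert, Finset.mem_singleton]
      constructor
      · intro hg
        by_contra! hcon
        exact hthree e he f hf g hg hfe.symm hcon.1.symm hcon.2.symm
      · rintro (rfl | rfl) <;> assumption
    have hd := hdisj e he f hf hfe.symm
    have hpairs : ∀ p : (Fin n × Fin n) × (Fin n × Fin n),
        (p ∈ edgePairs n ∧ p.1 ∈ E ∧ p.2 ∈ E) ↔ p = (e, f) := by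
      rintro ⟨a, b⟩
      rw [hEeq]
      simp only [edgePairs, Finset.mem_filter, Finset.mem_product, Finset.mem_insert,
        Finset.mem_singleton, Prod.mk.injEq]
      constructor
      · rintro ⟨⟨_, h, _⟩, rfl | rfl, rfl | rfl⟩
        · exact absurd h (lt_irrefl _)
        · exact ⟨rfl, rfl⟩
        · exact absurd h hlt'.not_gt
        · exact absurd h (lt_irrefl _)
      · rintro ⟨rfl, rfl⟩
        exact ⟨⟨⟨((hE _).1 he).1, ((hE _).1 hf).1⟩, hlt', hd.2.2⟩, Or.inl rfl, Or.inr rfl⟩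
    have hcard : ∀ (Q : (Fin n × Fin n) × (Fin n × Fin n) → Prop) [DecidablePred Q],
        (((edgePairs n).filter fun p => Q p ∧ p.1 ∈ E ∧ p.2 ∈ E).card : ℤ) =
          if Q (e, f) then 1 else 0 := by
      intro Q _
      have : ((edgePairs n).filter fun p => Q p ∧ p.1 ∈ E ∧ p.2 ∈ E) =
          ({(e, f)} : Finset _).filter Q := by
        ext p
        have := hpairs p
        simp only [Finset.mem_filter, Finset.mem_singleton]
        tauto
      rw [this, Finset.filter_singleton]
      split_ifs <;> simp
    rw [hcard, hcard]
    have hcard1 : ((E.filter fun e => Carries s e e).card : ℤ) =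
        (if Carries s e e then 1 else 0) + if Carries s f f then 1 else 0 := by
      rw [hEeq, Finset.card_filter, Finset.sum_pair hfe.symm]
      push_cast
      rfl
    rw [hcard1]
    obtain ⟨e', he', hce⟩ := hmap e he
    obtain ⟨f', hf', hcf⟩ := hmap f hf
    rw [hEeq, Finset.mem_insert, Finset.mem_singleton] at he' hf'
    have hexcl : ∀ a b c d : Fin n × Fin n, a.1 ≠ b.1 ∧ a.1 ≠ b.2 ∧ a.2 ≠ b.1 ∧ a.2 ≠ b.2 →
        Carries s a c → Carries s b c → False := by
      intro a b c _ h h1 h2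
      have hs' : ∀ {i j}, s i = s j → i = j := fun h => hs h
      rcases h1 with h1 | h1 <;> rcases h2 with h2 | h2
      · exact h.1 (hs' (h1.1.trans h2.1.symm))
      · exact h.2.1 (hs' (h1.1.trans h2.2.symm))
      · exact h.2.1 (hs' (h1.1.trans h2.2.symm))
      · exact h.1 (hs' (h1.1.trans h2.1.symm))
    have hexcl' : ∀ a : Fin n × Fin n, Carries s a e → Carries s a f → False := by
      intro a h1 h2
      rcases h1 with h1 | h1 <;> rcases h2 with h2 | h2
      · exact hd.1 (h1.1.symm.trans h2.1)
      · exact hd.2.1 (h1.1.symm.trans h2.1)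
      · exact hd.2.2.1 (h1.1.symm.trans h2.1)
      · exact hd.2.2.2 (h1.1.symm.trans h2.1)
    have n1 := hexcl e f e e hd
    have n2 := hexcl e f f e hd
    have n3 := hexcl' e
    have n4 := hexcl' f
    rcases he' with rfl | rfl <;> rcases hf' with rfl | rfl
    · exact (n1 hce hcf).elim
    · have a1 : ¬ Carries s e' f' := n3 hce
      simp [hce, hcf, a1]
    · have a1 : ¬ Carries s f' f' := fun h => n3 h hce
      have a2 : ¬ Carries s e' e' := n4 hcf
      simp [hce, hcf, a1, a2]
    · exact (n2 hce hcf).elim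
  · push Not at h2
    have hEeq : E = {e} := by
      ext g
      simp only [Finset.mem_singleton]
      exact ⟨h2 g, fun h => h ▸ he⟩
    have hp : ∀ (Q : (Fin n × Fin n) × (Fin n × Fin n) → Prop) [DecidablePred Q],
        ((edgePairs n).filter fun p => Q p ∧ p.1 ∈ E ∧ p.2 ∈ E) = ∅ := by
      intro Q _
      refine Finset.filter_eq_empty_iff.2 ?_
      rintro ⟨a, b⟩ hp ⟨_, ha, hb⟩
      rw [hEeq, Finset.mem_singleton] at ha hb
      simp only at ha hb
      subst ha hb
      simp [edgePairs] at hp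
    rw [hp, hp]
    obtain ⟨f, hf, hc⟩ := hmap e he
    have := h2 f hf
    subst this
    rw [hEeq, Finset.filter_singleton, if_pos hc]
    simp

end plane

section plane

variable {X : Type*} [PolarPlane X] [Fintype X] [Nontrivial X]

/-- Inclusion-exclusion for the points of a set `A` of fixed points, disjoint from the arc `P`,
that lie on no line of `P`. -/
theorem cnt_off {F : Equiv.Perm X} {q : ℤ} (hF : IsFrob F q)
    {n : ℕ} (hn : n ≤ 5) (hn3 : 3 ≤ n) {s : Fin n → Fin n} {P : Fin n → X} (hP : Tw F s P)
    (A : X → Prop) (hA : ∀ x, A x → F x = x ∧ ∀ i, x ≠ P i) :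
    cnt (fun x => A x ∧ Off P x) = cnt A
      - ∑ e ∈ (edges n).filter (fun e => Carries s e e), cnt (fun x => A x ∧ Inc x (line P e))
      + ∑ p ∈ (edgePairs n).filter (fun p => Carries s p.1 p.1 ∧ Carries s p.2 p.2),
          cnt (fun x => A x ∧ Inc x (line P p.1) ∧ Inc x (line P p.2))
      - ∑ p ∈ (edgePairs n).filter (fun p => Carries s p.1 p.2 ∧ Carries s p.2 p.1),
          cnt (fun x => A x ∧ Inc x (line P p.1) ∧ Inc x (line P p.2)) := by
  classical
  simp only [cnt_eq_sum]
  rw [Finset.sum_comm (s := (edges n).filter _)]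
  rw [Finset.sum_comm (s := (edgePairs n).filter _)]
  rw [Finset.sum_comm (s := (edgePairs n).filter _)]
  rw [← Finset.sum_sub_distrib, ← Finset.sum_add_distrib, ← Finset.sum_sub_distrib]
  refine Finset.sum_congr rfl fun x _ => ?_
  by_cases hx : A x
  · obtain ⟨h1, h2⟩ := hA x hx
    have key := off_indicator hF hn hn3 hP h1 h2 ((edges n).filter fun e => Inc x (line P e))
      (by simp)
    have hoff : Off P x ↔ (edges n).filter (fun e => Inc x (line P e)) = ∅ := by
      rw [Finset.filter_eq_empty_iff]
      simp only [Off, edges, Finset.mem_filter, Finset.mem_univ, true_and, Prod.forall, line]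
    simp only [hx, true_and, hoff, if_true]
    rw [key]
    have hmem : ∀ p ∈ edgePairs n, p.1 ∈ edges n ∧ p.2 ∈ edges n := by
      intro p hp
      simp only [edgePairs, Finset.mem_filter, Finset.mem_product] at hp
      exact hp.1
    congr 1
    congr 1
    congr 1
    · rw [Finset.filter_filter, Finset.card_filter, Finset.sum_filter]
      push_cast
      refine Finset.sum_congr rfl fun e _ => ?_
      by_cases a : Carries s e e <;> by_cases b : Inc x (line P e) <;> simp [a, b]
    all_goals
      rw [Finset.card_filter, Finset.sum_filter]
      push_cast
      refine Finset.sum_congr rfl fun p hp => ?_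
      have := hmem p hp
      simp only [Finset.mem_filter, this, true_and]
    · by_cases a : Carries s p.1 p.1 ∧ Carries s p.2 p.2 <;> simp [a]
    · by_cases a : Carries s p.1 p.2 ∧ Carries s p.2 p.1 <;> simp [a]
  · simp [hx]

theorem off_ne {n : ℕ} (hn : 3 ≤ n) {F : Equiv.Perm X} {s : Fin n → Fin n} {P : Fin n → X}
    (hP : Tw F s P) {x : X} (hx : Off P x) (i : Fin n) : x ≠ P i := by
  rintro rfl
  have hinj := hP.injective hn
  obtain ⟨j, hj⟩ : ∃ j : Fin n, j ≠ i := by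
    have : Nontrivial (Fin n) := Fin.nontrivial_iff_two_le.2 (by omega)
    exact exists_ne i
  rcases lt_or_gt_of_ne hj with h | h
  · exact hx j i h (inc_join_right (hinj.ne h.ne))
  · exact hx i j h (inc_join_left (hinj.ne h.ne))

theorem Tw.label_injective {F : Equiv.Perm X} {n : ℕ} (hn : 3 ≤ n) {s : Fin n → Fin n}
    {P : Fin n → X} (hP : Tw F s P) : Function.Injective s := by
  intro i j hij
  apply hP.injective hn
  apply F.injective
  rw [hP.1, hP.1, hij]

theorem map_line {F : Equiv.Perm X} {q : ℤ} (hF : IsFrob F q) {n : ℕ} {s : Fin n → Fin n}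
    {P : Fin n → X} (hP : Tw F s P) {e f : Fin n × Fin n} (h : Carries s e f) :
    F (line P e) = line P f := by
  rw [line, map_join hF, hP.1, hP.1]
  rcases h with h | h
  · rw [h.1, h.2, line]
  · rw [h.1, h.2, join_comm, line]

theorem Tw.inc_line_iff {F : Equiv.Perm X} {n : ℕ} {s : Fin n → Fin n} {P : Fin n → X}
    (hP : Tw F s P) (hn : 3 ≤ n) {e : Fin n × Fin n} (he : e.1 ≠ e.2) (i : Fin n) :
    Inc (P i) (line P e) ↔ i = e.1 ∨ i = e.2 := by
  have hinj := hP.injective hn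
  constructor
  · intro h
    by_contra! hcon
    exact hP.not_coll he hcon.1.symm hcon.2.symm ((coll_iff (hinj.ne he)).2 h)
  · rintro (rfl | rfl)
    · exact inc_join_left (hinj.ne he)
    · exact inc_join_right (hinj.ne he)

theorem mem_edgePairs {n : ℕ} {p : (Fin n × Fin n) × (Fin n × Fin n)} (h : p ∈ edgePairs n) :
    p.1.1 < p.1.2 ∧ p.2.1 < p.2.2 ∧ p.1.1 ≠ p.2.1 ∧ p.1.2 ≠ p.2.1 ∧ p.1.1 ≠ p.2.2 ∧
      p.1.2 ≠ p.2.2 := by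
  simp only [edgePairs, edges, Finset.mem_filter, Finset.mem_product, Finset.mem_univ,
    true_and] at h
  exact ⟨h.1.1, h.1.2, h.2.1.ne, h.2.2.1, (h.2.1.trans h.1.2).ne, h.2.2.2⟩

/-- The point in which two lines of an arc with disjoint labels meet. -/
noncomputable def diag {n : ℕ} (P : Fin n → X) (p : (Fin n × Fin n) × (Fin n × Fin n)) : X :=
  join (line P p.1) (line P p.2)

theorem Tw.line_ne {F : Equiv.Perm X} {n : ℕ} {s : Fin n → Fin n} {P : Fin n → X}
    (hP : Tw F s P) (hn : 3 ≤ n) {p : (Fin n × Fin n) × (Fin n × Fin n)} (h : p ∈ edgePairs n) :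
    line P p.1 ≠ line P p.2 := by
  have hp := mem_edgePairs h
  intro heq
  have h1 := (hP.inc_line_iff hn hp.1.ne p.1.1).2 (Or.inl rfl)
  rw [heq, hP.inc_line_iff hn hp.2.1.ne] at h1
  tauto

theorem Tw.eq_diag_iff {F : Equiv.Perm X} {n : ℕ} {s : Fin n → Fin n} {P : Fin n → X}
    (hP : Tw F s P) (hn : 3 ≤ n) {p : (Fin n × Fin n) × (Fin n × Fin n)} (h : p ∈ edgePairs n)
    (x : X) : (Inc x (line P p.1) ∧ Inc x (line P p.2)) ↔ x = diag P p := by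
  have := hP.line_ne hn h
  constructor
  · rintro ⟨h1, h2⟩
    exact eq_join' this h1 h2
  · rintro rfl
    exact ⟨join_inc_left this, join_inc_right this⟩

theorem Tw.diag_ne {F : Equiv.Perm X} {n : ℕ} {s : Fin n → Fin n} {P : Fin n → X}
    (hP : Tw F s P) (hn : 3 ≤ n) {p : (Fin n × Fin n) × (Fin n × Fin n)} (h : p ∈ edgePairs n)
    (i : Fin n) : diag P p ≠ P i := by
  intro heq
  have hp := mem_edgePairs h
  have := (hP.eq_diag_iff hn h (P i)).2 heq.symm
  rw [hP.inc_line_iff hn hp.1.ne, hP.inc_line_iff hn hp.2.1.ne] at this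
  rcases this with ⟨rfl | rfl, h | h⟩ <;> tauto

theorem Tw.map_diag {F : Equiv.Perm X} {q : ℤ} (hF : IsFrob F q) {n : ℕ} {s : Fin n → Fin n}
    {P : Fin n → X} (hP : Tw F s P) {p r : (Fin n × Fin n) × (Fin n × Fin n)}
    (h : (Carries s p.1 r.1 ∧ Carries s p.2 r.2) ∨ (Carries s p.1 r.2 ∧ Carries s p.2 r.1)) :
    F (diag P p) = diag P r := by
  rw [diag, map_join hF]
  rcases h with h | h
  · rw [map_line hF hP h.1, map_line hF hP h.2, diag]
  · rw [map_line hF hP h.1, map_line hF hP h.2, join_comm, diag]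

/-- The number of fixed points on no line of an arc of at most five points. -/
theorem cnt_fix_off {F : Equiv.Perm X} {q : ℤ} (hF : IsFrob F q)
    {n : ℕ} (hn : n ≤ 5) (hn3 : 3 ≤ n) {s : Fin n → Fin n} {P : Fin n → X} (hP : Tw F s P) :
    cnt (fun x => F x = x ∧ Off P x) = q ^ 2 + q + 1
      - ((Finset.univ.filter fun i => s i = i).card : ℤ)
      - ∑ e ∈ (edges n).filter (fun e => Carries s e e), (if s e.1 = e.1 then q - 1 else q + 1)
      + (((edgePairs n).filter fun p => Carries s p.1 p.1 ∧ Carries s p.2 p.2).card : ℤ)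
      - (((edgePairs n).filter fun p => Carries s p.1 p.2 ∧ Carries s p.2 p.1).card : ℤ) := by
  classical
  have hinj := hP.injective hn3
  have hfix : ∀ i, F (P i) = P i ↔ s i = i := fun i => by rw [hP.1, hinj.eq_iff]
  have h0 : cnt (fun x => F x = x ∧ Off P x) =
      cnt (fun x => (F x = x ∧ ∀ i, x ≠ P i) ∧ Off P x) :=
    cnt_congr fun x => ⟨fun h => ⟨⟨h.1, off_ne hn3 hP h.2⟩, h.2⟩, fun h => ⟨h.1.1, h.2⟩⟩
  rw [h0, cnt_off hF hn hn3 hP _ fun x h => h]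
  have h1 : cnt (fun x => F x = x ∧ ∀ i, x ≠ P i) =
      q ^ 2 + q + 1 - ((Finset.univ.filter fun i => s i = i).card : ℤ) := by
    rw [← hF.card_fix, cnt_split (fun x => F x = x) (fun x => ∀ i, x ≠ P i)]
    have : cnt (fun x => F x = x ∧ ¬ ∀ i, x ≠ P i) = cnt (fun i => s i = i) := by
      symm
      refine (cnt_fiber P 1 (fun i hi => ?_) ?_).trans (mul_one _)
      · exact ⟨(hfix i).2 hi, fun h => h i rfl⟩
      · rintro x ⟨h1, h2⟩
        push Not at h2
        obtain ⟨i, rfl⟩ := h2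
        refine cnt_eq_one i fun j => ?_
        constructor
        · exact fun h => hinj h.2
        · rintro rfl
          exact ⟨(hfix _).1 h1, rfl⟩
    have hcard := cnt_eq_card fun i => s i = i
    rw [this, hcard]
    ring
  rw [h1]
  congr 1
  congr 1
  congr 1
  · refine Finset.sum_congr rfl fun e he => ?_
    simp only [edges, Finset.mem_filter, Finset.mem_univ, true_and] at he
    have hl : F (line P e) = line P e := map_line hF hP he.2
    have := hF.card_line _ hl
    have hsplit := cnt_split (fun x => F x = x ∧ Inc x (line P e)) (fun x => ∀ i, x ≠ P i)
    rw [this] at hsplit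
    have hA : cnt (fun x => (F x = x ∧ ∀ i, x ≠ P i) ∧ Inc x (line P e)) =
        cnt (fun x => (F x = x ∧ Inc x (line P e)) ∧ ∀ i, x ≠ P i) :=
      cnt_congr fun x => by tauto
    rw [hA]
    -- the ends of a stable line are fixed or exchanged by `F`
    have hB : cnt (fun x => (F x = x ∧ Inc x (line P e)) ∧ ¬ ∀ i, x ≠ P i) =
        if s e.1 = e.1 then 2 else 0 := by
      split_ifs with hs
      · have hs2 : s e.2 = e.2 := by
          rcases he.2 with h | h
          · exact h.2
          · exact absurd (h.1.symm.trans hs) he.1.ne'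
        have : cnt (fun x => (F x = x ∧ Inc x (line P e)) ∧ ¬ ∀ i, x ≠ P i) =
            cnt (fun x => x = P e.1 ∨ x = P e.2) := by
          refine cnt_congr fun x => ⟨?_, ?_⟩
          · rintro ⟨⟨_, h⟩, h2⟩
            push Not at h2
            obtain ⟨i, rfl⟩ := h2
            rw [hP.inc_line_iff hn3 he.1.ne] at h
            rcases h with rfl | rfl <;> tauto
          · rintro (rfl | rfl)
            · exact ⟨⟨(hfix _).2 hs, inc_join_left (hinj.ne he.1.ne)⟩, fun h => h _ rfl⟩
            · exact ⟨⟨(hfix _).2 hs2, inc_join_right (hinj.ne he.1.ne)⟩, fun h => h _ rfl⟩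
        rw [this, cnt_or, cnt_eq_one _ fun _ => Iff.rfl, cnt_eq_one _ fun _ => Iff.rfl]
        · norm_num
        · rintro x rfl
          exact hinj.ne he.1.ne
      · refine cnt_eq_zero ?_
        rintro x ⟨⟨h1, h2⟩, h3⟩
        push Not at h3
        obtain ⟨i, rfl⟩ := h3
        rw [hP.inc_line_iff hn3 he.1.ne] at h2
        rw [hfix] at h1
        rcases he.2 with h | h
        · exact hs h.1
        · rcases h2 with rfl | rfl
          · exact hs h1
          · exact he.1.ne (h.2.symm.trans h1)
    rw [hB] at hsplit
    split_ifs at hsplit ⊢ <;> linarith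
  · rw [Finset.card_eq_sum_ones]
    push_cast
    refine Finset.sum_congr rfl fun p hp => ?_
    simp only [Finset.mem_filter] at hp
    refine cnt_eq_one (diag P p) fun x => ?_
    rw [hP.eq_diag_iff hn3 hp.1]
    constructor
    · exact fun h => h.2
    · rintro rfl
      exact ⟨⟨hP.map_diag hF (Or.inl hp.2), hP.diag_ne hn3 hp.1⟩, rfl⟩
  · rw [Finset.card_eq_sum_ones]
    push_cast
    refine Finset.sum_congr rfl fun p hp => ?_
    simp only [Finset.mem_filter] at hp
    refine cnt_eq_one (diag P p) fun x => ?_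
    rw [hP.eq_diag_iff hn3 hp.1]
    constructor
    · exact fun h => h.2
    · rintro rfl
      exact ⟨⟨hP.map_diag hF (Or.inr hp.2), hP.diag_ne hn3 hp.1⟩, rfl⟩

/-- The number of fixed points of a fixed line `l`, off the arc, on no line of the arc. -/
theorem cnt_line_off {F : Equiv.Perm X} {q : ℤ} (hF : IsFrob F q)
    {n : ℕ} (hn : n ≤ 5) (hn3 : 3 ≤ n) {s : Fin n → Fin n} {P : Fin n → X} (hP : Tw F s P)
    {l : X} (hl : F l = l) (hlP : ∀ i, ¬ Inc (P i) l) [DecidablePred fun x => Inc x l] :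
    cnt (fun x => (F x = x ∧ Inc x l) ∧ Off P x) = q + 1
      - (((edges n).filter fun e => Carries s e e).card : ℤ)
      + ∑ p ∈ (edgePairs n).filter (fun p => Carries s p.1 p.1 ∧ Carries s p.2 p.2),
          (if Inc (diag P p) l then 1 else 0)
      - ∑ p ∈ (edgePairs n).filter (fun p => Carries s p.1 p.2 ∧ Carries s p.2 p.1),
          (if Inc (diag P p) l then 1 else 0) := by
  have hinj := hP.injective hn3
  rw [cnt_off hF hn hn3 hP _ fun x h => ⟨h.1, fun i hi => hlP i (hi ▸ h.2)⟩, hF.card_line l hl]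
  congr 1
  congr 1
  congr 1
  · rw [Finset.card_eq_sum_ones]
    push_cast
    refine Finset.sum_congr rfl fun e he => ?_
    simp only [edges, Finset.mem_filter, Finset.mem_univ, true_and] at he
    have hne : l ≠ line P e := by
      rintro rfl
      exact hlP e.1 (inc_join_left (hinj.ne he.1.ne))
    refine cnt_eq_one (join l (line P e)) fun x => ?_
    constructor
    · exact fun h => eq_join' hne h.1.2 h.2
    · rintro rfl
      refine ⟨⟨?_, join_inc_left hne⟩, join_inc_right hne⟩
      rw [map_join hF, hl, map_line hF hP he.2]
  · refine Finset.sum_congr rfl fun p hp => ?_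
    simp only [Finset.mem_filter] at hp
    refine cnt_eq_ite (diag P p) _ fun x => ?_
    rw [hP.eq_diag_iff hn3 hp.1]
    constructor
    · rintro ⟨h, rfl⟩
      exact ⟨rfl, h.2⟩
    · rintro ⟨rfl, h⟩
      exact ⟨⟨hP.map_diag hF (Or.inl hp.2), h⟩, rfl⟩
  · refine Finset.sum_congr rfl fun p hp => ?_
    simp only [Finset.mem_filter] at hp
    refine cnt_eq_ite (diag P p) _ fun x => ?_
    rw [hP.eq_diag_iff hn3 hp.1]
    constructor
    · rintro ⟨h, rfl⟩
      exact ⟨rfl, h.2⟩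
    · rintro ⟨rfl, h⟩
      exact ⟨⟨hP.map_diag hF (Or.inr hp.2), h⟩, rfl⟩

/-! ### Adding points to an arc -/

/-- `Off` in terms of collinearity, with no requirement that the points `P i` be distinct. -/
def OffC {n : ℕ} (P : Fin n → X) (x : X) : Prop := ∀ i j, i < j → ¬ Coll (P i) (P j) x

theorem offC_iff {n : ℕ} {P : Fin n → X} (h : Function.Injective P) (x : X) :
    OffC P x ↔ Off P x := by
  unfold OffC Off
  refine forall₃_congr fun i j hij => ?_
  rw [coll_iff (h.ne hij.ne)]

theorem Tw.offC_iff {F : Equiv.Perm X} {n : ℕ} {s : Fin n → Fin n} {P : Fin n → X} (h : Tw F s P)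
    (hn : 3 ≤ n) (x : X) : OffC P x ↔ Off P x :=
  PlaneArcs.offC_iff (h.injective hn) x

/-- No three of the points are collinear exactly if this holds before adding the last point and that
point is on none of the lines joining the others. -/
theorem not_coll_snoc {n : ℕ} (P : Fin n → X) (x : X) :
    (∀ i j k : Fin (n + 1), i < j → j < k → ¬ Coll ((Fin.snoc P x : Fin (n + 1) → X) i)
      ((Fin.snoc P x : Fin (n + 1) → X) j) ((Fin.snoc P x : Fin (n + 1) → X) k)) ↔
    (∀ i j k, i < j → j < k → ¬ Coll (P i) (P j) (P k)) ∧ OffC P x := by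
  simp only [Fin.forall_fin_succ', Fin.snoc_castSucc, Fin.snoc_last, OffC]
  constructor
  · rintro ⟨h1, _⟩
    refine ⟨fun i j k hij hjk => ?_, fun i j hij => ?_⟩
    · exact ((h1 i).1 j).1 k (Fin.castSucc_lt_castSucc_iff.2 hij) (Fin.castSucc_lt_castSucc_iff.2 hjk)
    · exact ((h1 i).1 j).2 (Fin.castSucc_lt_castSucc_iff.2 hij) (Fin.castSucc_lt_last j)
  · rintro ⟨h1, h2⟩
    refine ⟨fun i => ⟨fun j => ⟨fun k hij hjk => ?_, fun hij _ => ?_⟩, ⟨fun k _ h => ?_, fun _ h => ?_⟩⟩,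
      ⟨fun j => ⟨fun k h => ?_, fun h => ?_⟩, fun k h => ?_, fun h => ?_⟩⟩
    · exact h1 i j k (Fin.castSucc_lt_castSucc_iff.1 hij) (Fin.castSucc_lt_castSucc_iff.1 hjk)
    · exact h2 i j (Fin.castSucc_lt_castSucc_iff.1 hij)
    · exact absurd h (Fin.castSucc_lt_last k).not_gt
    · exact absurd h (lt_irrefl _)
    · exact absurd h (Fin.castSucc_lt_last j).not_gt
    · exact absurd h (Fin.castSucc_lt_last j).not_gt
    · exact absurd h (lt_irrefl _)
    · exact absurd h (lt_irrefl _)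

theorem offC_snoc {n : ℕ} (P : Fin n → X) (x y : X) :
    OffC (Fin.snoc P x : Fin (n + 1) → X) y ↔ OffC P y ∧ ∀ i, ¬ Coll (P i) x y := by
  simp only [OffC, Fin.forall_fin_succ', Fin.snoc_castSucc, Fin.snoc_last]
  constructor
  · rintro ⟨h1, _⟩
    refine ⟨fun i j hij => ?_, fun i => ?_⟩
    · exact (h1 i).1 j (Fin.castSucc_lt_castSucc_iff.2 hij)
    · exact (h1 i).2 (Fin.castSucc_lt_last i)
  · rintro ⟨h1, h2⟩
    refine ⟨fun i => ⟨fun j hij => ?_, fun _ => h2 i⟩, fun k h => ?_, fun h => ?_⟩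
    · exact h1 i j (Fin.castSucc_lt_castSucc_iff.1 hij)
    · exact absurd h (Fin.castSucc_lt_last k).not_gt
    · exact absurd h (lt_irrefl _)

/-- Adding a fixed point to an arc. -/
theorem tw_snoc {F : Equiv.Perm X} {n : ℕ} (s : Fin n → Fin n) (s' : Fin (n + 1) → Fin (n + 1))
    (h : ∀ i, s' i.castSucc = (s i).castSucc) (hl : s' (Fin.last n) = Fin.last n)
    (P : Fin n → X) (x : X) :
    Tw F s' (Fin.snoc P x) ↔ Tw F s P ∧ F x = x ∧ OffC P x := by
  unfold Tw
  rw [not_coll_snoc, Fin.forall_fin_succ']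
  simp only [h, hl, Fin.snoc_castSucc, Fin.snoc_last]
  tauto

/-- Adding a pair of conjugate points to an arc. -/
theorem tw_snoc_snoc {F : Equiv.Perm X} {n : ℕ} (s : Fin n → Fin n)
    (s' : Fin (n + 2) → Fin (n + 2))
    (h : ∀ i, s' (Fin.castSucc (Fin.castSucc i)) = (Fin.castSucc (Fin.castSucc (s i))))
    (h1 : s' (Fin.last n).castSucc = Fin.last (n + 1))
    (h2 : s' (Fin.last (n + 1)) = (Fin.last n).castSucc) (P : Fin n → X) (x y : X) :
    Tw F s' (Fin.snoc (Fin.snoc P x : Fin (n + 1) → X) y) ↔ Tw F s P ∧ (F x = y ∧ F y = x) ∧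
      OffC P x ∧ OffC P y ∧ ∀ i, ¬ Coll (P i) x y := by
  unfold Tw
  rw [not_coll_snoc, not_coll_snoc, offC_snoc]
  simp only [Fin.forall_fin_succ', h, h1, h2, Fin.snoc_castSucc, Fin.snoc_last]
  tauto

/-- Adding a triple of conjugate points to an arc. -/
theorem tw_snoc_snoc_snoc {F : Equiv.Perm X} {n : ℕ} (s : Fin n → Fin n)
    (s' : Fin (n + 3) → Fin (n + 3))
    (h : ∀ i, s' (Fin.castSucc (Fin.castSucc (Fin.castSucc i))) =
      (Fin.castSucc (Fin.castSucc (Fin.castSucc (s i)))))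
    (h1 : s' (Fin.last n).castSucc.castSucc = (Fin.last (n + 1)).castSucc)
    (h2 : s' (Fin.last (n + 1)).castSucc = Fin.last (n + 2))
    (h3 : s' (Fin.last (n + 2)) = (Fin.last n).castSucc.castSucc) (P : Fin n → X) (x y z : X) :
    Tw F s' (Fin.snoc (Fin.snoc (Fin.snoc P x : Fin (n + 1) → X) y : Fin (n + 2) → X) z) ↔
      Tw F s P ∧ (F x = y ∧ F y = z ∧ F z = x) ∧ OffC P x ∧ OffC P y ∧ OffC P z ∧
      (∀ i, ¬ Coll (P i) x y) ∧ (∀ i, ¬ Coll (P i) y z) ∧ (∀ i, ¬ Coll (P i) x z) ∧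
      ¬ Coll x y z := by
  unfold Tw
  rw [not_coll_snoc, not_coll_snoc, not_coll_snoc, offC_snoc, offC_snoc, offC_snoc]
  simp only [Fin.forall_fin_succ', h, h1, h2, h3, Fin.snoc_castSucc, Fin.snoc_last]
  tauto

theorem cnt_snoc {n : ℕ} (p : (Fin (n + 1) → X) → Prop) :
    cnt p = cnt (fun u : (Fin n → X) × X => p (Fin.snoc u.1 u.2)) := by
  refine cnt_bij (fun P => (Fin.init P, P (Fin.last n))) (fun u => Fin.snoc u.1 u.2) ?_ ?_ ?_ ?_
  · intro P hP
    simpa using hP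
  · exact fun u hu => hu
  · intro P _
    simp
  · intro u _
    simp

theorem numTw_snoc {F : Equiv.Perm X} {n : ℕ} (s : Fin n → Fin n)
    (s' : Fin (n + 1) → Fin (n + 1))
    (h : ∀ i, s' i.castSucc = (s i).castSucc) (hl : s' (Fin.last n) = Fin.last n) (c : ℤ)
    (hc : ∀ P : Fin n → X, Tw F s P → cnt (fun x => F x = x ∧ OffC P x) = c) :
    numTw (X := X) F s' = numTw (X := X) F s * c := by
  rw [numTw, cnt_snoc, numTw, ← cnt_sigma _ _ c hc]
  exact cnt_congr fun u => tw_snoc s s' h hl _ _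

/-! ### Points on no fixed line -/

/-- `x` is fixed by `F'` and lies on no line fixed by `F`. -/
def Gen (F F' : Equiv.Perm X) (x : X) : Prop := F' x = x ∧ ∀ l, F l = l → ¬ Inc x l

theorem IsFrob.exists_line {F : Equiv.Perm X} {q : ℤ} (hF : IsFrob F q) {x : X} (hx : F x = x) :
    ∃ l, F l = l ∧ Inc x l := by
  by_contra! h
  have := hF.card_line x hx
  rw [cnt_eq_zero] at this
  · linarith [hF.one_lt]
  · exact fun l hl => h l hl.1 (PolarPlane.symm hl.2)

/-- A point of a fixed line that is not fixed lies on no other fixed line. -/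
theorem IsFrob.fix_line_unique {F : Equiv.Perm X} {q : ℤ} (hF : IsFrob F q) {x l m : X}
    (hx : F x ≠ x) (hl : F l = l) (hm : F m = m) (hxl : Inc x l) (hxm : Inc x m) : l = m := by
  by_contra h
  apply hx
  rw [eq_join' h hxl hxm, map_join hF, hl, hm]

/-- A line through a point `x` and its image that contains the next image also is fixed, if these
points are distinct. -/
theorem IsFrob.fix_of_inc {F : Equiv.Perm X} {q : ℤ} (hF : IsFrob F q) {x l : X}
    (hx : F x ≠ x) (h1 : Inc x l) (h2 : Inc (F x) l) (h3 : Inc (F (F x)) l) : F l = l :=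
  line_unique (F.injective.ne hx) ((hF.inc_iff _ _).2 h2) ((hF.inc_iff _ _).2 h1) h3 h2

/-- Points on no fixed line are what remains when the fixed points and the other points on fixed
lines are removed; each of the latter lies on a single fixed line, each of which has `q' - q` of
them. -/
theorem cnt_gen {F F' : Equiv.Perm X} {q q' : ℤ} (hF : IsFrob F q) (hF' : IsFrob F' q')
    (h : ∀ x, F x = x → F' x = x) :
    cnt (Gen F F') = q' ^ 2 + q' + 1 - (q ^ 2 + q + 1) - (q ^ 2 + q + 1) * (q' - q) := by
  rw [← hF'.card_fix, cnt_split (fun x => F' x = x) (fun x => ∀ l, F l = l → ¬ Inc x l),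
    cnt_split (fun x => F' x = x ∧ ¬ ∀ l, F l = l → ¬ Inc x l) (fun x => F x = x)]
  have h1 : cnt (fun x => (F' x = x ∧ ¬ ∀ l, F l = l → ¬ Inc x l) ∧ F x = x) = q ^ 2 + q + 1 := by
    rw [← hF.card_fix]
    refine cnt_congr fun x => ⟨fun h => h.2, fun hx => ⟨⟨h x hx, ?_⟩, hx⟩⟩
    push Not
    exact hF.exists_line hx
  have h2 : cnt (fun x => (F' x = x ∧ ¬ ∀ l, F l = l → ¬ Inc x l) ∧ ¬ F x = x) =
      (q ^ 2 + q + 1) * (q' - q) := by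
    have hline : ∀ l, F l = l → cnt (fun x => (F' x = x ∧ Inc x l) ∧ ¬ F x = x) = q' - q := by
      intro l hl
      have a := hF'.card_line l (h l hl)
      rw [cnt_split _ (fun x => F x = x)] at a
      have b := hF.card_line l hl
      have e : cnt (fun x => (F' x = x ∧ Inc x l) ∧ F x = x) = cnt (fun x => F x = x ∧ Inc x l) :=
        cnt_congr fun x => ⟨fun k => ⟨k.2, k.1.2⟩, fun k => ⟨⟨h x k.1, k.2⟩, k.1⟩⟩
      linarith
    rw [← hF.card_fix, ← cnt_sigma (fun l => F l = l) _ _ hline]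
    symm
    refine (cnt_fiber (fun u => u.2) 1 ?_ ?_).trans (mul_one _)
    · rintro ⟨l, x⟩ ⟨h1, ⟨h2, h3⟩, h4⟩
      exact ⟨⟨h2, fun h => h l h1 h3⟩, h4⟩
    · rintro x ⟨⟨h1, h2⟩, h3⟩
      push Not at h2
      obtain ⟨l, hl, hxl⟩ := h2
      refine cnt_eq_one (l, x) ?_
      rintro ⟨m, y⟩
      constructor
      · rintro ⟨⟨a, ⟨_, b⟩, _⟩, rfl⟩
        simp only at a b h3
        rw [hF.fix_line_unique h3 hl a hxl b]
      · intro h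
        rw [Prod.mk.injEq] at h
        obtain ⟨rfl, rfl⟩ := h
        exact ⟨⟨hl, ⟨h1, hxl⟩, h3⟩, rfl⟩
  rw [h1, h2]
  unfold Gen
  ring

/-! ### Arcs that are a single orbit -/

/-- The order of `PGL₃` over the field with `q` elements. -/
def pglCard (q : ℤ) : ℤ := q ^ 3 * (q ^ 3 - 1) * (q ^ 2 - 1)

theorem gen_ne {F F' : Equiv.Perm X} {q : ℤ} (hF : IsFrob F q) {x : X} (hx : Gen F F' x) :
    F x ≠ x := by
  intro h
  obtain ⟨l, hl, hxl⟩ := hF.exists_line h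
  exact hx.2 l hl hxl

/-- A cyclically permuted family is determined by its first point. -/
theorem cnt_cycle {F : Equiv.Perm X} {n : ℕ} [NeZero n] (p : X → Prop) :
    cnt (fun P : Fin n → X => (∀ i, F (P i) = P (i + 1)) ∧ p (P 0)) =
      cnt (fun x => (F ^ n) x = x ∧ p x) := by
  have hpow : ∀ P : Fin n → X, (∀ i, F (P i) = P (i + 1)) →
      ∀ m (hm : m < n), (F ^ m) (P 0) = P ⟨m, hm⟩ := by
    intro P hP m hm
    induction m with
    | zero => rfl
    | succ m ih =>
      rw [pow_succ', Equiv.Perm.mul_apply, ih (by omega), hP]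
      congr 1
      apply Fin.ext
      simp only [Fin.val_add]
      rw [Fin.coe_ofNat_eq_mod, Nat.mod_eq_of_lt (show 1 < n by omega), Nat.mod_eq_of_lt hm]
  refine cnt_bij (fun P => P 0) (fun x i => (F ^ (i : ℕ)) x) ?_ ?_ ?_ ?_
  · rintro P ⟨h, h'⟩
    refine ⟨?_, h'⟩
    obtain ⟨m, rfl⟩ : ∃ m, n = m + 1 := ⟨n - 1, by have := NeZero.pos n; omega⟩
    rw [pow_succ', Equiv.Perm.mul_apply, hpow P h m (by omega), h]
    congr 1
    exact Fin.last_add_one m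
  · rintro x ⟨h, h'⟩
    refine ⟨fun i => ?_, by simpa using h'⟩
    obtain ⟨m, rfl⟩ : ∃ m, n = m + 1 := ⟨n - 1, by have := NeZero.pos n; omega⟩
    show F ((F ^ (i : ℕ)) x) = _
    rw [← Equiv.Perm.mul_apply, ← pow_succ']
    by_cases hi : i = Fin.last m
    · subst hi
      simp only [Fin.last_add_one, Fin.val_last]
      simpa using h
    · show _ = (F ^ ((i + 1 : Fin (m + 1)) : ℕ)) x
      rw [Fin.val_add_one_of_lt (lt_of_le_of_ne (Fin.le_last i) hi)]
  · rintro P ⟨h, _⟩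
    funext i
    exact hpow P h i i.2
  · intro x _
    simp

/-- The points with labels in `t` lie on a common line. -/
def OnLine {n : ℕ} (P : Fin n → X) (t : Finset (Fin n)) : Prop := ∃ l, ∀ i ∈ t, Inc (P i) l

theorem coll_iff_onLine {n : ℕ} (P : Fin n → X) (i j k : Fin n) :
    Coll (P i) (P j) (P k) ↔ OnLine P {i, j, k} := by
  simp [Coll, OnLine]

theorem fix_of_pow {F : Equiv.Perm X} {l : X} {a b : ℕ} (hab : a.Coprime b) (ha : (F ^ a) l = l)
    (hb : (F ^ b) l = l) : F l = l := by
  have h1 : Function.IsPeriodicPt F a l := by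
    rw [Function.IsPeriodicPt, Function.IsFixedPt, ← Equiv.Perm.coe_pow]; exact ha
  have h2 : Function.IsPeriodicPt F b l := by
    rw [Function.IsPeriodicPt, Function.IsFixedPt, ← Equiv.Perm.coe_pow]; exact hb
  have := h1.gcd h2
  rw [hab.gcd_eq_one] at this
  exact this

theorem pow_fix {F : Equiv.Perm X} {x : X} (h : F x = x) (k : ℕ) : (F ^ k) x = x := by
  induction k with
  | zero => rfl
  | succ k ih => rw [pow_succ, Equiv.Perm.mul_apply, h, ih]

/-- On a line through three points of a cycle in arithmetic progression with difference prime to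
the length of the cycle, there is the whole cycle, and the line is fixed. -/
theorem not_coll_progression {F : Equiv.Perm X} {q Q Q' : ℤ} (hF : IsFrob F q) {x : X} {n a : ℕ}
    (hFn : IsFrob (F ^ n) Q') (hFa : IsFrob (F ^ a) Q) (hx : Gen F (F ^ n) x)
    (han : a.Coprime n) : ¬ Coll x ((F ^ a) x) ((F ^ a) ((F ^ a) x)) := by
  rintro ⟨l, h1, h2, h3⟩
  have hne : (F ^ a) x ≠ x := fun h => gen_ne hF hx (fix_of_pow han h hx.1)
  have ha := hFa.fix_of_inc hne h1 h2 h3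
  have hn : (F ^ n) l = l := by
    have hcomm : (F ^ n) ((F ^ a) x) = (F ^ a) x := by
      rw [← Equiv.Perm.mul_apply, ← pow_add, add_comm, pow_add, Equiv.Perm.mul_apply, hx.1]
    rw [eq_join hne.symm h1 h2, map_join hFn, hx.1, hcomm]
  exact hx.2 l (fix_of_pow han ha hn) h1

theorem Gen.map {F : Equiv.Perm X} {q : ℤ} (hF : IsFrob F q) {n : ℕ} {x : X}
    (hx : Gen F (F ^ n) x) : Gen F (F ^ n) (F x) := by
  refine ⟨?_, fun l hl h => hx.2 l hl ?_⟩
  · rw [← Equiv.Perm.mul_apply, ← pow_succ, pow_succ', Equiv.Perm.mul_apply, hx.1]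
  · rwa [← hl, hF.inc_iff] at h

theorem cycle_gen {F : Equiv.Perm X} {q : ℤ} (hF : IsFrob F q) {n : ℕ} [NeZero n]
    {P : Fin n → X} (h : ∀ i, F (P i) = P (i + 1)) {m : ℕ} (h0 : Gen F (F ^ m) (P 0)) (i : Fin n) :
    Gen F (F ^ m) (P i) := by
  obtain ⟨k, rfl⟩ : ∃ k, n = k + 1 := ⟨n - 1, by have := NeZero.pos n; omega⟩
  induction i using Fin.induction with
  | zero => exact h0
  | succ i ih =>
    rw [← Fin.coeSucc_eq_succ, ← h]
    exact ih.map hF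

theorem cycle_period {F : Equiv.Perm X} {n : ℕ} [NeZero n]
    {P : Fin n → X} (h : ∀ i, F (P i) = P (i + 1)) : (F ^ n) (P 0) = P 0 := by
  have := cnt_cycle (F := F) (n := n) (fun x => x = P 0)
  by_contra hne
  rw [cnt_eq_zero (p := fun x => (F ^ n) x = x ∧ x = P 0) (by rintro x ⟨h, rfl⟩; exact hne h)] at this
  classical
  rw [cnt_eq_card] at this
  have := Finset.card_eq_zero.1 (by exact_mod_cast this)
  have hP : P ∈ Finset.univ.filter
    (fun Q : Fin n → X => (∀ i, F (Q i) = Q (i + 1)) ∧ Q 0 = P 0) := by simp [h]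
  rw [this] at hP
  simp at hP

/-- A cycle of at least three points no three of which are collinear meets no fixed line. -/
theorem cycle_gen_of_not_coll {F : Equiv.Perm X} {q : ℤ} (hF : IsFrob F q) {n : ℕ} [NeZero n]
    {P : Fin n → X} (h : ∀ i, F (P i) = P (i + 1)) (h3 : ¬ Coll (P 0) (P 1) (P (1 + 1))) :
    Gen F (F ^ n) (P 0) := by
  refine ⟨cycle_period h, fun l hl h0 => h3 ⟨l, h0, ?_, ?_⟩⟩
  · rw [← zero_add (1 : Fin n), ← h, ← hl, hF.inc_iff]
    exact h0
  · rw [← h, ← zero_add (1 : Fin n), ← h, ← hl, hF.inc_iff, ← hl, hF.inc_iff]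
    exact h0

theorem fin_three_triple : ∀ i j k : Fin 3, i < j → j < k →
    ∃ m, ({i, j, k} : Finset (Fin 3)) = {m, m + 1, m + 1 + 1} := by decide

theorem fin_four_triple : ∀ i j k : Fin 4, i < j → j < k →
    ∃ m, ({i, j, k} : Finset (Fin 4)) = {m, m + 1, m + 1 + 1} := by decide

theorem fin_five_triple : ∀ i j k : Fin 5, i < j → j < k →
    ∃ m, ({i, j, k} : Finset (Fin 5)) = {m, m + 1, m + 1 + 1} ∨
      ({i, j, k} : Finset (Fin 5)) = {m, m + 1 + 1, m + 1 + 1 + 1 + 1} := by decide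

/-- Cyclically permuted arcs of three, four or five points correspond to points on no fixed
line. -/
theorem numTw_cycle {F : Equiv.Perm X} {q : ℤ} (hF : ∀ k, 1 ≤ k → k ≤ 7 → IsFrob (F ^ k) (q ^ k))
    {n : ℕ} [NeZero n] (hn : n = 3 ∨ n = 4 ∨ n = 5) (s : Fin n → Fin n) (hs : ∀ i, s i = i + 1) :
    numTw (X := X) F s = (q ^ n) ^ 2 + q ^ n + 1 - (q ^ 2 + q + 1)
      - (q ^ 2 + q + 1) * (q ^ n - q) := by
  have h1 : IsFrob F q := by simpa using hF 1 le_rfl (by norm_num)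
  have hFn : IsFrob (F ^ n) (q ^ n) := hF n (by omega) (by omega)
  rw [← cnt_gen h1 hFn (fun x hx => pow_fix hx n)]
  rw [show cnt (Gen F (F ^ n)) = cnt (fun x => (F ^ n) x = x ∧ ∀ l, F l = l → ¬ Inc x l) from rfl,
    ← cnt_cycle]
  refine cnt_congr fun P => ?_
  unfold Tw
  simp only [hs]
  refine and_congr_right fun h => ?_
  have hgen : Gen F (F ^ n) (P 0) ↔ ∀ l, F l = l → ¬ Inc (P 0) l :=
    ⟨fun h => h.2, fun h' => ⟨cycle_period h, h'⟩⟩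
  rw [← hgen]
  constructor
  · intro hP
    refine cycle_gen_of_not_coll h1 h ?_
    refine hP 0 1 (1 + 1) ?_ ?_ <;>
    · simp only [Fin.lt_def, Fin.val_add, Fin.coe_ofNat_eq_mod]
      rcases hn with rfl | rfl | rfl <;> norm_num
  · intro hg i j k hij hjk
    rw [coll_iff_onLine]
    have ap1 : ∀ i, ¬ OnLine P {i, i + 1, i + 1 + 1} := by
      intro i
      rw [← coll_iff_onLine]
      simp only [← h]
      simpa using not_coll_progression h1 hFn (a := 1) (by simpa using h1) (cycle_gen h1 h hg i)
        (by simp)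
    rcases hn with rfl | rfl | rfl
    · have := fin_three_triple
      obtain ⟨m, hm⟩ := this i j k hij hjk
      rw [hm]
      exact ap1 m
    · have := fin_four_triple
      obtain ⟨m, hm⟩ := this i j k hij hjk
      rw [hm]
      exact ap1 m
    · have := fin_five_triple
      have ap2 : ∀ i, ¬ OnLine P {i, i + 1 + 1, i + 1 + 1 + 1 + 1} := by
        intro i
        rw [← coll_iff_onLine]
        simp only [← h]
        simpa [pow_two] using not_coll_progression h1 hFn (a := 2)
          (hF 2 (by norm_num) (by norm_num)) (cycle_gen h1 h hg i) (by norm_num)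
      obtain ⟨m, hm | hm⟩ := this i j k hij hjk
      · rw [hm]
        exact ap1 m
      · rw [hm]
        exact ap2 m

/-! ### Frames -/

theorem IsFrob.cnt_conj {F F' : Equiv.Perm X} {q q' : ℤ} (hF : IsFrob F q) (hF' : IsFrob F' q')
    (h : ∀ x, F x = x → F' x = x) :
    cnt (fun x => F' x = x ∧ F x ≠ x) = q' ^ 2 + q' + 1 - (q ^ 2 + q + 1) := by
  rw [← hF.card_fix, ← hF'.card_fix, cnt_split (fun x => F' x = x) (fun x => F x = x),
    cnt_congr (p := fun x => F' x = x ∧ F x = x) (r := fun x => F x = x)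
      fun x => ⟨fun k => k.2, fun k => ⟨h x k, k⟩⟩]
  ring

theorem IsFrob.cnt_line_conj {F F' : Equiv.Perm X} {q q' : ℤ} (hF : IsFrob F q)
    (hF' : IsFrob F' q') (h : ∀ x, F x = x → F' x = x) {l : X} (hl : F l = l) :
    cnt (fun x => (F' x = x ∧ F x ≠ x) ∧ Inc x l) = q' - q := by
  have a := hF.card_line l hl
  have b := hF'.card_line l (h l hl)
  rw [cnt_split _ (fun x => F x = x)] at b
  rw [cnt_congr (r := fun x => (F' x = x ∧ Inc x l) ∧ ¬ F x = x) fun x => by tauto]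
  rw [cnt_congr (p := fun x => (F' x = x ∧ Inc x l) ∧ F x = x) (r := fun x => F x = x ∧ Inc x l)
      fun x => ⟨fun k => ⟨k.2, k.1.2⟩, fun k => ⟨⟨h x k.1, k.2⟩, k.1⟩⟩] at b
  linarith

theorem IsFrob.cnt_not_line {F : Equiv.Perm X} {q : ℤ} (hF : IsFrob F q) {l : X} (hl : F l = l) :
    cnt (fun x => F x = x ∧ ¬ Inc x l) = q ^ 2 := by
  have a := hF.card_line l hl
  have b := hF.card_fix
  rw [cnt_split _ (fun x => Inc x l)] at b
  linarith

/-- The pairs of distinct points on which `F` acts through `s`. -/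
noncomputable def numPairs (F : Equiv.Perm X) (s : Fin 2 → Fin 2) : ℤ :=
  cnt (fun u : Fin 2 → X => (∀ i, F (u i) = u (s i)) ∧ u 0 ≠ u 1)

theorem numPairs_id {F : Equiv.Perm X} {q : ℤ} (hF : IsFrob F q) :
    numPairs (X := X) F ![0, 1] = (q ^ 2 + q + 1) * (q ^ 2 + q) := by
  have h : ∀ x : X, F x = x → cnt (fun y => F y = y ∧ y ≠ x) = q ^ 2 + q := by
    intro x hx
    rw [cnt_ne (p := fun y => F y = y) hx, hF.card_fix]
    ring
  rw [← hF.card_fix, ← cnt_sigma _ _ _ h]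
  refine cnt_bij (fun u => (u 0, u 1)) (fun p => ![p.1, p.2]) ?_ ?_ ?_ ?_
  · rintro u ⟨hu, hne⟩
    exact ⟨hu 0, hu 1, hne.symm⟩
  · rintro ⟨x, y⟩ ⟨h1, h2, h3⟩
    exact ⟨fun i => by fin_cases i <;> assumption, h3.symm⟩
  · intro u _
    funext i
    fin_cases i <;> rfl
  · exact fun _ _ => rfl

theorem numPairs_swap {F : Equiv.Perm X} {q : ℤ} (hF : IsFrob F q) (hF2 : IsFrob (F ^ 2) (q ^ 2)) :
    numPairs (X := X) F ![1, 0] = q ^ 4 - q := by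
  have := hF.cnt_conj hF2 fun x hx => pow_fix hx 2
  rw [show q ^ 4 - q = (q ^ 2) ^ 2 + q ^ 2 + 1 - (q ^ 2 + q + 1) by ring, ← this]
  refine cnt_bij (fun u => u 0) (fun x => ![x, F x]) ?_ ?_ ?_ ?_
  · rintro u ⟨hu, hne⟩
    have h0 := hu 0
    have h1 := hu 1
    simp only [Matrix.cons_val_zero, Matrix.cons_val_one] at h0 h1
    refine ⟨?_, ?_⟩
    · rw [pow_two, Equiv.Perm.mul_apply, h0, h1]
    · rw [h0]
      exact hne.symm
  · rintro x ⟨h1, h2⟩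
    refine ⟨fun i => ?_, h2.symm⟩
    fin_cases i
    · rfl
    · exact h1
  · rintro u ⟨hu, _⟩
    funext i
    fin_cases i
    · rfl
    · exact hu 0
  · exact fun _ _ => rfl

theorem pair_line_fix {F : Equiv.Perm X} {q : ℤ} (hF : IsFrob F q) {s : Fin 2 → Fin 2}
    {u : Fin 2 → X} (h1 : ∀ i, F (u i) = u (s i)) (h2 : u 0 ≠ u 1) :
    F (join (u 0) (u 1)) = join (u 0) (u 1) := by
  have hs : s 0 ≠ s 1 := fun h => h2 (F.injective (by rw [h1, h1, h]))
  rw [map_join hF, h1, h1]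
  have : ∀ a b : Fin 2, a ≠ b → (a = 0 ∧ b = 1) ∨ (a = 1 ∧ b = 0) := by decide
  rcases this _ _ hs with h | h
  · rw [h.1, h.2]
  · rw [h.1, h.2, join_comm]

/-- A pair spans a fixed line, and the third point is a fixed point off this line. -/
theorem numTw_three {F : Equiv.Perm X} {q : ℤ} (hF : IsFrob F q) (s : Fin 2 → Fin 2)
    (s' : Fin 3 → Fin 3) (h : ∀ i, s' i.castSucc = (s i).castSucc) (hl : s' 2 = 2) :
    numTw (X := X) F s' = numPairs (X := X) F s * q ^ 2 := by
  have hc : ∀ u : Fin 2 → X, (∀ i, F (u i) = u (s i)) ∧ u 0 ≠ u 1 →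
      cnt (fun x => F x = x ∧ ¬ Inc x (join (u 0) (u 1))) = q ^ 2 :=
    fun u hu => hF.cnt_not_line (pair_line_fix hF hu.1 hu.2)
  rw [numTw, cnt_snoc, numPairs, ← cnt_sigma _ _ _ hc]
  refine cnt_congr fun ⟨u, x⟩ => ?_
  rw [tw_snoc s s' h hl]
  have h0 : OffC u x ↔ ¬ Coll (u 0) (u 1) x := by
    constructor
    · exact fun h => h 0 1 (by decide)
    · intro h i j hij
      have : ∀ a b : Fin 2, a < b → a = 0 ∧ b = 1 := by decide
      rw [(this i j hij).1, (this i j hij).2]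
      exact h
  have htriv : Tw F s u ↔ ∀ i, F (u i) = u (s i) := by
    refine ⟨fun h => h.1, fun h => ⟨h, fun i j k => ?_⟩⟩
    omega
  simp only [h0, htriv]
  by_cases hne : u 0 = u 1
  · refine iff_of_false (fun h => h.2.2 ?_) fun h => h.1.2 hne
    rw [hne]
    exact coll_self_left _ _
  · rw [coll_iff hne]
    simp only [ne_eq, hne, not_false_iff, and_true]

theorem cnt_fix_offC {F : Equiv.Perm X} {q : ℤ} (hF : IsFrob F q)
    {n : ℕ} (hn : n ≤ 5) (hn3 : 3 ≤ n) {s : Fin n → Fin n} {P : Fin n → X} (hP : Tw F s P) :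
    cnt (fun x => F x = x ∧ OffC P x) = q ^ 2 + q + 1
      - ((Finset.univ.filter fun i => s i = i).card : ℤ)
      - ∑ e ∈ (edges n).filter (fun e => Carries s e e), (if s e.1 = e.1 then q - 1 else q + 1)
      + (((edgePairs n).filter fun p => Carries s p.1 p.1 ∧ Carries s p.2 p.2).card : ℤ)
      - (((edgePairs n).filter fun p => Carries s p.1 p.2 ∧ Carries s p.2 p.1).card : ℤ) := by
  rw [← cnt_fix_off hF hn hn3 hP]
  exact cnt_congr fun x => and_congr_right fun _ => hP.offC_iff hn3 x

/-- `cnt_fix_offC` with the five combinatorial constants of the permutation `s` made explicit: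
its fixed labels, the stable edges with fixed and with exchanged ends, and the pairs of disjoint
edges that are stable and that are exchanged. -/
theorem cnt_fix_offC' {F : Equiv.Perm X} {q : ℤ} (hF : IsFrob F q)
    {n : ℕ} (hn : n ≤ 5) (hn3 : 3 ≤ n) {s : Fin n → Fin n} {P : Fin n → X} (hP : Tw F s P)
    (a b c d e : ℕ) (ha : (Finset.univ.filter fun i => s i = i).card = a)
    (hb : ((edges n).filter (fun e => Carries s e e ∧ s e.1 = e.1)).card = b)
    (hc : ((edges n).filter (fun e => Carries s e e ∧ ¬ s e.1 = e.1)).card = c)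
    (hd : ((edgePairs n).filter fun p => Carries s p.1 p.1 ∧ Carries s p.2 p.2).card = d)
    (he : ((edgePairs n).filter fun p => Carries s p.1 p.2 ∧ Carries s p.2 p.1).card = e) :
    cnt (fun x => F x = x ∧ OffC P x) =
      q ^ 2 + q + 1 - a - (b * (q - 1) + c * (q + 1)) + d - e := by
  rw [cnt_fix_offC hF hn hn3 hP, ha, hd, he, Finset.sum_ite, Finset.filter_filter,
    Finset.filter_filter, Finset.sum_const, Finset.sum_const, hb, hc]
  simp

theorem numTw_frame_id {F : Equiv.Perm X} {q : ℤ} (hF : IsFrob F q) :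
    numTw (X := X) F ![0, 1, 2, 3] = pglCard q := by
  rw [numTw_snoc ![0, 1, 2] ![0, 1, 2, 3] (by decide) (by decide) (q ^ 2 - 2 * q + 1),
    numTw_three hF ![0, 1] ![0, 1, 2] (by decide) (by decide), numPairs_id hF, pglCard]
  · ring
  · intro P hP
    rw [cnt_fix_offC' hF (by norm_num) (by norm_num) hP 3 3 0 0 0 (by decide) (by decide)
      (by decide) (by decide) (by decide)]
    push_cast
    ring

theorem numTw_frame_two {F : Equiv.Perm X} {q : ℤ} (hF : IsFrob F q)
    (hF2 : IsFrob (F ^ 2) (q ^ 2)) : numTw (X := X) F ![1, 0, 2, 3] = pglCard q := by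
  rw [numTw_snoc ![1, 0, 2] ![1, 0, 2, 3] (by decide) (by decide) (q ^ 2 - 1),
    numTw_three hF ![1, 0] ![1, 0, 2] (by decide) (by decide), numPairs_swap hF hF2, pglCard]
  · ring
  · intro P hP
    rw [cnt_fix_offC' hF (by norm_num) (by norm_num) hP 1 0 1 0 0 (by decide) (by decide)
      (by decide) (by decide) (by decide)]
    push_cast
    ring

theorem numTw_frame_three {F : Equiv.Perm X} {q : ℤ}
    (hF : ∀ k, 1 ≤ k → k ≤ 7 → IsFrob (F ^ k) (q ^ k)) :
    numTw (X := X) F ![1, 2, 0, 3] = pglCard q := by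
  have h1 : IsFrob F q := by simpa using hF 1 le_rfl (by norm_num)
  rw [numTw_snoc ![1, 2, 0] ![1, 2, 0, 3] (by decide) (by decide) (q ^ 2 + q + 1),
    numTw_cycle hF (by norm_num) ![1, 2, 0] (by decide), pglCard]
  · ring
  · intro P hP
    rw [cnt_fix_offC' h1 (by norm_num) (by norm_num) hP 0 0 0 0 0 (by decide) (by decide)
      (by decide) (by decide) (by decide)]
    push_cast
    ring

theorem numTw_frame_four {F : Equiv.Perm X} {q : ℤ}
    (hF : ∀ k, 1 ≤ k → k ≤ 7 → IsFrob (F ^ k) (q ^ k)) :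
    numTw (X := X) F ![1, 2, 3, 0] = pglCard q := by
  rw [numTw_cycle hF (by norm_num) ![1, 2, 3, 0] (by decide), pglCard]
  ring

theorem numTw_five_cycle {F : Equiv.Perm X} {q : ℤ}
    (hF : ∀ k, 1 ≤ k → k ≤ 7 → IsFrob (F ^ k) (q ^ k)) :
    numTw (X := X) F ![1, 2, 3, 4, 0] = pglCard q * (q ^ 2 + 1) := by
  rw [numTw_cycle hF (by norm_num) ![1, 2, 3, 4, 0] (by decide), pglCard]
  ring

theorem cnt_snoc_snoc {n : ℕ} (p : (Fin (n + 2) → X) → Prop) :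
    cnt p = cnt (fun u : (Fin n → X) × (X × X) =>
      p (Fin.snoc (Fin.snoc u.1 u.2.1 : Fin (n + 1) → X) u.2.2)) := by
  rw [cnt_snoc, cnt_bij (r := fun u : (Fin n → X) × (X × X) =>
      p (Fin.snoc (Fin.snoc u.1 u.2.1 : Fin (n + 1) → X) u.2.2))
    (fun u => (Fin.init u.1, (u.1 (Fin.last n), u.2)))
    (fun u => ((Fin.snoc u.1 u.2.1 : Fin (n + 1) → X), u.2.2))]
  · rintro ⟨u, x⟩ h
    simpa using h
  · exact fun u h => h
  · rintro ⟨u, x⟩ _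
    simp
  · rintro ⟨u, x⟩ _
    simp

/-- Pairs of conjugate points are determined by one of them. -/
theorem cnt_conj_pair {F : Equiv.Perm X} (p : X → X → Prop) :
    cnt (fun u : X × X => (F u.1 = u.2 ∧ F u.2 = u.1) ∧ p u.1 u.2) =
      cnt (fun x => (F ^ 2) x = x ∧ p x (F x)) := by
  refine cnt_bij (fun u => u.1) (fun x => (x, F x)) ?_ ?_ ?_ ?_
  · rintro ⟨x, y⟩ ⟨⟨h1, h2⟩, h3⟩
    simp only at h1 h2 h3 ⊢
    subst h1
    exact ⟨h2, h3⟩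
  · exact fun x h => ⟨⟨rfl, h.1⟩, h.2⟩
  · rintro ⟨x, y⟩ ⟨⟨h1, _⟩, _⟩
    simp only at h1
    rw [h1]
  · exact fun _ _ => rfl

/-- Two pairs of conjugate points form a frame as soon as the second is off the line of the first:
the lines of the two pairs are fixed and meet in a fixed point. -/
theorem numTw_frame_two_two {F : Equiv.Perm X} {q : ℤ} (hF : IsFrob F q)
    (hF2 : IsFrob (F ^ 2) (q ^ 2)) : numTw (X := X) F ![1, 0, 3, 2] = pglCard q := by
  have hc : ∀ u : Fin 2 → X, (∀ i, F (u i) = u (![1, 0] i)) ∧ u 0 ≠ u 1 →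
      cnt (fun v : X × X => (F v.1 = v.2 ∧ F v.2 = v.1) ∧ ¬ Coll (u 0) (u 1) v.1 ∧
        ¬ Coll (u 0) (u 1) v.2 ∧ ∀ i, ¬ Coll (u i) v.1 v.2) = q ^ 4 - q ^ 2 := by
    intro u ⟨h1, h2⟩
    set l := join (u 0) (u 1) with hldef
    have hl : F l = l := pair_line_fix hF h1 h2
    have hu0 : F (u 0) = u 1 := h1 0
    have hu1 : F (u 1) = u 0 := h1 1
    have a := hF.cnt_conj hF2 fun x hx => pow_fix hx 2
    have b := hF.cnt_line_conj hF2 (fun x hx => pow_fix hx 2) hl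
    rw [cnt_split _ (fun x => Inc x l), b] at a
    rw [cnt_conj_pair (fun x y => ¬ Coll (u 0) (u 1) x ∧ ¬ Coll (u 0) (u 1) y ∧
      ∀ i, ¬ Coll (u i) x y)]
    have e : cnt (fun x => (F ^ 2) x = x ∧ (¬ Coll (u 0) (u 1) x ∧ ¬ Coll (u 0) (u 1) (F x) ∧
        ∀ i, ¬ Coll (u i) x (F x))) = cnt (fun x => ((F ^ 2) x = x ∧ F x ≠ x) ∧ ¬ Inc x l) := by
      refine cnt_congr fun x => ?_
      rw [coll_iff h2, coll_iff h2]
      constructor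
      · rintro ⟨h3, h4, h5, h6⟩
        refine ⟨⟨h3, fun h => h6 0 ?_⟩, h4⟩
        rw [h]
        exact (coll_self_left _ _).swap₂₃.swap₁₂
      · rintro ⟨⟨h3, h4⟩, h5⟩
        refine ⟨h3, h5, fun h => h5 ?_, ?_⟩
        · rw [← hF.inc_iff, hl]
          exact h
        -- the line of the second pair is fixed and contains the non-fixed point `u i`, so it is `l`
        · rintro i ⟨m, hm1, hm2, hm3⟩
          have hm : F m = m := by
            have h3' : F (F x) = x := h3
            rw [eq_join h4.symm hm2 hm3, map_join hF, h3', join_comm]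
          have hi : F (u i) ≠ u i := by
            fin_cases i
            · simpa [hu0] using h2.symm
            · simpa [hu1] using h2
          have hil : Inc (u i) l := by
            fin_cases i
            · exact inc_join_left h2
            · exact inc_join_right h2
          rw [hF.fix_line_unique hi hm hl hm1 hil] at hm2
          exact h5 hm2
    rw [e]
    linarith
  have hs := cnt_sigma _ _ _ hc
  rw [numTw, cnt_snoc_snoc]
  have h0 : ∀ (u : Fin 2 → X) x, OffC u x ↔ ¬ Coll (u 0) (u 1) x := by
    intro u x
    constructor
    · exact fun h => h 0 1 (by decide)
    · intro h i j hij
      have : ∀ a b : Fin 2, a < b → a = 0 ∧ b = 1 := by decide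
      rw [(this i j hij).1, (this i j hij).2]
      exact h
  have : cnt (fun u : (Fin 2 → X) × (X × X) =>
      Tw F ![1, 0, 3, 2] (Fin.snoc (Fin.snoc u.1 u.2.1 : Fin 3 → X) u.2.2 : Fin 4 → X)) =
      numPairs (X := X) F ![1, 0] * (q ^ 4 - q ^ 2) := by
    rw [numPairs, ← hs]
    refine cnt_congr fun ⟨u, x, y⟩ => ?_
    rw [tw_snoc_snoc ![1, 0] ![1, 0, 3, 2] (by decide) (by decide) (by decide)]
    have htriv : Tw F ![1, 0] u ↔ ∀ i, F (u i) = u (![1, 0] i) := by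
      refine ⟨fun h => h.1, fun h => ⟨h, fun i j k => ?_⟩⟩
      omega
    simp only [h0, htriv]
    by_cases hne : u 0 = u 1
    · simp only [hne, ne_eq, not_true, and_false, false_and, iff_false, not_and]
      exact fun _ _ h => absurd (coll_self_left _ _) h
    · simp only [ne_eq, hne, not_false_iff, and_true]
  rw [this, numPairs_swap hF hF2, pglCard]
  ring

/-! ### A frame and a conjugate triple -/

theorem cnt_snoc_three {n : ℕ} (p : (Fin (n + 3) → X) → Prop) :
    cnt p = cnt (fun u : (Fin n → X) × (X × X × X) =>
      p (Fin.snoc (Fin.snoc (Fin.snoc u.1 u.2.1 : Fin (n + 1) → X) u.2.2.1 : Fin (n + 2) → X)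
        u.2.2.2)) := by
  rw [cnt_snoc_snoc, cnt_bij (r := fun u : (Fin n → X) × (X × X × X) =>
      p (Fin.snoc (Fin.snoc (Fin.snoc u.1 u.2.1 : Fin (n + 1) → X) u.2.2.1 : Fin (n + 2) → X)
        u.2.2.2))
    (fun u => (Fin.init u.1, (u.1 (Fin.last n), u.2)))
    (fun u => ((Fin.snoc u.1 u.2.1 : Fin (n + 1) → X), u.2.2))]
  · rintro ⟨u, x⟩ h
    simpa using h
  · exact fun u h => h
  · rintro ⟨u, x⟩ _
    simp
  · rintro ⟨u, x⟩ _
    simp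

theorem cnt_conj_triple {F : Equiv.Perm X} (p : X → X → X → Prop) :
    cnt (fun u : X × X × X => (F u.1 = u.2.1 ∧ F u.2.1 = u.2.2 ∧ F u.2.2 = u.1) ∧
      p u.1 u.2.1 u.2.2) = cnt (fun x => (F ^ 3) x = x ∧ p x (F x) (F (F x))) := by
  refine cnt_bij (fun u => u.1) (fun x => (x, F x, F (F x))) ?_ ?_ ?_ ?_
  · rintro ⟨x, y, z⟩ ⟨⟨h1, h2, h3⟩, h4⟩
    simp only at h1 h2 h3 h4 ⊢
    subst h1
    subst h2
    exact ⟨h3, h4⟩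
  · exact fun x h => ⟨⟨rfl, rfl, h.1⟩, h.2⟩
  · rintro ⟨x, y, z⟩ ⟨⟨h1, h2, _⟩, _⟩
    simp only at h1 h2
    subst h1
    rw [h2]
  · exact fun _ _ => rfl

/-- A conjugate triple of points, on no fixed line, is in general position with respect to every
family of points whose cycle lengths divide `4`. -/
theorem numTw_frame_triple {F : Equiv.Perm X} {q : ℤ}
    (hF : ∀ k, 1 ≤ k → k ≤ 7 → IsFrob (F ^ k) (q ^ k)) (s : Fin 4 → Fin 4)
    (hs4 : ∀ i, s (s (s (s i))) = i) (s' : Fin 7 → Fin 7)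
    (h : ∀ i, s' (Fin.castSucc (Fin.castSucc (Fin.castSucc i))) =
      (Fin.castSucc (Fin.castSucc (Fin.castSucc (s i)))))
    (h4 : s' 4 = 5) (h5 : s' 5 = 6) (h6 : s' 6 = 4) :
    numTw (X := X) F s' = numTw (X := X) F s * (q ^ 6 - q ^ 5 - q ^ 4 + q ^ 3) := by
  have h1 : IsFrob F q := by simpa using hF 1 le_rfl (by norm_num)
  have hF3 := hF 3 (by norm_num) (by norm_num)
  have hF4 := hF 4 (by norm_num) (by norm_num)
  have hgen := cnt_gen h1 hF3 (fun x hx => pow_fix hx 3)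
  have hc : ∀ A : Fin 4 → X, Tw F s A → cnt (fun u : X × X × X =>
      (F u.1 = u.2.1 ∧ F u.2.1 = u.2.2 ∧ F u.2.2 = u.1) ∧ OffC A u.1 ∧ OffC A u.2.1 ∧
      OffC A u.2.2 ∧ (∀ i, ¬ Coll (A i) u.1 u.2.1) ∧ (∀ i, ¬ Coll (A i) u.2.1 u.2.2) ∧
      (∀ i, ¬ Coll (A i) u.1 u.2.2) ∧ ¬ Coll u.1 u.2.1 u.2.2) =
      q ^ 6 - q ^ 5 - q ^ 4 + q ^ 3 := by
    intro A hA
    rw [cnt_conj_triple fun x y z => OffC A x ∧ OffC A y ∧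
      OffC A z ∧ (∀ i, ¬ Coll (A i) x y) ∧ (∀ i, ¬ Coll (A i) y z) ∧
      (∀ i, ¬ Coll (A i) x z) ∧ ¬ Coll x y z]
    have hA4 : ∀ i, (F ^ 4) (A i) = A i := by
      intro i
      simp only [pow_succ, pow_zero, one_mul, Equiv.Perm.mul_apply, hA.1, hs4]
    have hnc : ∀ x, Gen F (F ^ 3) x → ¬ Coll x (F x) (F (F x)) := fun x hx =>
      not_coll_progression h1 hF3 (a := 1) (by simpa using h1) hx (by norm_num)
    have hshift : ∀ x, Gen F (F ^ 3) x → (F ^ 4) x = F x := fun x hx => by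
      rw [pow_succ', Equiv.Perm.mul_apply, hx.1]
    -- `F ^ 4` fixes the lines of the frame and acts on the triple as `F` does
    have hoff : ∀ x, Gen F (F ^ 3) x → OffC A x := by
      rintro x hx i j hij ⟨l, hi, hj, hxl⟩
      have hne : A i ≠ A j := (hA.injective (by norm_num)).ne hij.ne
      have hl : (F ^ 4) l = l := by
        rw [eq_join hne hi hj, map_join hF4, hA4, hA4]
      have step : ∀ y, Gen F (F ^ 3) y → Inc y l → Inc (F y) l := by
        intro y hy hyl
        rw [← hF4.inc_iff, hl, hshift y hy] at hyl
        exact hyl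
      have a := step x hx hxl
      exact hnc x hx ⟨l, hxl, a, step _ (hx.map h1) a⟩
    -- `F ^ 3` fixes the sides of the triple and `F ^ 9` acts on the frame as `F` does, so a side
    -- through `A i` contains `F (A i)` as well
    have hside : ∀ x, Gen F (F ^ 3) x → ∀ i, ¬ Coll (A i) x (F x) := by
      rintro x hx i ⟨m, hi, hm1, hm2⟩
      have hne : x ≠ F x := (gen_ne h1 hx).symm
      have hm : (F ^ 3) m = m := by
        rw [eq_join hne hm1 hm2, map_join hF3, hx.1, (hx.map h1).1]
      have e9 : F (A i) = (F ^ 3) ((F ^ 3) ((F ^ 3) (A i))) := by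
        have : (F ^ 3) ((F ^ 3) ((F ^ 3) (A i))) = F ((F ^ 4) ((F ^ 4) (A i))) := rfl
        rw [this, hA4, hA4]
      have hFi : Inc (F (A i)) m := by
        have step : ∀ y, Inc y m → Inc ((F ^ 3) y) m := by
          intro y hy
          rw [← hF3.inc_iff, hm] at hy
          exact hy
        rw [e9]
        exact step _ (step _ (step _ hi))
      by_cases hFm : F m = m
      · exact hx.2 m hFm hm1
      · have a := (h1.inc_iff _ _).2 hi
        have b := (h1.inc_iff _ _).2 hm1
        have : F (A i) = F x := (eq_join' hFm a hFi).trans (eq_join' hFm b hm2).symm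
        have hAx : A i = x := F.injective this
        have h44 := hA4 i
        rw [hAx, hshift x hx] at h44
        exact hne h44.symm
    have : q ^ 6 - q ^ 5 - q ^ 4 + q ^ 3 = cnt (Gen F (F ^ 3)) := by
      rw [hgen]
      ring
    rw [this]
    refine cnt_congr fun x => ⟨?_, fun hx => ⟨hx.1, ?_⟩⟩
    · rintro ⟨h0, _, _, _, _, _, _, hcoll⟩
      refine ⟨h0, fun l hl hxl => hcoll ⟨l, hxl, ?_⟩⟩
      have step : ∀ y, Inc y l → Inc (F y) l := by
        intro y hy
        rw [← h1.inc_iff, hl] at hy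
        exact hy
      exact ⟨step _ hxl, step _ (step _ hxl)⟩
    · have hx1 := hx.map h1
      have hx2 := hx1.map h1
      refine ⟨hoff _ hx, hoff _ hx1, hoff _ hx2, hside _ hx, hside _ hx1, fun i hi => ?_,
        hnc _ hx⟩
      refine hside _ hx2 i ?_
      have : F (F (F x)) = x := hx.1
      rw [this]
      exact hi.swap₂₃
  have hs := cnt_sigma _ _ _ hc
  rw [numTw, cnt_snoc_three, numTw, ← hs]
  exact cnt_congr fun u => tw_snoc_snoc_snoc s s' h h4 h5 h6 _ _ _ _

/-! ### A five-arc and two further points -/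

open Classical in
/-- Removing mutually exclusive possibilities. -/
theorem cnt_exists_unique {α ι : Type*} [Fintype α] [Fintype ι] (p : α → Prop) (r : ι → α → Prop)
    (h : ∀ x, p x → ∀ i j, r i x → r j x → i = j) :
    cnt (fun x => p x ∧ ∀ i, ¬ r i x) = cnt p - ∑ i, cnt (fun x => p x ∧ r i x) := by
  simp only [cnt_eq_sum]
  rw [Finset.sum_comm, ← Finset.sum_sub_distrib]
  refine Finset.sum_congr rfl fun x _ => ?_
  by_cases hx : p x
  · by_cases hr : ∃ i, r i x
    · obtain ⟨i, hi⟩ := hr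
      have : ∀ j, r j x ↔ j = i := fun j => ⟨fun hj => h x hx _ _ hj hi, fun hj => hj ▸ hi⟩
      simp [hx, this]
    · push Not at hr
      simp [hx, hr]
  · simp [hx]

/-- Labelled arcs with two further points `x`, `y`, in the relation `R`, such that the line `xy`
passes through the point with label `i`. -/
noncomputable def numAligned (F : Equiv.Perm X) (R : X → X → Prop) {n : ℕ} (s : Fin n → Fin n)
    (i : Fin n) : ℤ :=
  cnt (fun u : (Fin n → X) × (X × X) => Tw F s u.1 ∧
    ((R u.2.1 u.2.2 ∧ OffC u.1 u.2.1 ∧ OffC u.1 u.2.2) ∧ u.2.1 ≠ u.2.2) ∧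
      Coll (u.1 i) u.2.1 u.2.2)

/-- Two points `x`, `y` in the relation `R`, each in general position with respect to an arc, fail
to extend it to an arc exactly if they coincide or their line passes through a single point of the
arc. -/
theorem numTw_pair {F : Equiv.Perm X} (R : X → X → Prop) {n : ℕ} (hn : 3 ≤ n)
    (s : Fin n → Fin n) (s' : Fin (n + 2) → Fin (n + 2))
    (hs : ∀ (P : Fin n → X) x y, Tw F s' (Fin.snoc (Fin.snoc P x : Fin (n + 1) → X) y) ↔
      Tw F s P ∧ R x y ∧ OffC P x ∧ OffC P y ∧ ∀ i, ¬ Coll (P i) x y) (c : ℤ)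
    (hc : ∀ P : Fin n → X, Tw F s P →
      cnt (fun u : X × X => (R u.1 u.2 ∧ OffC P u.1 ∧ OffC P u.2) ∧ u.1 ≠ u.2) = c) :
    numTw (X := X) F s' = numTw (X := X) F s * c - ∑ i, numAligned F R s i := by
  rw [numTw, cnt_snoc_snoc, numTw, ← cnt_sigma _ _ _ hc]
  simp only [numAligned]
  have e1 : ∀ i, cnt (fun u : (Fin n → X) × (X × X) => Tw F s u.1 ∧
      ((R u.2.1 u.2.2 ∧ OffC u.1 u.2.1 ∧ OffC u.1 u.2.2) ∧ u.2.1 ≠ u.2.2) ∧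
        Coll (u.1 i) u.2.1 u.2.2) = cnt (fun u : (Fin n → X) × (X × X) => (Tw F s u.1 ∧
      ((R u.2.1 u.2.2 ∧ OffC u.1 u.2.1 ∧ OffC u.1 u.2.2) ∧ u.2.1 ≠ u.2.2)) ∧
        Coll (u.1 i) u.2.1 u.2.2) := fun i => cnt_congr fun u => by tauto
  simp only [e1]
  rw [← cnt_exists_unique]
  · refine cnt_congr fun ⟨P, x, y⟩ => ?_
    rw [hs]
    constructor
    · rintro ⟨h1, h2, h3, h4, h5⟩
      refine ⟨⟨h1, ⟨h2, h3, h4⟩, fun h => ?_⟩, h5⟩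
      simp only at h
      subst h
      exact h5 ⟨0, by omega⟩ (coll_self_left _ _).swap₂₃.swap₁₂
    · rintro ⟨⟨h1, ⟨h2, h3, h4⟩, _⟩, h6⟩
      exact ⟨h1, h2, h3, h4, h6⟩
  · rintro ⟨P, x, y⟩ ⟨h1, ⟨_, h3, h4⟩, h5⟩ i j hi hj
    simp only at h1 h3 h4 h5 hi hj
    by_contra hij
    have hoff : ∀ i j, i ≠ j → ¬ Coll (P i) (P j) x := by
      intro i j hij
      rcases lt_or_gt_of_ne hij with h | h
      · exact h3 i j h
      · exact fun h' => h3 j i h h'.swap₁₂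
    have ei := (coll_iff h5).1 hi.swap₁₂.swap₂₃
    have ej := (coll_iff h5).1 hj.swap₁₂.swap₂₃
    exact hoff i j hij ⟨_, ei, ej, inc_join_left h5⟩

/-- If the line `xy` is fixed and passes through `P i`, it also passes through `P (s i)`, which
general position excludes unless `i` is fixed by `s`. -/
theorem numAligned_of_ne {F : Equiv.Perm X} {q : ℤ} (hF : IsFrob F q) (R : X → X → Prop)
    (hR : ∀ x y, R x y → x ≠ y → F (join x y) = join x y) {n : ℕ}
    (s : Fin n → Fin n) {i : Fin n} (hi : s i ≠ i) : numAligned F R s i = 0 := by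
  refine cnt_eq_zero ?_
  rintro ⟨P, x, y⟩ ⟨h1, ⟨⟨h2, h3, h4⟩, h5⟩, h6⟩
  simp only at h1 h2 h3 h4 h5 h6
  have ei := (coll_iff h5).1 h6.swap₁₂.swap₂₃
  have ej := (hF.inc_iff _ _).2 ei
  rw [hR x y h2 h5, h1.1] at ej
  rcases lt_or_gt_of_ne hi with h | h
  · exact h3 _ _ h ⟨_, ej, ei, inc_join_left h5⟩
  · exact h3 _ _ h ⟨_, ei, ej, inc_join_left h5⟩

theorem Tw.comp {F : Equiv.Perm X} {n : ℕ} {s : Fin n → Fin n} {P : Fin n → X} (h : Tw F s P)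
    (t : Equiv.Perm (Fin n)) (ht : ∀ i, s (t i) = t (s i)) : Tw F s (P ∘ t) := by
  refine ⟨fun i => ?_, fun i j k hij hjk => ?_⟩
  · simp only [Function.comp]
    rw [h.1, ht]
  · exact h.not_coll (t.injective.ne hij.ne) (t.injective.ne (hij.trans hjk).ne)
      (t.injective.ne hjk.ne)

theorem OffC.comp {n : ℕ} {P : Fin n → X} {x : X} (h : OffC P x)
    (t : Equiv.Perm (Fin n)) : OffC (P ∘ t) x := by
  intro i j hij
  rcases lt_or_gt_of_ne (t.injective.ne hij.ne) with h' | h'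
  · exact h _ _ h'
  · exact fun hc => h _ _ h' hc.swap₁₂

/-- The labels fixed by `s` play the same role. -/
theorem numAligned_eq_of_fix {F : Equiv.Perm X} (R : X → X → Prop) {n : ℕ}
    (s : Fin n → Fin n) (hs : Function.Injective s) {i j : Fin n} (hi : s i = i) (hj : s j = j) :
    numAligned (X := X) F R s i = numAligned (X := X) F R s j := by
  set t : Equiv.Perm (Fin n) := Equiv.swap i j with ht
  have hcomm : ∀ k, s (t k) = t (s k) := by
    intro k
    by_cases h1 : k = i
    · subst h1
      rw [ht, Equiv.swap_apply_left, hj, hi, Equiv.swap_apply_left]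
    by_cases h2 : k = j
    · subst h2
      rw [ht, Equiv.swap_apply_right, hj, hi, Equiv.swap_apply_right]
    rw [ht, Equiv.swap_apply_of_ne_of_ne h1 h2, Equiv.swap_apply_of_ne_of_ne]
    · exact fun h => h1 (hs (h.trans hi.symm))
    · exact fun h => h2 (hs (h.trans hj.symm))
  have htt : ∀ P : Fin n → X, (P ∘ t) ∘ t = P := fun P => by
    funext k
    simp [ht]
  refine cnt_bij (fun u => (u.1 ∘ t, u.2)) (fun u => (u.1 ∘ t, u.2)) ?_ ?_ ?_ ?_
  · rintro ⟨P, x, y⟩ ⟨h1, ⟨⟨h2, h3, h4⟩, h5⟩, h6⟩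
    refine ⟨h1.comp t hcomm, ⟨⟨h2, OffC.comp h3 t, OffC.comp h4 t⟩, h5⟩, ?_⟩
    simpa [ht] using h6
  · rintro ⟨P, x, y⟩ ⟨h1, ⟨⟨h2, h3, h4⟩, h5⟩, h6⟩
    refine ⟨h1.comp t hcomm, ⟨⟨h2, OffC.comp h3 t, OffC.comp h4 t⟩, h5⟩, ?_⟩
    simpa [ht] using h6
  · rintro ⟨P, x, y⟩ _
    simp only [htt]
  · rintro ⟨P, x, y⟩ _
    simp only [htt]

/-- If the aligned point is the last one of the arc, the three aligned points can be chosen after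
the other points of the arc and the line. -/
theorem numAligned_last {F : Equiv.Perm X} (R : X → X → Prop)
    (hR : ∀ x y, R x y → x ≠ y → F (join x y) = join x y) {n : ℕ} (hn : 3 ≤ n)
    (s : Fin n → Fin n) (s' : Fin (n + 1) → Fin (n + 1))
    (h : ∀ i, s' i.castSucc = (s i).castSucc) (hl : s' (Fin.last n) = Fin.last n) (b : ℤ)
    (hb : ∀ A : Fin n → X, Tw F s A → cnt (fun v : X × (X × (X × X)) =>
      (F v.1 = v.1 ∧ ∀ i, ¬ Inc (A i) v.1) ∧
      (((F v.2.1 = v.2.1 ∧ Inc v.2.1 v.1) ∧ Off A v.2.1) ∧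
        R v.2.2.1 v.2.2.2 ∧ (Inc v.2.2.1 v.1 ∧ Off A v.2.2.1) ∧
          (Inc v.2.2.2 v.1 ∧ Off A v.2.2.2) ∧ v.2.2.1 ≠ v.2.2.2 ∧ v.2.1 ≠ v.2.2.1 ∧
            v.2.1 ≠ v.2.2.2)) = b) :
    numAligned (X := X) F R s' (Fin.last n) = numTw (X := X) F s * b := by
  rw [numAligned, numTw, ← cnt_sigma _ _ _ hb]
  refine cnt_bij (fun u => (Fin.init u.1, (join u.2.1 u.2.2, (u.1 (Fin.last n), u.2))))
    (fun w => (Fin.snoc w.1 w.2.2.1, w.2.2.2)) ?_ ?_ ?_ ?_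
  · rintro ⟨P, x, y⟩ ⟨h1, ⟨⟨h2, h3, h4⟩, h5⟩, h6⟩
    simp only at h1 h2 h3 h4 h5 h6
    obtain ⟨A, z, rfl⟩ : ∃ A z, P = Fin.snoc A z := ⟨Fin.init P, P (Fin.last n), by simp⟩
    rw [tw_snoc s s' h hl] at h1
    rw [offC_snoc] at h3 h4
    rw [Fin.snoc_last] at h6
    obtain ⟨hA, hz, hzA⟩ := h1
    have e := (coll_iff h5).1 h6.swap₁₂.swap₂₃
    have hzx : z ≠ x := fun h => h3.2 ⟨0, by omega⟩ (by rw [h]; exact (coll_self_left _ _).swap₂₃.swap₁₂)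
    have hzy : z ≠ y := fun h => h4.2 ⟨0, by omega⟩ (by rw [h]; exact (coll_self_left _ _).swap₂₃.swap₁₂)
    simp only [Fin.init_snoc, Fin.snoc_last]
    refine ⟨hA, ⟨hR x y h2 h5, fun i hi => ?_⟩, ⟨⟨hz, e⟩, (hA.offC_iff hn _).1 hzA⟩, h2,
      ⟨inc_join_left h5, (hA.offC_iff hn _).1 h3.1⟩, ⟨inc_join_right h5, (hA.offC_iff hn _).1 h4.1⟩,
      h5, hzx, hzy⟩
    exact h3.2 i ⟨_, hi, e, inc_join_left h5⟩
  · rintro ⟨A, l, z, x, y⟩ ⟨hA, ⟨hlF, hlA⟩, ⟨⟨hz, hzl⟩, hzA⟩, hxy, ⟨hxl, hxA⟩, ⟨hyl, hyA⟩, h1, h2, h3⟩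
    simp only at hA hlF hlA hz hzl hzA hxy hxl hxA hyl hyA h1 h2 h3 ⊢
    rw [tw_snoc s s' h hl, offC_snoc, offC_snoc, Fin.snoc_last, hA.offC_iff hn, hA.offC_iff hn,
      hA.offC_iff hn]
    refine ⟨⟨hA, hz, hzA⟩, ⟨⟨hxy, ⟨hxA, fun i hi => ?_⟩, hyA, fun i hi => ?_⟩, h1⟩, l, hzl, hxl, hyl⟩
    · obtain ⟨m, m1, m2, m3⟩ := hi
      exact hlA i (line_unique h2 m2 m3 hzl hxl ▸ m1)
    · obtain ⟨m, m1, m2, m3⟩ := hi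
      exact hlA i (line_unique h3 m2 m3 hzl hyl ▸ m1)
  · rintro ⟨P, x, y⟩ _
    simp
  · rintro ⟨A, l, z, x, y⟩ ⟨hA, ⟨hlF, hlA⟩, ⟨⟨hz, hzl⟩, hzA⟩, hxy, ⟨hxl, hxA⟩, ⟨hyl, hyA⟩, h1, h2, h3⟩
    simp only at hxl hyl h1 ⊢
    rw [← eq_join h1 hxl hyl]
    simp

/-! ### Fixed lines avoiding a frame -/

/-- The number of fixed lines through no point of an arc. -/
theorem cnt_avoid {F : Equiv.Perm X} {q : ℤ} (hF : IsFrob F q) {n : ℕ} (hn : 3 ≤ n)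
    {s : Fin n → Fin n} {P : Fin n → X} (hP : Tw F s P) (a b c : ℕ)
    (ha : (Finset.univ.filter fun i => s i = i).card = a)
    (hb : ((edges n).filter (fun e => Carries s e e ∧ s e.1 = e.1)).card = b)
    (hc : ((edges n).filter (fun e => Carries s e e ∧ ¬ s e.1 = e.1)).card = c) :
    cnt (fun l => F l = l ∧ ∀ i, ¬ Inc (P i) l) =
      q ^ 2 + q + 1 - a * (q + 1) + b - c := by
  classical
  have hinj := hP.injective hn
  have hsinj := hP.label_injective hn
  have hedge : ∀ e ∈ (edges n).filter (fun e => Carries s e e),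
      cnt (fun l => F l = l ∧ Inc (P e.1) l ∧ Inc (P e.2) l) = 1 := by
    intro e he
    simp only [edges, Finset.mem_filter, Finset.mem_univ, true_and] at he
    refine cnt_eq_one (line P e) fun l => ?_
    constructor
    · rintro ⟨_, h1, h2⟩
      exact eq_join (hinj.ne he.1.ne) h1 h2
    · rintro rfl
      exact ⟨map_line hF hP he.2, inc_join_left (hinj.ne he.1.ne),
        inc_join_right (hinj.ne he.1.ne)⟩
  -- inclusion-exclusion: a fixed line carries at most two points of the arc, fixed or exchanged
  have key : cnt (fun l => F l = l ∧ ∀ i, ¬ Inc (P i) l) = cnt (fun l => F l = l)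
      - ∑ i ∈ Finset.univ.filter (fun i => s i = i), cnt (fun l => F l = l ∧ Inc (P i) l)
      + ∑ e ∈ (edges n).filter (fun e => Carries s e e ∧ s e.1 = e.1),
          cnt (fun l => F l = l ∧ Inc (P e.1) l ∧ Inc (P e.2) l)
      - ∑ e ∈ (edges n).filter (fun e => Carries s e e ∧ ¬ s e.1 = e.1),
          cnt (fun l => F l = l ∧ Inc (P e.1) l ∧ Inc (P e.2) l) := by
    simp only [cnt_eq_sum]
    rw [Finset.sum_comm (s := Finset.univ.filter _)]
    rw [Finset.sum_comm (s := (edges n).filter _)]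
    rw [Finset.sum_comm (s := (edges n).filter _)]
    rw [← Finset.sum_sub_distrib, ← Finset.sum_add_distrib, ← Finset.sum_sub_distrib]
    refine Finset.sum_congr rfl fun l _ => ?_
    by_cases hl : F l = l
    swap
    · simp [hl]
    have hstep : ∀ i, Inc (P i) l → Inc (P (s i)) l := by
      intro i hi
      rw [← hP.1, ← hl, hF.inc_iff]
      exact hi
    have hthree : ∀ i j k, Inc (P i) l → Inc (P j) l → Inc (P k) l → i ≠ j → i = k ∨ j = k := by
      intro i j k hi hj hk hij
      by_contra! hcon
      exact hP.not_coll hij hcon.1 hcon.2 ⟨l, hi, hj, hk⟩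
    simp only [hl, true_and]
    by_cases hK : ∃ i, Inc (P i) l
    swap
    · push Not at hK
      simp [hK]
    rw [if_neg (by push Not; exact hK)]
    by_cases hK2 : ∃ i j, i < j ∧ Inc (P i) l ∧ Inc (P j) l
    · obtain ⟨i, j, hij, hi, hj⟩ := hK2
      have hmem : ∀ k, Inc (P k) l ↔ k = i ∨ k = j := by
        intro k
        constructor
        · intro hk
          rcases hthree i j k hi hj hk hij.ne with h | h
          · exact Or.inl h.symm
          · exact Or.inr h.symm
        · rintro (rfl | rfl) <;> assumption
      have hpair : ∀ e ∈ edges n, (Inc (P e.1) l ∧ Inc (P e.2) l) ↔ e = (i, j) := by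
        rintro ⟨c, d⟩ he
        simp only [edges, Finset.mem_filter, Finset.mem_univ, true_and] at he
        simp only [hmem, Prod.mk.injEq]
        constructor
        · rintro ⟨rfl | rfl, rfl | rfl⟩
          · exact absurd he (lt_irrefl _)
          · exact ⟨rfl, rfl⟩
          · exact absurd he hij.not_gt
          · exact absurd he (lt_irrefl _)
        · rintro ⟨rfl, rfl⟩
          simp
      have hijE : (i, j) ∈ edges n := by simp [edges, hij]
      have hsum : ∀ (Q : Fin n × Fin n → Prop) [DecidablePred Q],
          (∑ e ∈ (edges n).filter Q, if Inc (P e.1) l ∧ Inc (P e.2) l then (1 : ℤ) else 0) =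
            if Q (i, j) then 1 else 0 := by
        intro Q _
        rw [Finset.sum_filter, Finset.sum_eq_single (i, j)]
        · simp [(hpair _ hijE).2 rfl]
        · intro e he hne
          rw [if_neg fun h => hne ((hpair e he).1 h), ite_self]
        · exact fun h => absurd hijE h
      rw [hsum, hsum]
      have hsum1 : (∑ k ∈ Finset.univ.filter (fun k => s k = k),
          if Inc (P k) l then (1 : ℤ) else 0) =
            (if s i = i then 1 else 0) + if s j = j then 1 else 0 := by
        rw [Finset.sum_filter]
        simp only [hmem]
        rw [← Finset.sum_subset (Finset.subset_univ {i, j}), Finset.sum_pair hij.ne]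
        · simp
        · intro k _ hk
          simp only [Finset.mem_insert, Finset.mem_singleton] at hk
          simp [hk]
      rw [hsum1]
      have si := hstep i hi
      have sj := hstep j hj
      rw [hmem] at si sj
      have hne : s i ≠ s j := hsinj.ne hij.ne
      unfold Carries
      rcases si with si | si <;> rcases sj with sj | sj
      · exact absurd (si.trans sj.symm) hne
      · simp [si, sj]
      · simp [si, sj, hij.ne, hij.ne']
      · exact absurd (si.trans sj.symm) hne
    · push Not at hK2
      obtain ⟨i, hi⟩ := hK
      have hmem : ∀ k, Inc (P k) l ↔ k = i := by
        intro k
        constructor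
        · intro hk
          rcases lt_trichotomy i k with h | h | h
          · exact absurd hk (hK2 _ _ h hi)
          · exact h.symm
          · exact absurd hi (hK2 _ _ h hk)
        · rintro rfl
          exact hi
      have hpair : ∀ e ∈ edges n, ¬ (Inc (P e.1) l ∧ Inc (P e.2) l) := by
        rintro ⟨c, d⟩ he ⟨h1, h2⟩
        simp only [edges, Finset.mem_filter, Finset.mem_univ, true_and] at he
        exact hK2 _ _ he h1 h2
      have hsum : ∀ (Q : Fin n × Fin n → Prop) [DecidablePred Q],
          (∑ e ∈ (edges n).filter Q, if Inc (P e.1) l ∧ Inc (P e.2) l then (1 : ℤ) else 0) = 0 := by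
        intro Q _
        refine Finset.sum_eq_zero fun e he => if_neg (hpair e (Finset.mem_filter.1 he).1)
      rw [hsum, hsum]
      have si := (hmem _).1 (hstep i hi)
      simp only [hmem]
      rw [Finset.sum_ite_eq' ]
      simp [si]
  rw [key, hF.card_fix]
  have e1 : ∑ i ∈ Finset.univ.filter (fun i => s i = i), cnt (fun l => F l = l ∧ Inc (P i) l) =
      a * (q + 1) := by
    rw [Finset.sum_congr rfl (g := fun _ => q + 1), Finset.sum_const, ha]
    · simp
    · intro i hi
      rw [cnt_congr (r := fun l => F l = l ∧ Inc l (P i)) fun l => by rw [inc_comm]]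
      refine hF.card_line _ ?_
      rw [hP.1, (Finset.mem_filter.1 hi).2]
  have e2 : ∑ e ∈ (edges n).filter (fun e => Carries s e e ∧ s e.1 = e.1),
          cnt (fun l => F l = l ∧ Inc (P e.1) l ∧ Inc (P e.2) l) = b := by
    rw [Finset.sum_congr rfl (g := fun _ => 1), Finset.sum_const, hb]
    · simp
    · intro e he
      simp only [Finset.mem_filter] at he
      exact hedge e (by simp only [Finset.mem_filter]; tauto)
  have e3 : ∑ e ∈ (edges n).filter (fun e => Carries s e e ∧ ¬ s e.1 = e.1),
          cnt (fun l => F l = l ∧ Inc (P e.1) l ∧ Inc (P e.2) l) = c := by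
    rw [Finset.sum_congr rfl (g := fun _ => 1), Finset.sum_const, hc]
    · simp
    · intro e he
      simp only [Finset.mem_filter] at he
      exact hedge e (by simp only [Finset.mem_filter]; tauto)
  rw [e1, e2, e3]

/-! ### The diagonal points of a frame -/

theorem edgePairs_four :
    edgePairs 4 = {((0, 1), (2, 3)), ((0, 2), (1, 3)), ((0, 3), (1, 2))} := by decide

theorem edgePairs_four_cover : ∀ p ∈ edgePairs 4, ∀ k,
    (k = p.1.1 ∨ k = p.1.2) ∨ (k = p.2.1 ∨ k = p.2.2) := by
  intro p hp
  simp only [edgePairs_four, Finset.mem_insert, Finset.mem_singleton] at hp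
  rcases hp with rfl | rfl | rfl <;> decide

theorem edgePairs_four_ne : ∀ p ∈ edgePairs 4, ∀ r ∈ edgePairs 4, p ≠ r →
    p.1 ≠ r.1 ∧ p.1 ≠ r.2 ∧ p.2 ≠ r.1 ∧ p.2 ≠ r.2 := by
  rw [edgePairs_four]
  decide

theorem Tw.line_injOn {F : Equiv.Perm X} {n : ℕ} {s : Fin n → Fin n} {A : Fin n → X}
    (hA : Tw F s A) (hn : 3 ≤ n) {e f : Fin n × Fin n} (he : e.1 < e.2) (hf : f.1 < f.2)
    (h : line A e = line A f) : e = f := by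
  have h1 := (hA.inc_line_iff hn he.ne e.1).2 (Or.inl rfl)
  have h2 := (hA.inc_line_iff hn he.ne e.2).2 (Or.inr rfl)
  rw [h, hA.inc_line_iff hn hf.ne] at h1 h2
  apply Prod.ext
  · rcases h1 with h1 | h1
    · exact h1
    · rcases h2 with h2 | h2
      · rw [h1, h2] at he
        exact absurd he hf.not_gt
      · exact absurd (h1.trans h2.symm) he.ne
  · rcases h2 with h2 | h2
    · rcases h1 with h1 | h1
      · exact absurd (h1.trans h2.symm) he.ne
      · rw [h1, h2] at he
        exact absurd he hf.not_gt
    · exact h2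

/-- A line through a diagonal point and a point of the frame is a line of the frame. -/
theorem Tw.eq_line_of_diag {F : Equiv.Perm X} {n : ℕ} {s : Fin n → Fin n} {A : Fin n → X}
    (hA : Tw F s A) (hn : 3 ≤ n) {p : (Fin n × Fin n) × (Fin n × Fin n)} (hp : p ∈ edgePairs n)
    {k : Fin n} {l : X} (hk : Inc (A k) l) (hl : Inc (diag A p) l) :
    ((k = p.1.1 ∨ k = p.1.2) → l = line A p.1) ∧ ((k = p.2.1 ∨ k = p.2.2) → l = line A p.2) := by
  have h := mem_edgePairs hp
  have hd := (hA.eq_diag_iff hn hp (diag A p)).2 rfl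
  have hne := hA.diag_ne hn hp k
  constructor
  · intro hk'
    exact line_unique hne hl hk hd.1 ((hA.inc_line_iff hn h.1.ne k).2 hk')
  · intro hk'
    exact line_unique hne hl hk hd.2 ((hA.inc_line_iff hn h.2.1.ne k).2 hk')

theorem Tw.eq_line_of_diag' {F : Equiv.Perm X} {s : Fin 4 → Fin 4} {A : Fin 4 → X}
    (hA : Tw F s A) {p : (Fin 4 × Fin 4) × (Fin 4 × Fin 4)} (hp : p ∈ edgePairs 4)
    {k : Fin 4} {l : X} (hk : Inc (A k) l) (hl : Inc (diag A p) l) :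
    l = line A p.1 ∨ l = line A p.2 := by
  have := hA.eq_line_of_diag (by norm_num) hp hk hl
  rcases edgePairs_four_cover p hp k with h | h
  · exact Or.inl (this.1 h)
  · exact Or.inr (this.2 h)

theorem Tw.diag_injOn {F : Equiv.Perm X} {s : Fin 4 → Fin 4} {A : Fin 4 → X}
    (hA : Tw F s A) {p r : (Fin 4 × Fin 4) × (Fin 4 × Fin 4)} (hp : p ∈ edgePairs 4)
    (hr : r ∈ edgePairs 4) (hpr : p ≠ r) : diag A p ≠ diag A r := by
  intro h
  have hm := mem_edgePairs hp
  have hm' := mem_edgePairs hr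
  have hd := (hA.eq_diag_iff (by norm_num) hp (diag A p)).2 rfl
  have hne := edgePairs_four_ne p hp r hr hpr
  have h1 := (hA.inc_line_iff (by norm_num) hm.1.ne p.1.1).2 (Or.inl rfl)
  have h2 := hd.1
  rw [h] at h2
  rcases hA.eq_line_of_diag' hr h1 h2 with h3 | h3
  · exact hne.1 (hA.line_injOn (by norm_num) hm.1 hm'.1 h3)
  · exact hne.2.1 (hA.line_injOn (by norm_num) hm.1 hm'.2.1 h3)

/-- A line through two diagonal points avoids the frame. -/
theorem Tw.avoid_of_diag {F : Equiv.Perm X} {s : Fin 4 → Fin 4} {A : Fin 4 → X}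
    (hA : Tw F s A) {p r : (Fin 4 × Fin 4) × (Fin 4 × Fin 4)} (hp : p ∈ edgePairs 4)
    (hr : r ∈ edgePairs 4) (hpr : p ≠ r) {l : X} (h1 : Inc (diag A p) l) (h2 : Inc (diag A r) l)
    (k : Fin 4) : ¬ Inc (A k) l := by
  intro hk
  have hm := mem_edgePairs hp
  have hm' := mem_edgePairs hr
  have hne := edgePairs_four_ne p hp r hr hpr
  have a := hA.eq_line_of_diag' hp hk h1
  have b := hA.eq_line_of_diag' hr hk h2
  rcases a with a | a <;> rcases b with b | b
  · exact hne.1 (hA.line_injOn (by norm_num) hm.1 hm'.1 (a.symm.trans b))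
  · exact hne.2.1 (hA.line_injOn (by norm_num) hm.1 hm'.2.1 (a.symm.trans b))
  · exact hne.2.2.1 (hA.line_injOn (by norm_num) hm.2.1 hm'.1 (a.symm.trans b))
  · exact hne.2.2.2 (hA.line_injOn (by norm_num) hm.2.1 hm'.2.1 (a.symm.trans b))

/-- `l` is a fixed line through no point of the family `A`. -/
def Avoids (F : Equiv.Perm X) {n : ℕ} (A : Fin n → X) (l : X) : Prop :=
  F l = l ∧ ∀ i, ¬ Inc (A i) l

/-- Of the fixed lines through a diagonal point only the two lines of the frame meet the frame, and
they are fixed or exchanged. -/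
theorem cnt_avoids_diag {F : Equiv.Perm X} {q : ℤ} (hF : IsFrob F q) {s : Fin 4 → Fin 4}
    {A : Fin 4 → X} (hA : Tw F s A) {p : (Fin 4 × Fin 4) × (Fin 4 × Fin 4)}
    (hp : p ∈ edgePairs 4)
    (hs : (Carries s p.1 p.1 ∧ Carries s p.2 p.2) ∨ (Carries s p.1 p.2 ∧ Carries s p.2 p.1)) :
    cnt (fun l => Avoids F A l ∧ Inc (diag A p) l) =
      q + 1 - if Carries s p.1 p.1 ∧ Carries s p.2 p.2 then 2 else 0 := by
  have hfix : F (diag A p) = diag A p := hA.map_diag hF hs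
  have hm := mem_edgePairs hp
  have hd := (hA.eq_diag_iff (by norm_num) hp (diag A p)).2 rfl
  have h1 := hF.card_line _ hfix
  rw [cnt_split _ (fun l => ∀ i, ¬ Inc (A i) l)] at h1
  have e1 : cnt (fun l => (F l = l ∧ Inc l (diag A p)) ∧ ∀ i, ¬ Inc (A i) l) =
      cnt (fun l => Avoids F A l ∧ Inc (diag A p) l) :=
    cnt_congr fun l => by rw [inc_comm, Avoids]; tauto
  have e2 : cnt (fun l => (F l = l ∧ Inc l (diag A p)) ∧ ¬ ∀ i, ¬ Inc (A i) l) =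
      cnt (fun l => F l = l ∧ (l = line A p.1 ∨ l = line A p.2)) := by
    refine cnt_congr fun l => ?_
    constructor
    · rintro ⟨⟨h1, h2⟩, h3⟩
      push Not at h3
      obtain ⟨k, hk⟩ := h3
      exact ⟨h1, hA.eq_line_of_diag' hp hk (PolarPlane.symm h2)⟩
    · rintro ⟨h1, rfl | rfl⟩
      · exact ⟨⟨h1, PolarPlane.symm hd.1⟩, fun h => h p.1.1
          ((hA.inc_line_iff (by norm_num) hm.1.ne _).2 (Or.inl rfl))⟩
      · exact ⟨⟨h1, PolarPlane.symm hd.2⟩, fun h => h p.2.1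
          ((hA.inc_line_iff (by norm_num) hm.2.1.ne _).2 (Or.inl rfl))⟩
  have hne := hA.line_ne (by norm_num) hp
  rw [e1, e2] at h1
  rw [← h1]
  split_ifs with hst
  · have : cnt (fun l => F l = l ∧ (l = line A p.1 ∨ l = line A p.2)) =
        cnt (fun l => l = line A p.1 ∨ l = line A p.2) := by
      refine cnt_congr fun l => ⟨fun h => h.2, fun h => ⟨?_, h⟩⟩
      rcases h with rfl | rfl
      · exact map_line hF hA hst.1
      · exact map_line hF hA hst.2
    rw [this, cnt_or, cnt_eq_one _ fun _ => Iff.rfl, cnt_eq_one _ fun _ => Iff.rfl]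
    · ring
    · rintro l rfl
      exact hne
  · have hs := hs.resolve_left hst
    rw [cnt_eq_zero (p := fun l => F l = l ∧ (l = line A p.1 ∨ l = line A p.2))]
    · ring
    · rintro l ⟨h, rfl | rfl⟩
      · rw [map_line hF hA hs.1] at h
        exact hne h.symm
      · rw [map_line hF hA hs.2] at h
        exact hne h

/-- The join of two diagonal points is fixed and avoids the frame. -/
theorem cnt_avoids_diag_diag {F : Equiv.Perm X} {q : ℤ} (hF : IsFrob F q) {s : Fin 4 → Fin 4}
    {A : Fin 4 → X} (hA : Tw F s A) {p r : (Fin 4 × Fin 4) × (Fin 4 × Fin 4)}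
    (hp : p ∈ edgePairs 4) (hr : r ∈ edgePairs 4) (hpr : p ≠ r)
    (hs : (F (diag A p) = diag A p ∧ F (diag A r) = diag A r) ∨
      (F (diag A p) = diag A r ∧ F (diag A r) = diag A p)) :
    cnt (fun l => Avoids F A l ∧ Inc (diag A p) l ∧ Inc (diag A r) l) = 1 := by
  have hne := hA.diag_injOn hp hr hpr
  refine cnt_eq_one (join (diag A p) (diag A r)) fun l => ?_
  constructor
  · exact fun h => eq_join hne h.2.1 h.2.2
  · rintro rfl
    refine ⟨⟨?_, hA.avoid_of_diag hp hr hpr (inc_join_left hne) (inc_join_right hne)⟩,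
      inc_join_left hne, inc_join_right hne⟩
    rw [map_join hF]
    rcases hs with h | h
    · rw [h.1, h.2]
    · rw [h.1, h.2, join_comm]

/-- The three diagonal points, lying on the pairs of opposite lines. -/
noncomputable def diag₀ (A : Fin 4 → X) : X := diag A ((0, 1), (2, 3))

/-- See `diag₀`. -/
noncomputable def diag₁ (A : Fin 4 → X) : X := diag A ((0, 2), (1, 3))

/-- See `diag₀`. -/
noncomputable def diag₂ (A : Fin 4 → X) : X := diag A ((0, 3), (1, 2))

theorem edgePairs_four_mem : ((0, 1), (2, 3)) ∈ edgePairs 4 ∧ ((0, 2), (1, 3)) ∈ edgePairs 4 ∧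
    ((0, 3), (1, 2)) ∈ edgePairs 4 := by decide

/-- The plane satisfies `Φ` exactly if the diagonal points of every frame are collinear: the plane
over a field of characteristic two, for the proposition `Φ` that this is the characteristic. -/
def FanoIff (X : Type*) [PolarPlane X] (Φ : Prop) : Prop :=
  ∀ A : Fin 4 → X, (∀ i j k, i < j → j < k → ¬ Coll (A i) (A j) (A k)) →
    (Coll (diag₀ A) (diag₁ A) (diag₂ A) ↔ Φ)

open Classical in
/-- Here the characteristic enters: the three diagonal points are collinear exactly if `Φ` holds. -/
theorem cnt_avoids_diag_all {F : Equiv.Perm X} {q : ℤ} (hF : IsFrob F q) {Φ : Prop}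
    (hΦ : FanoIff X Φ) {s : Fin 4 → Fin 4}
    {A : Fin 4 → X} (hA : Tw F s A)
    (hs : (F (diag₀ A) = diag₀ A ∧ F (diag₂ A) = diag₂ A) ∨
      (F (diag₀ A) = diag₂ A ∧ F (diag₂ A) = diag₀ A)) :
    cnt (fun l => Avoids F A l ∧ Inc (diag₀ A) l ∧ Inc (diag₁ A) l ∧ Inc (diag₂ A) l) =
      if Φ then 1 else 0 := by
  have hp := edgePairs_four_mem
  have hne : diag₀ A ≠ diag₂ A := hA.diag_injOn hp.1 hp.2.2 (by decide)
  refine cnt_eq_ite (join (diag₀ A) (diag₂ A)) Φ fun l => ?_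
  rw [← hΦ A hA.2]
  constructor
  · rintro ⟨_, h0, h1, h2⟩
    exact ⟨eq_join hne h0 h2, l, h0, h1, h2⟩
  · rintro ⟨rfl, l, h0, h1, h2⟩
    rw [← eq_join hne h0 h2]
    refine ⟨⟨?_, hA.avoid_of_diag hp.1 hp.2.2 (by decide) h0 h2⟩, h0, h1, h2⟩
    rw [eq_join hne h0 h2, map_join hF]
    rcases hs with h | h
    · rw [h.1, h.2]
    · rw [h.1, h.2, join_comm]

/-! ### Sums over the fixed lines avoiding a frame -/

open Classical in
/-- A sum of values that depend on three indicators only, by multilinear expansion. -/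
theorem sum_indicators {α : Type*} [Fintype α] (p a b c : α → Prop) (f : ℤ → ℤ → ℤ → ℤ) :
    (∑ x, if p x then f (if a x then 1 else 0) (if b x then 1 else 0) (if c x then 1 else 0)
      else 0) = f 0 0 0 * cnt p
      + (f 1 0 0 - f 0 0 0) * cnt (fun x => p x ∧ a x)
      + (f 0 1 0 - f 0 0 0) * cnt (fun x => p x ∧ b x)
      + (f 0 0 1 - f 0 0 0) * cnt (fun x => p x ∧ c x)
      + (f 1 1 0 - f 1 0 0 - f 0 1 0 + f 0 0 0) * cnt (fun x => p x ∧ a x ∧ b x)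
      + (f 1 0 1 - f 1 0 0 - f 0 0 1 + f 0 0 0) * cnt (fun x => p x ∧ a x ∧ c x)
      + (f 0 1 1 - f 0 1 0 - f 0 0 1 + f 0 0 0) * cnt (fun x => p x ∧ b x ∧ c x)
      + (f 1 1 1 - f 1 1 0 - f 1 0 1 - f 0 1 1 + f 1 0 0 + f 0 1 0 + f 0 0 1 - f 0 0 0) *
          cnt (fun x => p x ∧ a x ∧ b x ∧ c x) := by
  simp only [cnt_eq_sum, Finset.mul_sum, ← Finset.sum_add_distrib]
  refine Finset.sum_congr rfl fun x _ => ?_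
  by_cases hp : p x <;> by_cases ha : a x <;> by_cases hb : b x <;> by_cases hc : c x <;>
    simp [hp, ha, hb, hc] <;> ring

theorem cnt_distinct_triples {α : Type*} [Fintype α] (p : α → Prop) :
    cnt (fun u : α × (α × α) => p u.1 ∧ p u.2.1 ∧ p u.2.2 ∧ u.2.1 ≠ u.2.2 ∧ u.1 ≠ u.2.1 ∧
      u.1 ≠ u.2.2) = cnt p * ((cnt p - 1) * (cnt p - 2)) := by
  refine cnt_sigma p (fun z (v : α × α) => p v.1 ∧ p v.2 ∧ v.1 ≠ v.2 ∧ z ≠ v.1 ∧ z ≠ v.2) _ fun z hz => ?_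
  have h1 := cnt_ne (p := p) hz
  rw [← h1, cnt_congr (r := fun v : α × α => (p v.1 ∧ v.1 ≠ z) ∧ (p v.2 ∧ v.2 ≠ z) ∧ v.2 ≠ v.1)
    fun v => by grind]
  refine cnt_sigma (fun x => p x ∧ x ≠ z) (fun x y => (p y ∧ y ≠ z) ∧ y ≠ x) _ fun x hx => ?_
  rw [cnt_ne (p := fun y => p y ∧ y ≠ z) hx, h1]
  ring

/-- Triples of distinct aligned fixed points in general position with respect to a frame. -/
noncomputable def alignedTriples (F : Equiv.Perm X) {n : ℕ} (A : Fin n → X) : ℤ :=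
  cnt (fun v : X × (X × (X × X)) => (F v.1 = v.1 ∧ ∀ i, ¬ Inc (A i) v.1) ∧
      (((F v.2.1 = v.2.1 ∧ Inc v.2.1 v.1) ∧ Off A v.2.1) ∧
        (F v.2.2.1 = v.2.2.1 ∧ F v.2.2.2 = v.2.2.2) ∧ (Inc v.2.2.1 v.1 ∧ Off A v.2.2.1) ∧
          (Inc v.2.2.2 v.1 ∧ Off A v.2.2.2) ∧ v.2.2.1 ≠ v.2.2.2 ∧ v.2.1 ≠ v.2.2.1 ∧
            v.2.1 ≠ v.2.2.2))

/-- A fixed point and two conjugate points, aligned and in general position with respect to a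
frame. -/
noncomputable def alignedConj (F : Equiv.Perm X) {n : ℕ} (A : Fin n → X) : ℤ :=
  cnt (fun v : X × (X × (X × X)) => (F v.1 = v.1 ∧ ∀ i, ¬ Inc (A i) v.1) ∧
      (((F v.2.1 = v.2.1 ∧ Inc v.2.1 v.1) ∧ Off A v.2.1) ∧
        (F v.2.2.1 = v.2.2.2 ∧ F v.2.2.2 = v.2.2.1) ∧ (Inc v.2.2.1 v.1 ∧ Off A v.2.2.1) ∧
          (Inc v.2.2.2 v.1 ∧ Off A v.2.2.2) ∧ v.2.2.1 ≠ v.2.2.2 ∧ v.2.1 ≠ v.2.2.1 ∧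
            v.2.1 ≠ v.2.2.2))

open Classical in
/-- Summation over the line; `g l` is the number of admissible fixed points on it. -/
theorem alignedTriples_eq {F : Equiv.Perm X} {n : ℕ} (A : Fin n → X) (g : X → ℤ)
    (hg : ∀ l, Avoids F A l → cnt (fun x => (F x = x ∧ Inc x l) ∧ Off A x) = g l) :
    alignedTriples F A =
      ∑ l, if Avoids F A l then g l * ((g l - 1) * (g l - 2)) else 0 := by
  rw [alignedTriples]
  refine (cnt_sigma_sum (fun l => Avoids F A l) (fun l (v : X × (X × X)) =>
      (((F v.1 = v.1 ∧ Inc v.1 l) ∧ Off A v.1) ∧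
        (F v.2.1 = v.2.1 ∧ F v.2.2 = v.2.2) ∧ (Inc v.2.1 l ∧ Off A v.2.1) ∧
          (Inc v.2.2 l ∧ Off A v.2.2) ∧ v.2.1 ≠ v.2.2 ∧ v.1 ≠ v.2.1 ∧
            v.1 ≠ v.2.2))).trans ?_
  refine Finset.sum_congr rfl fun l _ => ?_
  split_ifs with hl
  · rw [← hg l hl, ← cnt_distinct_triples]
    exact cnt_congr fun v => by tauto
  · rfl

theorem Tw.off_map {F : Equiv.Perm X} {q : ℤ} (hF : IsFrob F q) {n : ℕ} (hn : 3 ≤ n)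
    {s : Fin n → Fin n} {A : Fin n → X} (hA : Tw F s A) {x : X} (hx : Off A (F x)) : Off A x := by
  intro i j hij h
  rw [← hF.inc_iff, map_join hF, hA.1, hA.1] at h
  rcases lt_or_gt_of_ne ((hA.label_injective hn).ne hij.ne) with h' | h'
  · exact hx _ _ h' h
  · rw [join_comm] at h
    exact hx _ _ h' h

open Classical in
/-- Summation over the line; `g l` and `g' l` are the numbers of admissible points on it fixed by
`F` and by `F ^ 2`. -/
theorem alignedConj_eq {F : Equiv.Perm X} {q : ℤ} (hF : IsFrob F q) {n : ℕ} (hn : 3 ≤ n)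
    {s : Fin n → Fin n} (A : Fin n → X) (hA : Tw F s A) (g g' : X → ℤ)
    (hg : ∀ l, Avoids F A l → cnt (fun x => (F x = x ∧ Inc x l) ∧ Off A x) = g l)
    (hg' : ∀ l, Avoids F A l → cnt (fun x => ((F ^ 2) x = x ∧ Inc x l) ∧ Off A x) = g' l) :
    alignedConj F A = ∑ l, if Avoids F A l then g l * (g' l - g l) else 0 := by
  rw [alignedConj]
  refine (cnt_sigma_sum (fun l => Avoids F A l) (fun l (v : X × (X × X)) =>
      (((F v.1 = v.1 ∧ Inc v.1 l) ∧ Off A v.1) ∧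
        (F v.2.1 = v.2.2 ∧ F v.2.2 = v.2.1) ∧ (Inc v.2.1 l ∧ Off A v.2.1) ∧
          (Inc v.2.2 l ∧ Off A v.2.2) ∧ v.2.1 ≠ v.2.2 ∧ v.1 ≠ v.2.1 ∧
            v.1 ≠ v.2.2))).trans ?_
  refine Finset.sum_congr rfl fun l _ => ?_
  split_ifs with hl
  · rw [← hg l hl]
    refine cnt_sigma (fun z => (F z = z ∧ Inc z l) ∧ Off A z) (fun z (v : X × X) =>
        (F v.1 = v.2 ∧ F v.2 = v.1) ∧ (Inc v.1 l ∧ Off A v.1) ∧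
          (Inc v.2 l ∧ Off A v.2) ∧ v.1 ≠ v.2 ∧ z ≠ v.1 ∧ z ≠ v.2) _ ?_
    rintro z ⟨⟨hz, _⟩, _⟩
    rw [cnt_conj_pair fun x y => (Inc x l ∧ Off A x) ∧
          (Inc y l ∧ Off A y) ∧ x ≠ y ∧ z ≠ x ∧ z ≠ y]
    have hs := cnt_split (fun x => ((F ^ 2) x = x ∧ Inc x l) ∧ Off A x) (fun x => F x = x)
    rw [hg' l hl, cnt_congr (p := fun x => (((F ^ 2) x = x ∧ Inc x l) ∧ Off A x) ∧ F x = x)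
      (r := fun x => (F x = x ∧ Inc x l) ∧ Off A x), hg l hl] at hs
    · rw [hg l hl, hs, add_sub_cancel_left]
      refine cnt_congr fun x => ⟨?_, ?_⟩
      · rintro ⟨h1, ⟨h2, h3⟩, _, h4, _⟩
        exact ⟨⟨⟨h1, h2⟩, h3⟩, h4.symm⟩
      · rintro ⟨⟨⟨h1, h2⟩, h3⟩, h4⟩
        have h1' : F (F x) = x := h1
        refine ⟨h1, ⟨h2, h3⟩, ⟨?_, ?_⟩, Ne.symm h4, ?_, ?_⟩
        · rw [← hl.1, hF.inc_iff]
          exact h2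
        · refine hA.off_map hF hn ?_
          rwa [h1']
        · rintro rfl
          exact h4 hz
        · rintro rfl
          exact h4 (F.injective hz)
    · intro x
      constructor
      · exact fun h => ⟨⟨h.2, h.1.1.2⟩, h.1.2⟩
      · exact fun h => ⟨⟨⟨pow_fix h.1.1 2, h.1.2⟩, h.2⟩, h.1.1⟩
  · rfl

theorem tw_snoc_snoc_fix {F : Equiv.Perm X} {n : ℕ} (s : Fin n → Fin n)
    (s' : Fin (n + 2) → Fin (n + 2))
    (h : ∀ i, s' (Fin.castSucc (Fin.castSucc i)) = (Fin.castSucc (Fin.castSucc (s i))))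
    (h1 : s' (Fin.last n).castSucc = (Fin.last n).castSucc)
    (h2 : s' (Fin.last (n + 1)) = Fin.last (n + 1)) (P : Fin n → X) (x y : X) :
    Tw F s' (Fin.snoc (Fin.snoc P x : Fin (n + 1) → X) y) ↔ Tw F s P ∧ (F x = x ∧ F y = y) ∧
      OffC P x ∧ OffC P y ∧ ∀ i, ¬ Coll (P i) x y := by
  unfold Tw
  rw [not_coll_snoc, not_coll_snoc, offC_snoc]
  simp only [Fin.forall_fin_succ', h, h1, h2, Fin.snoc_castSucc, Fin.snoc_last]
  tauto

theorem Tw.sq {F : Equiv.Perm X} {n : ℕ} {s t : Fin n → Fin n} {P : Fin n → X} (h : Tw F s P)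
    (ht : ∀ i, t i = s (s i)) : Tw (F ^ 2) t P :=
  ⟨fun i => by rw [pow_two, Equiv.Perm.mul_apply, h.1, h.1, ht], h.2⟩

theorem cnt_fix_pairs {F : Equiv.Perm X} {n : ℕ} {P : Fin n → X} {c : ℤ}
    (h : cnt (fun x => F x = x ∧ OffC P x) = c) :
    cnt (fun u : X × X => ((F u.1 = u.1 ∧ F u.2 = u.2) ∧ OffC P u.1 ∧ OffC P u.2) ∧ u.1 ≠ u.2) =
      c * (c - 1) := by
  rw [cnt_congr (r := fun u : X × X => (F u.1 = u.1 ∧ OffC P u.1) ∧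
    (F u.2 = u.2 ∧ OffC P u.2) ∧ u.2 ≠ u.1) fun u => by grind]
  refine (cnt_sigma (fun x => F x = x ∧ OffC P x)
    (fun x y => (F y = y ∧ OffC P y) ∧ y ≠ x) (c - 1) fun x hx => ?_).trans ?_
  · rw [cnt_ne (p := fun y => F y = y ∧ OffC P y) hx, h]
  · rw [h]

/-- Pairs of conjugate points are the points fixed by `F ^ 2` and not by `F`. -/
theorem cnt_conj_pairs {F : Equiv.Perm X} {q : ℤ} (hF : IsFrob F q) {n : ℕ} (hn : 3 ≤ n)
    {s : Fin n → Fin n} {P : Fin n → X} (hP : Tw F s P) {c c' : ℤ}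
    (h : cnt (fun x => F x = x ∧ OffC P x) = c)
    (h' : cnt (fun x => (F ^ 2) x = x ∧ OffC P x) = c') :
    cnt (fun u : X × X => ((F u.1 = u.2 ∧ F u.2 = u.1) ∧ OffC P u.1 ∧ OffC P u.2) ∧ u.1 ≠ u.2) =
      c' - c := by
  rw [cnt_congr (r := fun u : X × X => (F u.1 = u.2 ∧ F u.2 = u.1) ∧
    (OffC P u.1 ∧ OffC P u.2 ∧ u.1 ≠ u.2)) fun u => by tauto]
  rw [cnt_conj_pair fun x y => OffC P x ∧ OffC P y ∧ x ≠ y]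
  rw [← h', ← h, cnt_split (fun x => (F ^ 2) x = x ∧ OffC P x) (fun x => F x = x),
    cnt_congr (p := fun x => ((F ^ 2) x = x ∧ OffC P x) ∧ F x = x)
      (r := fun x => F x = x ∧ OffC P x)
      fun x => ⟨fun k => ⟨k.2, k.1.2⟩, fun k => ⟨⟨pow_fix k.1 2, k.2⟩, k.1⟩⟩, add_sub_cancel_left]
  refine cnt_congr fun x => ⟨?_, ?_⟩
  · rintro ⟨h1, h2, _, h3⟩
    exact ⟨⟨h1, h2⟩, h3.symm⟩
  · rintro ⟨⟨h1, h2⟩, h3⟩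
    refine ⟨h1, h2, ?_, Ne.symm h3⟩
    rw [hP.offC_iff hn] at h2 ⊢
    refine hP.off_map hF hn ?_
    have : F (F x) = x := h1
    rwa [this]

theorem join_fix_of_fix {F : Equiv.Perm X} {q : ℤ} (hF : IsFrob F q) (x y : X)
    (h : F x = x ∧ F y = y) (_ : x ≠ y) : F (join x y) = join x y := by
  rw [map_join hF, h.1, h.2]

theorem join_fix_of_conj {F : Equiv.Perm X} {q : ℤ} (hF : IsFrob F q) (x y : X)
    (h : F x = y ∧ F y = x) (_ : x ≠ y) : F (join x y) = join x y := by
  rw [map_join hF, h.1, h.2, join_comm]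

open Classical in
/-- The lines `A 0 A 1` and `A 2 A 3` are fixed and the other four are exchanged in opposite pairs,
so the diagonal points enter with different signs. -/
theorem cnt_line_two_two {F : Equiv.Perm X} {q : ℤ} (hF : IsFrob F q)
    {A : Fin 4 → X} (hA : Tw F ![1, 0, 3, 2] A) {l : X} (hl : Avoids F A l) :
    cnt (fun x => (F x = x ∧ Inc x l) ∧ Off A x) = q + 1 - 2
      + (if Inc (diag₀ A) l then 1 else 0)
      - ((if Inc (diag₁ A) l then 1 else 0) + if Inc (diag₂ A) l then 1 else 0) := by
  rw [cnt_line_off hF (by norm_num) (by norm_num) hA hl.1 hl.2]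
  rw [show ((edges 4).filter fun e => Carries ![1, 0, 3, 2] e e).card = 2 by decide,
    show ((edgePairs 4).filter fun p => Carries ![1, 0, 3, 2] p.1 p.1 ∧
      Carries ![1, 0, 3, 2] p.2 p.2) = {((0, 1), (2, 3))} by decide,
    show ((edgePairs 4).filter fun p => Carries ![1, 0, 3, 2] p.1 p.2 ∧
      Carries ![1, 0, 3, 2] p.2 p.1) = {((0, 2), (1, 3)), ((0, 3), (1, 2))} by decide]
  simp [diag₀, diag₁, diag₂, -Finset.sum_boole]
  congr!

open Classical in
theorem cnt_line_id {F : Equiv.Perm X} {q : ℤ} (hF : IsFrob F q)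
    {A : Fin 4 → X} (hA : Tw F ![0, 1, 2, 3] A) {l : X} (hl : Avoids F A l) :
    cnt (fun x => (F x = x ∧ Inc x l) ∧ Off A x) = q + 1 - 6
      + ((if Inc (diag₀ A) l then 1 else 0)
      + ((if Inc (diag₁ A) l then 1 else 0) + if Inc (diag₂ A) l then 1 else 0)) := by
  rw [cnt_line_off hF (by norm_num) (by norm_num) hA hl.1 hl.2]
  rw [show ((edges 4).filter fun e => Carries ![0, 1, 2, 3] e e).card = 6 by decide,
    show ((edgePairs 4).filter fun p => Carries ![0, 1, 2, 3] p.1 p.1 ∧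
      Carries ![0, 1, 2, 3] p.2 p.2) =
        {((0, 1), (2, 3)), ((0, 2), (1, 3)), ((0, 3), (1, 2))} by decide,
    show ((edgePairs 4).filter fun p => Carries ![0, 1, 2, 3] p.1 p.2 ∧
      Carries ![0, 1, 2, 3] p.2 p.1) = ∅ by decide]
  simp [diag₀, diag₁, diag₂, -Finset.sum_boole]
  congr!

open Classical in
theorem cnt_line_four {F : Equiv.Perm X} {q : ℤ} (hF : IsFrob F q)
    {A : Fin 4 → X} (hA : Tw F ![1, 2, 3, 0] A) {l : X} (hl : Avoids F A l) :
    cnt (fun x => (F x = x ∧ Inc x l) ∧ Off A x) = q + 1 - if Inc (diag₁ A) l then 1 else 0 := by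
  rw [cnt_line_off hF (by norm_num) (by norm_num) hA hl.1 hl.2]
  rw [show ((edges 4).filter fun e => Carries ![1, 2, 3, 0] e e).card = 0 by decide,
    show ((edgePairs 4).filter fun p => Carries ![1, 2, 3, 0] p.1 p.1 ∧
      Carries ![1, 2, 3, 0] p.2 p.2) = ∅ by decide,
    show ((edgePairs 4).filter fun p => Carries ![1, 2, 3, 0] p.1 p.2 ∧
      Carries ![1, 2, 3, 0] p.2 p.1) = {((0, 2), (1, 3))} by decide]
  simp [diag₁, -Finset.sum_boole]
  congr!

open Classical in
theorem cnt_line_four_sq {F : Equiv.Perm X} {q : ℤ} (hF : IsFrob F q)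
    {A : Fin 4 → X} (hA : Tw F ![2, 3, 0, 1] A) {l : X} (hl : Avoids F A l) :
    cnt (fun x => (F x = x ∧ Inc x l) ∧ Off A x) = q + 1 - 2
      + (if Inc (diag₁ A) l then 1 else 0)
      - ((if Inc (diag₀ A) l then 1 else 0) + if Inc (diag₂ A) l then 1 else 0) := by
  rw [cnt_line_off hF (by norm_num) (by norm_num) hA hl.1 hl.2]
  rw [show ((edges 4).filter fun e => Carries ![2, 3, 0, 1] e e).card = 2 by decide,
    show ((edgePairs 4).filter fun p => Carries ![2, 3, 0, 1] p.1 p.1 ∧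
      Carries ![2, 3, 0, 1] p.2 p.2) = {((0, 2), (1, 3))} by decide,
    show ((edgePairs 4).filter fun p => Carries ![2, 3, 0, 1] p.1 p.2 ∧
      Carries ![2, 3, 0, 1] p.2 p.1) = {((0, 1), (2, 3)), ((0, 3), (1, 2))} by decide]
  simp [diag₀, diag₁, diag₂, -Finset.sum_boole]
  congr!

theorem Avoids.pow {F : Equiv.Perm X} {n : ℕ} {A : Fin n → X} {l : X} (h : Avoids F A l) (k : ℕ) :
    Avoids (F ^ k) A l :=
  ⟨pow_fix h.1 k, h.2⟩

/-! ### Aligned triples for each type of frame -/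

open Classical in
/-- `g l` is `q - 5` plus the number of diagonal points on `l`; the sum over `l` is evaluated by
inclusion-exclusion on the diagonal points (`sum_indicators`). -/
theorem alignedTriples_id {F : Equiv.Perm X} {q : ℤ} (hF : IsFrob F q) {Φ : Prop}
    (hΦ : FanoIff X Φ) {A : Fin 4 → X} (hA : Tw F ![0, 1, 2, 3] A) :
    alignedTriples F A = q ^ 5 - 21 * q ^ 4 + 173 * q ^ 3 - 693 * q ^ 2 + 1338 * q - 990
      + if Φ then 6 else 0 := by
  have hp := edgePairs_four_mem
  rw [alignedTriples_eq A fun l => q + 1 - 6 + ((if Inc (diag₀ A) l then 1 else 0)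
    + ((if Inc (diag₁ A) l then 1 else 0) + if Inc (diag₂ A) l then 1 else 0))]
  · have := sum_indicators (fun l => Avoids F A l) (fun l => Inc (diag₀ A) l)
      (fun l => Inc (diag₁ A) l) (fun l => Inc (diag₂ A) l) (fun a b c =>
      (q + 1 - 6 + (a + (b + c))) * (((q + 1 - 6 + (a + (b + c))) - 1) *
        ((q + 1 - 6 + (a + (b + c))) - 2)))
    rw [this]
    have h0 := hA.map_diag hF (p := ((0, 1), (2, 3))) (r := ((0, 1), (2, 3))) (by decide)
    have h1 := hA.map_diag hF (p := ((0, 2), (1, 3))) (r := ((0, 2), (1, 3))) (by decide)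
    have h2 := hA.map_diag hF (p := ((0, 3), (1, 2))) (r := ((0, 3), (1, 2))) (by decide)
    have n := cnt_avoid hF (by norm_num) hA 4 6 0 (by decide) (by decide) (by decide)
    have l0 := cnt_avoids_diag hF hA hp.1 (by decide)
    have l1 := cnt_avoids_diag hF hA hp.2.1 (by decide)
    have l2 := cnt_avoids_diag hF hA hp.2.2 (by decide)
    have l01 := cnt_avoids_diag_diag hF hA hp.1 hp.2.1 (by decide) (Or.inl ⟨h0, h1⟩)
    have l02 := cnt_avoids_diag_diag hF hA hp.1 hp.2.2 (by decide) (Or.inl ⟨h0, h2⟩)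
    have l12 := cnt_avoids_diag_diag hF hA hp.2.1 hp.2.2 (by decide) (Or.inl ⟨h1, h2⟩)
    have l012 := cnt_avoids_diag_all hF hΦ hA (Or.inl ⟨h0, h2⟩)
    rw [if_pos (by decide)] at l0 l1 l2
    simp only [diag₀, diag₁, diag₂, Avoids] at *
    rw [n, l0, l1, l2, l01, l02, l12, l012]
    split_ifs <;> push_cast <;> ring
  · exact fun l hl => cnt_line_id hF hA hl

theorem alignedTriples_two {F : Equiv.Perm X} {q : ℤ} (hF : IsFrob F q)
    {A : Fin 4 → X} (hA : Tw F ![1, 0, 2, 3] A) :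
    alignedTriples F A = q ^ 5 - 7 * q ^ 4 + 19 * q ^ 3 - 23 * q ^ 2 + 10 * q := by
  classical
  have hp := edgePairs_four_mem
  rw [alignedTriples_eq A fun l => q + 1 - 2 + if Inc (diag₀ A) l then 1 else 0]
  · have := sum_indicators (fun l => Avoids F A l) (fun l => Inc (diag₀ A) l)
      (fun l => Inc (diag₀ A) l) (fun l => Inc (diag₀ A) l) (fun a _ _ =>
      (q + 1 - 2 + a) * (((q + 1 - 2 + a) - 1) * ((q + 1 - 2 + a) - 2)))
    rw [this]
    have n := cnt_avoid hF (by norm_num) hA 2 1 1 (by decide) (by decide) (by decide)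
    have l0 := cnt_avoids_diag hF hA hp.1 (by decide)
    rw [if_pos (by decide)] at l0
    simp only [diag₀, Avoids] at *
    rw [n, l0]
    push_cast
    ring
  · intro l hl
    rw [cnt_line_off hF (by norm_num) (by norm_num) hA hl.1 hl.2]
    rw [show ((edges 4).filter fun e => Carries ![1, 0, 2, 3] e e).card = 2 by decide,
      show ((edgePairs 4).filter fun p => Carries ![1, 0, 2, 3] p.1 p.1 ∧
        Carries ![1, 0, 2, 3] p.2 p.2) = {((0, 1), (2, 3))} by decide,
      show ((edgePairs 4).filter fun p => Carries ![1, 0, 2, 3] p.1 p.2 ∧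
        Carries ![1, 0, 2, 3] p.2 p.1) = ∅ by decide]
    simp [diag₀, -Finset.sum_boole]
    congr!

/-- The numbers of fixed lines avoiding a frame of type `(2, 2)` and passing through given
diagonal points. -/
theorem cnt_avoids_two_two {F : Equiv.Perm X} {q : ℤ} (hF : IsFrob F q)
    {A : Fin 4 → X} (hA : Tw F ![1, 0, 3, 2] A) :
    cnt (fun l => Avoids F A l) = q ^ 2 + q - 1 ∧
    cnt (fun l => Avoids F A l ∧ Inc (diag₀ A) l) = q - 1 ∧
    cnt (fun l => Avoids F A l ∧ Inc (diag₁ A) l) = q + 1 ∧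
    cnt (fun l => Avoids F A l ∧ Inc (diag₂ A) l) = q + 1 ∧
    cnt (fun l => Avoids F A l ∧ Inc (diag₀ A) l ∧ Inc (diag₁ A) l) = 1 ∧
    cnt (fun l => Avoids F A l ∧ Inc (diag₀ A) l ∧ Inc (diag₂ A) l) = 1 ∧
    cnt (fun l => Avoids F A l ∧ Inc (diag₁ A) l ∧ Inc (diag₂ A) l) = 1 := by
  have hp := edgePairs_four_mem
  have h0 := hA.map_diag hF (p := ((0, 1), (2, 3))) (r := ((0, 1), (2, 3))) (by decide)
  have h1 := hA.map_diag hF (p := ((0, 2), (1, 3))) (r := ((0, 2), (1, 3))) (by decide)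
  have h2 := hA.map_diag hF (p := ((0, 3), (1, 2))) (r := ((0, 3), (1, 2))) (by decide)
  refine ⟨?_, ?_, ?_, ?_, cnt_avoids_diag_diag hF hA hp.1 hp.2.1 (by decide) (Or.inl ⟨h0, h1⟩),
    cnt_avoids_diag_diag hF hA hp.1 hp.2.2 (by decide) (Or.inl ⟨h0, h2⟩),
    cnt_avoids_diag_diag hF hA hp.2.1 hp.2.2 (by decide) (Or.inl ⟨h1, h2⟩)⟩
  · refine (cnt_avoid hF (by norm_num) hA 0 0 2 (by decide) (by decide) (by decide)).trans ?_
    push_cast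
    ring
  · refine (cnt_avoids_diag hF hA hp.1 (by decide)).trans ?_
    rw [if_pos (by decide)]
    ring
  · refine (cnt_avoids_diag hF hA hp.2.1 (by decide)).trans ?_
    rw [if_neg (by decide)]
    ring
  · refine (cnt_avoids_diag hF hA hp.2.2 (by decide)).trans ?_
    rw [if_neg (by decide)]
    ring

open Classical in
theorem cnt_avoids_two_two_all {F : Equiv.Perm X} {q : ℤ} (hF : IsFrob F q) {Φ : Prop}
    (hΦ : FanoIff X Φ) {A : Fin 4 → X} (hA : Tw F ![1, 0, 3, 2] A) :
    cnt (fun l => Avoids F A l ∧ Inc (diag₀ A) l ∧ Inc (diag₁ A) l ∧ Inc (diag₂ A) l) =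
      if Φ then 1 else 0 :=
  cnt_avoids_diag_all hF hΦ hA (Or.inl
    ⟨hA.map_diag hF (p := ((0, 1), (2, 3))) (r := ((0, 1), (2, 3))) (by decide),
      hA.map_diag hF (p := ((0, 3), (1, 2))) (r := ((0, 3), (1, 2))) (by decide)⟩)

open Classical in
theorem alignedTriples_two_two {F : Equiv.Perm X} {q : ℤ} (hF : IsFrob F q) {Φ : Prop}
    (hΦ : FanoIff X Φ) {A : Fin 4 → X} (hA : Tw F ![1, 0, 3, 2] A) :
    alignedTriples F A = q ^ 5 - 5 * q ^ 4 + q ^ 3 + 23 * q ^ 2 - 14 * q - 30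
      + if Φ then 6 else 0 := by
  rw [alignedTriples_eq A _ fun l hl => cnt_line_two_two hF hA hl]
  have := sum_indicators (fun l => Avoids F A l) (fun l => Inc (diag₀ A) l)
    (fun l => Inc (diag₁ A) l) (fun l => Inc (diag₂ A) l) (fun a b c =>
    (q + 1 - 2 + a - (b + c)) * (((q + 1 - 2 + a - (b + c)) - 1) *
      ((q + 1 - 2 + a - (b + c)) - 2)))
  obtain ⟨n, l0, l1, l2, l01, l02, l12⟩ := cnt_avoids_two_two hF hA
  rw [this, n, l0, l1, l2, l01, l02, l12, cnt_avoids_two_two_all hF hΦ hA]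
  split_ifs <;> ring

open Classical in
theorem alignedConj_two_two {F : Equiv.Perm X} {q : ℤ} (hF : IsFrob F q)
    (hF2 : IsFrob (F ^ 2) (q ^ 2)) {Φ : Prop}
    (hΦ : FanoIff X Φ) {A : Fin 4 → X} (hA : Tw F ![1, 0, 3, 2] A) :
    alignedConj F A = q ^ 5 - q ^ 4 - 7 * q ^ 3 + 5 * q ^ 2 + 10 * q := by
  rw [alignedConj_eq hF (by norm_num) A hA _ _ (fun l hl => cnt_line_two_two hF hA hl)
    fun l hl => cnt_line_id hF2 (hA.sq (t := ![0, 1, 2, 3]) (by decide)) (hl.pow 2)]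
  have := sum_indicators (fun l => Avoids F A l) (fun l => Inc (diag₀ A) l)
    (fun l => Inc (diag₁ A) l) (fun l => Inc (diag₂ A) l) (fun a b c =>
    (q + 1 - 2 + a - (b + c)) * ((q ^ 2 + 1 - 6 + (a + (b + c))) -
      (q + 1 - 2 + a - (b + c))))
  obtain ⟨n, l0, l1, l2, l01, l02, l12⟩ := cnt_avoids_two_two hF hA
  rw [this, n, l0, l1, l2, l01, l02, l12, cnt_avoids_two_two_all hF hΦ hA]
  split_ifs <;> ring

/-- The numbers of fixed lines avoiding a frame of type `(4)` and passing through given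
diagonal points; the first and the last of these points are conjugate. -/
theorem cnt_avoids_four {F : Equiv.Perm X} {q : ℤ} (hF : IsFrob F q)
    {A : Fin 4 → X} (hA : Tw F ![1, 2, 3, 0] A) :
    (F (diag₀ A) = diag₂ A ∧ F (diag₂ A) = diag₀ A) ∧
    cnt (fun l => Avoids F A l) = q ^ 2 + q + 1 ∧
    cnt (fun l => Avoids F A l ∧ Inc (diag₁ A) l) = q + 1 ∧
    cnt (fun l => Avoids F A l ∧ Inc (diag₀ A) l ∧ Inc (diag₂ A) l) = 1 := by
  have hp := edgePairs_four_mem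
  have h0 := hA.map_diag hF (p := ((0, 1), (2, 3))) (r := ((0, 3), (1, 2))) (by decide)
  have h2 := hA.map_diag hF (p := ((0, 3), (1, 2))) (r := ((0, 1), (2, 3))) (by decide)
  refine ⟨⟨h0, h2⟩, ?_, ?_,
    cnt_avoids_diag_diag hF hA hp.1 hp.2.2 (by decide) (Or.inr ⟨h0, h2⟩)⟩
  · refine (cnt_avoid hF (by norm_num) hA 0 0 0 (by decide) (by decide) (by decide)).trans ?_
    push_cast
    ring
  · refine (cnt_avoids_diag hF hA hp.2.1 (by decide)).trans ?_
    rw [if_neg (by decide)]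
    ring

theorem alignedTriples_four {F : Equiv.Perm X} {q : ℤ} (hF : IsFrob F q)
    {A : Fin 4 → X} (hA : Tw F ![1, 2, 3, 0] A) :
    alignedTriples F A = q ^ 5 + q ^ 4 - 3 * q ^ 3 - q ^ 2 + 2 * q := by
  classical
  rw [alignedTriples_eq A _ fun l hl => cnt_line_four hF hA hl]
  have := sum_indicators (fun l => Avoids F A l) (fun l => Inc (diag₁ A) l)
    (fun l => Inc (diag₁ A) l) (fun l => Inc (diag₁ A) l) (fun a _ _ =>
    (q + 1 - a) * (((q + 1 - a) - 1) * ((q + 1 - a) - 2)))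
  obtain ⟨_, n, l1, _⟩ := cnt_avoids_four hF hA
  rw [this, n, l1]
  ring

open Classical in
theorem alignedConj_four {F : Equiv.Perm X} {q : ℤ} (hF : IsFrob F q)
    (hF2 : IsFrob (F ^ 2) (q ^ 2)) {Φ : Prop}
    (hΦ : FanoIff X Φ) {A : Fin 4 → X} (hA : Tw F ![1, 2, 3, 0] A) :
    alignedConj F A = q ^ 5 + q ^ 4 - 3 * q ^ 3 - 3 * q ^ 2 - 2 * q - 2
      + if Φ then 2 else 0 := by
  rw [alignedConj_eq hF (by norm_num) A hA _ _ (fun l hl => cnt_line_four hF hA hl)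
    fun l hl => cnt_line_four_sq hF2 (hA.sq (t := ![2, 3, 0, 1]) (by decide)) (hl.pow 2)]
  have := sum_indicators (fun l => Avoids F A l) (fun l => Inc (diag₀ A) l)
    (fun l => Inc (diag₁ A) l) (fun l => Inc (diag₂ A) l) (fun a b c =>
    (q + 1 - b) * ((q ^ 2 + 1 - 2 + b - (a + c)) - (q + 1 - b)))
  obtain ⟨hd, n, l1, l02⟩ := cnt_avoids_four hF hA
  have h02 : ∀ l, F l = l → (Inc (diag₀ A) l ↔ Inc (diag₂ A) l) := fun l hl => by
    rw [← hF.inc_iff, hd.1, hl]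
  have l0 : cnt (fun l => Avoids F A l ∧ Inc (diag₀ A) l) = 1 := by
    rw [← l02]
    exact cnt_congr fun l => by have := fun h : Avoids F A l => h02 l h.1; tauto
  have l2 : cnt (fun l => Avoids F A l ∧ Inc (diag₂ A) l) = 1 := by
    rw [← l02]
    exact cnt_congr fun l => by have := fun h : Avoids F A l => h02 l h.1; tauto
  have l012 := cnt_avoids_diag_all hF hΦ hA (Or.inr hd)
  have l01 : cnt (fun l => Avoids F A l ∧ Inc (diag₀ A) l ∧ Inc (diag₁ A) l) =
      if Φ then 1 else 0 := by
    rw [← l012]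
    exact cnt_congr fun l => by have := fun h : Avoids F A l => h02 l h.1; tauto
  have l12 : cnt (fun l => Avoids F A l ∧ Inc (diag₁ A) l ∧ Inc (diag₂ A) l) =
      if Φ then 1 else 0 := by
    rw [← l012]
    exact cnt_congr fun l => by have := fun h : Avoids F A l => h02 l h.1; tauto
  rw [this, n, l0, l1, l2, l01, l02, l12, l012]
  split_ifs <;> ring

/-! ### Seven points from a frame -/

/-- Arcs with five points from a frame, by adding a fixed point. The numbers `a`, ..., `e` are those
of `cnt_fix_off`: fixed labels, edges fixed with both ends and edges reversed, and pairs of edges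
fixed and exchanged. -/
theorem numTw_five {F : Equiv.Perm X} {q : ℤ} (hF : IsFrob F q) (s : Fin 4 → Fin 4)
    (s' : Fin 5 → Fin 5) (h : ∀ i, s' i.castSucc = (s i).castSucc)
    (hl : s' (Fin.last 4) = Fin.last 4) (hs : numTw (X := X) F s = pglCard q) (a b c d e : ℕ)
    (ha : (Finset.univ.filter fun i => s i = i).card = a)
    (hb : ((edges 4).filter (fun e => Carries s e e ∧ s e.1 = e.1)).card = b)
    (hc : ((edges 4).filter (fun e => Carries s e e ∧ ¬ s e.1 = e.1)).card = c)
    (hd : ((edgePairs 4).filter fun p => Carries s p.1 p.1 ∧ Carries s p.2 p.2).card = d)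
    (he : ((edgePairs 4).filter fun p => Carries s p.1 p.2 ∧ Carries s p.2 p.1).card = e) :
    numTw (X := X) F s' =
      pglCard q * (q ^ 2 + q + 1 - a - (b * (q - 1) + c * (q + 1)) + d - e) := by
  rw [numTw_snoc s s' h hl _ fun P hP => cnt_fix_offC' hF (by norm_num) (by norm_num) hP a b c d e
    ha hb hc hd he, hs]

/-- Arcs with seven points from arcs with five points, by adding two fixed points. -/
theorem numTw_add_fix_fix {F : Equiv.Perm X} {q : ℤ} (hF : IsFrob F q) (s : Fin 5 → Fin 5)
    (s' : Fin 7 → Fin 7)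
    (h : ∀ i, s' (Fin.castSucc (Fin.castSucc i)) = (Fin.castSucc (Fin.castSucc (s i))))
    (h1 : s' 5 = 5) (h2 : s' 6 = 6) (a b c d e : ℕ)
    (ha : (Finset.univ.filter fun i => s i = i).card = a)
    (hb : ((edges 5).filter (fun e => Carries s e e ∧ s e.1 = e.1)).card = b)
    (hc : ((edges 5).filter (fun e => Carries s e e ∧ ¬ s e.1 = e.1)).card = c)
    (hd : ((edgePairs 5).filter fun p => Carries s p.1 p.1 ∧ Carries s p.2 p.2).card = d)
    (he : ((edgePairs 5).filter fun p => Carries s p.1 p.2 ∧ Carries s p.2 p.1).card = e) :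
    numTw (X := X) F s' = numTw (X := X) F s *
      ((q ^ 2 + q + 1 - a - (b * (q - 1) + c * (q + 1)) + d - e) *
        ((q ^ 2 + q + 1 - a - (b * (q - 1) + c * (q + 1)) + d - e) - 1)) -
      ∑ i, numAligned (X := X) F (fun x y => F x = x ∧ F y = y) s i :=
  numTw_pair _ (by norm_num) s s' (fun P x y => tw_snoc_snoc_fix s s' h h1 h2 P x y) _
    fun _ hP => cnt_fix_pairs
      (cnt_fix_offC' hF (by norm_num) (by norm_num) hP a b c d e ha hb hc hd he)

/-- Arcs with seven points from arcs with five points, by adding two conjugate points. -/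
theorem numTw_add_conj {F : Equiv.Perm X} {q : ℤ} (hF : IsFrob F q) (hF2 : IsFrob (F ^ 2) (q ^ 2))
    (s t : Fin 5 → Fin 5) (ht : ∀ i, t i = s (s i)) (s' : Fin 7 → Fin 7)
    (h : ∀ i, s' (Fin.castSucc (Fin.castSucc i)) = (Fin.castSucc (Fin.castSucc (s i))))
    (h1 : s' 5 = 6) (h2 : s' 6 = 5) (a b c d e : ℕ)
    (ha : (Finset.univ.filter fun i => s i = i).card = a)
    (hb : ((edges 5).filter (fun e => Carries s e e ∧ s e.1 = e.1)).card = b)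
    (hc : ((edges 5).filter (fun e => Carries s e e ∧ ¬ s e.1 = e.1)).card = c)
    (hd : ((edgePairs 5).filter fun p => Carries s p.1 p.1 ∧ Carries s p.2 p.2).card = d)
    (he : ((edgePairs 5).filter fun p => Carries s p.1 p.2 ∧ Carries s p.2 p.1).card = e)
    (a' b' c' d' e' : ℕ)
    (ha' : (Finset.univ.filter fun i => t i = i).card = a')
    (hb' : ((edges 5).filter (fun e => Carries t e e ∧ t e.1 = e.1)).card = b')
    (hc' : ((edges 5).filter (fun e => Carries t e e ∧ ¬ t e.1 = e.1)).card = c')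
    (hd' : ((edgePairs 5).filter fun p => Carries t p.1 p.1 ∧ Carries t p.2 p.2).card = d')
    (he' : ((edgePairs 5).filter fun p => Carries t p.1 p.2 ∧ Carries t p.2 p.1).card = e') :
    numTw (X := X) F s' = numTw (X := X) F s *
      ((q ^ 4 + q ^ 2 + 1 - a' - (b' * (q ^ 2 - 1) + c' * (q ^ 2 + 1)) + d' - e') -
        (q ^ 2 + q + 1 - a - (b * (q - 1) + c * (q + 1)) + d - e)) -
      ∑ i, numAligned (X := X) F (fun x y => F x = y ∧ F y = x) s i :=
  numTw_pair _ (by norm_num) s s' (fun P x y => tw_snoc_snoc s s' h h1 h2 P x y) _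
    fun _ hP => (cnt_conj_pairs hF (by norm_num) hP
      (cnt_fix_offC' hF (by norm_num) (by norm_num) hP a b c d e ha hb hc hd he)
      (cnt_fix_offC' hF2 (by norm_num) (by norm_num) (hP.sq ht) a' b' c' d' e' ha' hb' hc' hd'
        he')).trans (by ring)

/-- The contribution of the fixed points of a five-point arc to the aligned pairs, all of them
equal to that of the last point. -/
theorem sum_numAligned {F : Equiv.Perm X} {q : ℤ} (hF : IsFrob F q) (R : X → X → Prop)
    (hR : ∀ x y, R x y → x ≠ y → F (join x y) = join x y) (s : Fin 5 → Fin 5)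
    (hs : Function.Injective s) (hl : s 4 = 4) (m : ℕ)
    (hm : (Finset.univ.filter fun i => s i = i).card = m) :
    ∑ i, numAligned (X := X) F R s i = m * numAligned (X := X) F R s (Fin.last 4) := by
  rw [← hm, ← nsmul_eq_mul, ← Finset.sum_const, Finset.sum_filter]
  refine Finset.sum_congr rfl fun i _ => ?_
  split_ifs with h
  · exact numAligned_eq_of_fix R s hs h hl
  · exact numAligned_of_ne hF R hR s h

theorem sum_numAligned_fix {F : Equiv.Perm X} {q : ℤ} (hF : IsFrob F q) (s : Fin 4 → Fin 4)
    (s' : Fin 5 → Fin 5) (hs : Function.Injective s') (h : ∀ i, s' i.castSucc = (s i).castSucc)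
    (hl : s' 4 = 4) (m : ℕ) (hm : (Finset.univ.filter fun i => s' i = i).card = m) (b : ℤ)
    (hb : ∀ A : Fin 4 → X, Tw F s A → alignedTriples F A = b) :
    ∑ i, numAligned (X := X) F (fun x y => F x = x ∧ F y = y) s' i =
      m * (numTw (X := X) F s * b) := by
  rw [sum_numAligned hF _ (join_fix_of_fix hF) s' hs hl m hm,
    numAligned_last _ (join_fix_of_fix hF) (by norm_num) s s' h hl b hb]

theorem sum_numAligned_conj {F : Equiv.Perm X} {q : ℤ} (hF : IsFrob F q) (s : Fin 4 → Fin 4)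
    (s' : Fin 5 → Fin 5) (hs : Function.Injective s') (h : ∀ i, s' i.castSucc = (s i).castSucc)
    (hl : s' 4 = 4) (m : ℕ) (hm : (Finset.univ.filter fun i => s' i = i).card = m) (b : ℤ)
    (hb : ∀ A : Fin 4 → X, Tw F s A → alignedConj F A = b) :
    ∑ i, numAligned (X := X) F (fun x y => F x = y ∧ F y = x) s' i =
      m * (numTw (X := X) F s * b) := by
  rw [sum_numAligned hF _ (join_fix_of_conj hF) s' hs hl m hm,
    numAligned_last _ (join_fix_of_conj hF) (by norm_num) s s' h hl b hb]

open Classical in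
/-- The `30` comes from the `6` additional aligned triples of `alignedTriples_id`, once for each of
the five points of the arc. -/
theorem numTw_id {F : Equiv.Perm X} {q : ℤ} (hF : IsFrob F q) {Φ : Prop} (hΦ : FanoIff X Φ) :
    numTw (X := X) F ![0, 1, 2, 3, 4, 5, 6] = pglCard q * (q ^ 6 - 28 * q ^ 5 + 323 * q ^ 4
      - 1952 * q ^ 3 + 6462 * q ^ 2 - 11004 * q + 7470 - if Φ then 30 else 0) := by
  rw [numTw_add_fix_fix hF ![0, 1, 2, 3, 4] ![0, 1, 2, 3, 4, 5, 6] (by decide) (by decide)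
    (by decide) 5 10 0 15 0 (by decide) (by decide) (by decide) (by decide) (by decide),
    sum_numAligned_fix hF ![0, 1, 2, 3] ![0, 1, 2, 3, 4] (by decide) (by decide) (by decide) 5
      (by decide) _ fun A hA => alignedTriples_id hF hΦ hA,
    numTw_five hF ![0, 1, 2, 3] ![0, 1, 2, 3, 4] (by decide) (by decide) (numTw_frame_id hF)
      4 6 0 3 0 (by decide) (by decide) (by decide) (by decide) (by decide), numTw_frame_id hF]
  split_ifs <;> push_cast <;> ring

theorem numTw_two {F : Equiv.Perm X} {q : ℤ} (hF : IsFrob F q) (hF2 : IsFrob (F ^ 2) (q ^ 2)) :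
    numTw (X := X) F ![1, 0, 2, 3, 4, 5, 6] = pglCard q * (q ^ 6 - 10 * q ^ 5 + 41 * q ^ 4
      - 86 * q ^ 3 + 90 * q ^ 2 - 36 * q) := by
  rw [numTw_add_fix_fix hF ![1, 0, 2, 3, 4] ![1, 0, 2, 3, 4, 5, 6] (by decide) (by decide)
    (by decide) 3 3 1 3 0 (by decide) (by decide) (by decide) (by decide) (by decide),
    sum_numAligned_fix hF ![1, 0, 2, 3] ![1, 0, 2, 3, 4] (by decide) (by decide) (by decide) 3
      (by decide) _ fun A hA => alignedTriples_two hF hA,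
    numTw_five hF ![1, 0, 2, 3] ![1, 0, 2, 3, 4] (by decide) (by decide) (numTw_frame_two hF hF2)
      2 1 1 1 0 (by decide) (by decide) (by decide) (by decide) (by decide),
    numTw_frame_two hF hF2]
  push_cast
  ring

open Classical in
theorem numTw_two_two {F : Equiv.Perm X} {q : ℤ} (hF : IsFrob F q)
    (hF2 : IsFrob (F ^ 2) (q ^ 2)) {Φ : Prop} (hΦ : FanoIff X Φ) :
    numTw (X := X) F ![1, 0, 3, 2, 4, 5, 6] = pglCard q * (q ^ 6 - 4 * q ^ 5 - q ^ 4
      + 16 * q ^ 3 - 6 * q ^ 2 - 12 * q + 6 - if Φ then 6 else 0) := by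
  rw [numTw_add_fix_fix hF ![1, 0, 3, 2, 4] ![1, 0, 3, 2, 4, 5, 6] (by decide) (by decide)
    (by decide) 1 0 2 1 2 (by decide) (by decide) (by decide) (by decide) (by decide),
    sum_numAligned_fix hF ![1, 0, 3, 2] ![1, 0, 3, 2, 4] (by decide) (by decide) (by decide) 1
      (by decide) _ fun A hA => alignedTriples_two_two hF hΦ hA,
    numTw_five hF ![1, 0, 3, 2] ![1, 0, 3, 2, 4] (by decide) (by decide)
      (numTw_frame_two_two hF hF2)
      0 0 2 1 2 (by decide) (by decide) (by decide) (by decide) (by decide),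
    numTw_frame_two_two hF hF2]
  split_ifs <;> push_cast <;> ring

theorem numTw_two_two_two {F : Equiv.Perm X} {q : ℤ} (hF : IsFrob F q)
    (hF2 : IsFrob (F ^ 2) (q ^ 2)) {Φ : Prop} (hΦ : FanoIff X Φ) :
    numTw (X := X) F ![1, 0, 3, 2, 4, 6, 5] = pglCard q * (q ^ 6 - 2 * q ^ 5 - 11 * q ^ 4
      + 18 * q ^ 3 + 38 * q ^ 2 - 36 * q - 48) := by
  rw [numTw_add_conj hF hF2 ![1, 0, 3, 2, 4] ![0, 1, 2, 3, 4] (by decide)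
    ![1, 0, 3, 2, 4, 6, 5] (by decide) (by decide) (by decide)
    1 0 2 1 2 (by decide) (by decide) (by decide) (by decide) (by decide)
    5 10 0 15 0 (by decide) (by decide) (by decide) (by decide) (by decide),
    sum_numAligned_conj hF ![1, 0, 3, 2] ![1, 0, 3, 2, 4] (by decide) (by decide) (by decide) 1
      (by decide) _ fun A hA => alignedConj_two_two hF hF2 hΦ hA,
    numTw_five hF ![1, 0, 3, 2] ![1, 0, 3, 2, 4] (by decide) (by decide)
      (numTw_frame_two_two hF hF2)
      0 0 2 1 2 (by decide) (by decide) (by decide) (by decide) (by decide),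
    numTw_frame_two_two hF hF2]
  push_cast
  ring

theorem numTw_four {F : Equiv.Perm X} {q : ℤ}
    (hF : ∀ k, 1 ≤ k → k ≤ 7 → IsFrob (F ^ k) (q ^ k)) :
    numTw (X := X) F ![1, 2, 3, 0, 4, 5, 6] = pglCard q * (q ^ 6 + 2 * q ^ 5 - q ^ 4
      - 2 * q ^ 3) := by
  have h1 : IsFrob F q := by simpa using hF 1 le_rfl (by norm_num)
  rw [numTw_add_fix_fix h1 ![1, 2, 3, 0, 4] ![1, 2, 3, 0, 4, 5, 6] (by decide) (by decide)
    (by decide) 1 0 0 0 1 (by decide) (by decide) (by decide) (by decide) (by decide),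
    sum_numAligned_fix h1 ![1, 2, 3, 0] ![1, 2, 3, 0, 4] (by decide) (by decide) (by decide) 1
      (by decide) _ fun A hA => alignedTriples_four h1 hA,
    numTw_five h1 ![1, 2, 3, 0] ![1, 2, 3, 0, 4] (by decide) (by decide) (numTw_frame_four hF)
      0 0 0 0 1 (by decide) (by decide) (by decide) (by decide) (by decide), numTw_frame_four hF]
  push_cast
  ring

open Classical in
theorem numTw_four_two {F : Equiv.Perm X} {q : ℤ}
    (hF : ∀ k, 1 ≤ k → k ≤ 7 → IsFrob (F ^ k) (q ^ k)) {Φ : Prop} (hΦ : FanoIff X Φ) :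
    numTw (X := X) F ![1, 2, 3, 0, 4, 6, 5] = pglCard q * (q ^ 6 - 3 * q ^ 4
      + 2 - if Φ then 2 else 0) := by
  have h1 : IsFrob F q := by simpa using hF 1 le_rfl (by norm_num)
  have h2 := hF 2 (by norm_num) (by norm_num)
  rw [numTw_add_conj h1 h2 ![1, 2, 3, 0, 4] ![2, 3, 0, 1, 4] (by decide)
    ![1, 2, 3, 0, 4, 6, 5] (by decide) (by decide) (by decide)
    1 0 0 0 1 (by decide) (by decide) (by decide) (by decide) (by decide)
    1 0 2 1 2 (by decide) (by decide) (by decide) (by decide) (by decide),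
    sum_numAligned_conj h1 ![1, 2, 3, 0] ![1, 2, 3, 0, 4] (by decide) (by decide) (by decide) 1
      (by decide) _ fun A hA => alignedConj_four h1 h2 hΦ hA,
    numTw_five h1 ![1, 2, 3, 0] ![1, 2, 3, 0, 4] (by decide) (by decide) (numTw_frame_four hF)
      0 0 0 0 1 (by decide) (by decide) (by decide) (by decide) (by decide), numTw_frame_four hF]
  split_ifs <;> push_cast <;> ring

theorem numTw_five_fix {F : Equiv.Perm X} {q : ℤ}
    (hF : ∀ k, 1 ≤ k → k ≤ 7 → IsFrob (F ^ k) (q ^ k)) :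
    numTw (X := X) F ![1, 2, 3, 4, 0, 5, 6] = pglCard q * (q ^ 6 + 2 * q ^ 5 + 3 * q ^ 4
      + 3 * q ^ 3 + 2 * q ^ 2 + q) := by
  have h1 : IsFrob F q := by simpa using hF 1 le_rfl (by norm_num)
  rw [numTw_add_fix_fix h1 ![1, 2, 3, 4, 0] ![1, 2, 3, 4, 0, 5, 6] (by decide) (by decide)
    (by decide) 0 0 0 0 0 (by decide) (by decide) (by decide) (by decide) (by decide),
    Finset.sum_eq_zero fun i _ => numAligned_of_ne h1 _ (join_fix_of_fix h1) _
      ((show ∀ i, (![1, 2, 3, 4, 0] : Fin 5 → Fin 5) i ≠ i by decide) i), numTw_five_cycle hF]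
  push_cast
  ring

theorem numTw_five_two {F : Equiv.Perm X} {q : ℤ}
    (hF : ∀ k, 1 ≤ k → k ≤ 7 → IsFrob (F ^ k) (q ^ k)) :
    numTw (X := X) F ![1, 2, 3, 4, 0, 6, 5] = pglCard q * (q ^ 6 + q ^ 4 - q ^ 3 - q) := by
  have h1 : IsFrob F q := by simpa using hF 1 le_rfl (by norm_num)
  rw [numTw_add_conj h1 (hF 2 (by norm_num) (by norm_num)) ![1, 2, 3, 4, 0] ![2, 3, 4, 0, 1]
    (by decide) ![1, 2, 3, 4, 0, 6, 5] (by decide) (by decide) (by decide)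
    0 0 0 0 0 (by decide) (by decide) (by decide) (by decide) (by decide)
    0 0 0 0 0 (by decide) (by decide) (by decide) (by decide) (by decide),
    Finset.sum_eq_zero fun i _ => numAligned_of_ne h1 _ (join_fix_of_conj h1) _
      ((show ∀ i, (![1, 2, 3, 4, 0] : Fin 5 → Fin 5) i ≠ i by decide) i), numTw_five_cycle hF]
  push_cast
  ring

theorem numTw_three_fix {F : Equiv.Perm X} {q : ℤ}
    (hF : ∀ k, 1 ≤ k → k ≤ 7 → IsFrob (F ^ k) (q ^ k)) :
    numTw (X := X) F ![0, 1, 2, 3, 5, 6, 4] = pglCard q * (q ^ 6 - q ^ 5 - q ^ 4 + q ^ 3) := by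
  rw [numTw_frame_triple hF ![0, 1, 2, 3] (by decide) _ (by decide) (by decide) (by decide)
    (by decide), numTw_frame_id (by simpa using hF 1 le_rfl (by norm_num))]

theorem numTw_three_two {F : Equiv.Perm X} {q : ℤ}
    (hF : ∀ k, 1 ≤ k → k ≤ 7 → IsFrob (F ^ k) (q ^ k)) :
    numTw (X := X) F ![1, 0, 2, 3, 5, 6, 4] = pglCard q * (q ^ 6 - q ^ 5 - q ^ 4 + q ^ 3) := by
  rw [numTw_frame_triple hF ![1, 0, 2, 3] (by decide) _ (by decide) (by decide) (by decide)
    (by decide), numTw_frame_two (by simpa using hF 1 le_rfl (by norm_num))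
    (hF 2 (by norm_num) (by norm_num))]

theorem numTw_three_two_two {F : Equiv.Perm X} {q : ℤ}
    (hF : ∀ k, 1 ≤ k → k ≤ 7 → IsFrob (F ^ k) (q ^ k)) :
    numTw (X := X) F ![1, 0, 3, 2, 5, 6, 4] = pglCard q * (q ^ 6 - q ^ 5 - q ^ 4 + q ^ 3) := by
  rw [numTw_frame_triple hF ![1, 0, 3, 2] (by decide) _ (by decide) (by decide) (by decide)
    (by decide), numTw_frame_two_two (by simpa using hF 1 le_rfl (by norm_num))
    (hF 2 (by norm_num) (by norm_num))]

theorem numTw_four_three {F : Equiv.Perm X} {q : ℤ}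
    (hF : ∀ k, 1 ≤ k → k ≤ 7 → IsFrob (F ^ k) (q ^ k)) :
    numTw (X := X) F ![1, 2, 3, 0, 5, 6, 4] = pglCard q * (q ^ 6 - q ^ 5 - q ^ 4 + q ^ 3) := by
  rw [numTw_frame_triple hF ![1, 2, 3, 0] (by decide) _ (by decide) (by decide) (by decide)
    (by decide), numTw_frame_four hF]

/-! ### Six-cycles with a fixed point -/

/-- The condition for the orbit of `x` to be an arc of six points. -/
def Hex (F : Equiv.Perm X) (x : X) : Prop :=
  (F ^ 6) x = x ∧ (F ^ 3) x ≠ x ∧ ∀ m, (F ^ 2) m = m → ¬ Inc x m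

theorem Hex.map {F : Equiv.Perm X} {q : ℤ} (hF : IsFrob F q) {x : X} (h : Hex F x) :
    Hex F (F x) := by
  have hc : ∀ k, (F ^ k) (F x) = F ((F ^ k) x) := fun k => by
    rw [← Equiv.Perm.mul_apply, ← pow_succ, pow_succ', Equiv.Perm.mul_apply]
  refine ⟨by rw [hc, h.1], by rw [hc]; exact F.injective.ne h.2.1, fun m hm hx => ?_⟩
  refine h.2.2 (F m) (by rw [← Equiv.Perm.mul_apply, ← pow_succ, pow_succ', Equiv.Perm.mul_apply, hm])
    ?_
  rw [← hF.inc_iff]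
  have : F (F m) = m := hm
  rwa [this]

theorem Hex.not_fix {F : Equiv.Perm X} {x m : X} (h : Hex F x) (hm : F m = m) : ¬ Inc x m :=
  h.2.2 m (pow_fix hm 2)

theorem Hex.ne {F : Equiv.Perm X} {x : X} (h : Hex F x) : F x ≠ x :=
  fun h' => h.2.1 (pow_fix h' 3)

theorem Hex.sq_ne {F : Equiv.Perm X} {q : ℤ} (hF : IsFrob F q) {x : X} (h : Hex F x) :
    F (F x) ≠ x := fun h' =>
  h.not_fix (m := join x (F x)) (by rw [map_join hF, h', join_comm]) (inc_join_left h.ne.symm)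

theorem Hex.sq_ne' {F : Equiv.Perm X} {q : ℤ} (hF : IsFrob F q) {x : X} (h : Hex F x) :
    (F ^ 2) x ≠ x := h.sq_ne hF

theorem Hex.cube_line {F : Equiv.Perm X} {q : ℤ} (hF : IsFrob F q) {x l : X} (h : Hex F x)
    (h0 : Inc x l) (h3 : Inc (F (F (F x))) l) : F (F (F l)) = l := by
  have h6 : F (F (F (F (F (F x))))) = x := h.1
  refine line_unique (a := F (F (F x))) (b := x) h.2.1 ?_ ?_ h3 h0
  · rwa [hF.inc_iff, hF.inc_iff, hF.inc_iff]
  · conv_lhs => rw [← h6]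
    rwa [hF.inc_iff, hF.inc_iff, hF.inc_iff]

/-- Representatives of the triples of points of the orbit under rotation and reflection. -/
theorem Hex.not_coll {F : Equiv.Perm X} {q : ℤ} (hF : IsFrob F q) (hF2 : IsFrob (F ^ 2) (q ^ 2))
    {x : X} (h : Hex F x) :
    ¬ Coll x (F x) (F (F x)) ∧ ¬ Coll x (F x) (F (F (F x))) ∧ ¬ Coll x (F x) (F (F (F (F x)))) ∧
      ¬ Coll x (F (F x)) (F (F (F (F x)))) := by
  have h6 : F (F (F (F (F (F x))))) = x := h.1
  have key : ¬ Coll x (F x) (F (F (F x))) := by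
    rintro ⟨l, h0, h1, h3⟩
    have hl := h.cube_line hF h0 h3
    have h4 : Inc (F (F (F (F x)))) l := by
      rw [← hl, hF.inc_iff, hF.inc_iff, hF.inc_iff]
      exact h1
    refine h.not_fix (m := l) (line_unique (F.injective.ne h.2.1) ?_ ?_ h4 h1) h0
    · rw [hF.inc_iff]
      exact h3
    · rw [hF.inc_iff]
      exact h0
  refine ⟨?_, key, ?_, ?_⟩
  · rintro ⟨l, h0, h1, h2⟩
    exact h.not_fix (hF.fix_of_inc h.ne h0 h1 h2) h0
  · rintro ⟨l, h0, h1, h4⟩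
    have hl := (h.map hF).cube_line hF h1 h4
    refine key ⟨l, h0, h1, ?_⟩
    rw [← hl, hF.inc_iff, hF.inc_iff, hF.inc_iff]
    exact h0
  · rintro ⟨l, h0, h1, h2⟩
    exact h.2.2 _ (hF2.fix_of_inc (h.sq_ne' hF) h0 h1 h2) h0

theorem cycle_induction {F : Equiv.Perm X} {n : ℕ} [NeZero n] {P : Fin n → X}
    (h : ∀ i, F (P i) = P (i + 1)) {p : X → Prop} (hp : ∀ x, p x → p (F x)) (h0 : p (P 0))
    (i : Fin n) : p (P i) := by
  obtain ⟨k, rfl⟩ : ∃ k, n = k + 1 := ⟨n - 1, by have := NeZero.pos n; omega⟩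
  induction i using Fin.induction with
  | zero => exact h0
  | succ i ih =>
    rw [← Fin.coeSucc_eq_succ, ← h]
    exact hp _ ih

theorem fin_six_triple : ∀ i j k : Fin 6, i < j → j < k →
    ∃ m, ({i, j, k} : Finset (Fin 6)) = {m, m + 1, m + 1 + 1} ∨
      ({i, j, k} : Finset (Fin 6)) = {m, m + 1, m + 1 + 1 + 1} ∨
      ({i, j, k} : Finset (Fin 6)) = {m, m + 1, m + 1 + 1 + 1 + 1} ∨
      ({i, j, k} : Finset (Fin 6)) = {m, m + 1 + 1, m + 1 + 1 + 1 + 1} := by decide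

theorem fin_six_pair : ∀ i j : Fin 6, i < j → ∃ m, (i = m ∧ j = m + 1) ∨ (j = m ∧ i = m + 1) ∨
    (i = m ∧ j = m + 1 + 1) ∨ (j = m ∧ i = m + 1 + 1) ∨ (i = m ∧ j = m + 1 + 1 + 1) := by decide

/-- An orbit of length `6` is an arc exactly if its first point satisfies `Hex`. -/
theorem tw_six {F : Equiv.Perm X} {q : ℤ} (hF : IsFrob F q) (hF2 : IsFrob (F ^ 2) (q ^ 2))
    (P : Fin 6 → X) :
    Tw F ![1, 2, 3, 4, 5, 0] P ↔ (∀ i, F (P i) = P (i + 1)) ∧ Hex F (P 0) := by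
  have hs : ∀ i : Fin 6, (![1, 2, 3, 4, 5, 0] : Fin 6 → Fin 6) i = i + 1 := by decide
  unfold Tw
  simp only [hs]
  refine and_congr_right fun h => ⟨fun hP => ?_, fun hx i j k hij hjk => ?_⟩
  · have e1 : F (P 0) = P 1 := h 0
    have e2 : F (P 1) = P 2 := h 1
    have e3 : F (P 2) = P 3 := h 2
    have e4 : F (P 3) = P 4 := h 3
    refine ⟨cycle_period h, ?_, fun m hm h0 => ?_⟩
    · show F (F (F (P 0))) ≠ P 0
      rw [e1, e2, e3]
      exact (not_coll_ne (hP 0 1 3 (by decide) (by decide))).2.1.symm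
    · have h2 : Inc (P 2) m := by
        rw [← e2, ← e1, ← hm]
        exact (hF2.inc_iff _ _).2 h0
      have h4 : Inc (P 4) m := by
        rw [← e4, ← e3, ← hm]
        exact (hF2.inc_iff _ _).2 h2
      exact hP 0 2 4 (by decide) (by decide) ⟨m, h0, h2, h4⟩
  · rw [coll_iff_onLine]
    obtain ⟨m, hm⟩ := fin_six_triple i j k hij hjk
    have := (cycle_induction h (p := Hex F) (fun x => Hex.map hF) hx m).not_coll hF hF2
    simp only [h, coll_iff_onLine] at this
    rcases hm with hm | hm | hm | hm <;> rw [hm]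
    · exact this.1
    · exact this.2.1
    · exact this.2.2.1
    · exact this.2.2.2

/-- A fixed point extends a six-cycle in general position unless it lies on the line of two
opposite points. -/
theorem offC_six {F : Equiv.Perm X} {q : ℤ} (hF : IsFrob F q) (hF2 : IsFrob (F ^ 2) (q ^ 2))
    {P : Fin 6 → X} (h : ∀ i, F (P i) = P (i + 1)) (hx : Hex F (P 0)) {Q : X} (hQ : F Q = Q) :
    OffC P Q ↔ ¬ Coll (P 0) (F (F (F (P 0)))) Q := by
  have hh := cycle_induction h (p := Hex F) (fun x => Hex.map hF) hx
  have hne : ∀ i, Q ≠ P i := fun i hi => (hh i).ne (by rw [← hi, hQ])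
  constructor
  · intro hP
    have e1 : F (P 0) = P 1 := h 0
    have e2 : F (P 1) = P 2 := h 1
    have e3 : F (P 2) = P 3 := h 2
    rw [e1, e2, e3]
    exact hP 0 3 (by decide)
  · intro h0
    have h3 : ∀ i, ¬ Coll (P i) (F (F (F (P i)))) Q := cycle_induction h
      (p := fun x => ¬ Coll x (F (F (F x))) Q) (fun x hx => by
        rw [← map_coll hF, hQ] at hx
        exact hx) h0
    have h1 : ∀ i, ¬ Coll (P i) (F (P i)) Q := by
      rintro i ⟨l, a, b, c⟩
      refine (hh i).not_fix (m := l) (line_unique (a := Q) (b := F (P i)) ?_ ?_ ?_ c b) a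
      · rw [h]
        exact hne _
      · rwa [← hQ, hF.inc_iff]
      · rwa [hF.inc_iff]
    have h2 : ∀ i, ¬ Coll (P i) (F (F (P i))) Q := by
      rintro i ⟨l, a, b, c⟩
      refine (hh i).2.2 l (line_unique (a := Q) (b := (F ^ 2) (P i)) ?_ ?_ ?_ c b) a
      · show Q ≠ F (F (P i))
        rw [h, h]
        exact hne _
      · rw [← pow_fix hQ 2, hF2.inc_iff]
        exact c
      · rwa [hF2.inc_iff]
    intro i j hij
    simp only [h] at h1 h2 h3
    obtain ⟨m, ⟨rfl, rfl⟩ | ⟨rfl, rfl⟩ | ⟨rfl, rfl⟩ | ⟨rfl, rfl⟩ | ⟨rfl, rfl⟩⟩ :=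
      fin_six_pair i j hij
    · exact h1 _
    · exact fun h => h1 _ h.swap₁₂
    · exact h2 _
    · exact fun h => h2 _ h.swap₁₂
    · exact h3 _

/-- These are the points on no line fixed by `F ^ 2` among those fixed by `F ^ 6`, without the ones
fixed by `F ^ 3`, which are just the points of period `3` on no fixed line. -/
theorem cnt_hex {F : Equiv.Perm X} {q : ℤ}
    (hF : ∀ k, 1 ≤ k → k ≤ 7 → IsFrob (F ^ k) (q ^ k)) :
    cnt (Hex F) = q ^ 12 - q ^ 10 - q ^ 8 + q ^ 5 + q ^ 4 - q ^ 3 := by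
  have h1 : IsFrob F q := by simpa using hF 1 le_rfl (by norm_num)
  have h2 := hF 2 (by norm_num) (by norm_num)
  have a := cnt_gen h2 (hF 6 (by norm_num) (by norm_num)) fun x hx => by
    rw [show 6 = 2 * 3 by norm_num, pow_mul]
    exact pow_fix hx 3
  have b := cnt_gen h1 (hF 3 (by norm_num) (by norm_num)) fun x hx => pow_fix hx 3
  rw [cnt_split _ (fun x => (F ^ 3) x = x)] at a
  have e1 : cnt (fun x => Gen (F ^ 2) (F ^ 6) x ∧ (F ^ 3) x = x) = cnt (Gen F (F ^ 3)) := by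
    refine cnt_congr fun x => ⟨fun h => ⟨h.2, fun l hl => h.1.2 l (pow_fix hl 2)⟩, fun h => ?_⟩
    refine ⟨⟨?_, fun l hl hx => ?_⟩, h.1⟩
    · rw [show 6 = 3 * 2 by norm_num, pow_mul]
      exact pow_fix h.1 2
    · have hl' : F (F l) = l := hl
      have hx3 : F (F (F x)) = x := h.1
      have hx' : Inc x (F l) := by
        rw [← hx3]
        conv_rhs => rw [← hl']
        rwa [h1.inc_iff, h1.inc_iff, h1.inc_iff]
      by_cases hll : F l = l
      · exact h.2 l hll hx
      · refine gen_ne h1 h ?_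
        rw [eq_join' (Ne.symm hll) hx hx', map_join h1, hl', join_comm]
  have e2 : cnt (fun x => Gen (F ^ 2) (F ^ 6) x ∧ ¬ (F ^ 3) x = x) = cnt (Hex F) :=
    cnt_congr fun x => by unfold Gen Hex; tauto
  rw [e1, e2, b] at a
  linear_combination a

/-- The points of a conjugate line `e` through a fixed point `Q` whose orbits are arcs. -/
theorem cnt_hex_line {F : Equiv.Perm X} {q : ℤ}
    (hF : ∀ k, 1 ≤ k → k ≤ 7 → IsFrob (F ^ k) (q ^ k)) {Q e : X} (hQ : F Q = Q)
    (he : ((F ^ 3) e = e ∧ F e ≠ e) ∧ Inc e Q) :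
    cnt (fun x => Hex F x ∧ Inc x e) = q ^ 6 - q ^ 3 - (q ^ 4 - q ^ 2) := by
  obtain ⟨⟨he3, he1⟩, heQ⟩ := he
  have h1 : IsFrob F q := by simpa using hF 1 le_rfl (by norm_num)
  have h2 := hF 2 (by norm_num) (by norm_num)
  have h3 := hF 3 (by norm_num) (by norm_num)
  have h6 := hF 6 (by norm_num) (by norm_num)
  have he6 : (F ^ 6) e = e := by
    rw [show 6 = 3 * 2 by norm_num, pow_mul]
    exact pow_fix he3 2
  have he2 : (F ^ 2) e ≠ e := fun h => he1 (fix_of_pow (by norm_num) h he3)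
  have a := h3.cnt_line_conj h6 (fun x hx => by
    rw [show 6 = 3 * 2 by norm_num, pow_mul]
    exact pow_fix hx 2) he3
  rw [cnt_split _ (fun x => ∃ m, (F ^ 2) m = m ∧ Inc x m)] at a
  have b : cnt (fun m => ((F ^ 2) m = m ∧ F m ≠ m) ∧ ¬ Inc m Q) = q ^ 4 - q ^ 2 := by
    have c1 := h1.cnt_conj h2 (fun x hx => pow_fix hx 2)
    have c2 := h1.cnt_line_conj h2 (fun x hx => pow_fix hx 2) hQ
    rw [cnt_split _ (fun x => Inc x Q)] at c1
    linear_combination c1 - c2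
  -- the points of `e` on a line fixed by `F ^ 2` correspond to these lines by intersection;
  -- those through `Q` meet `e` in the fixed point `Q`
  have c : cnt (fun m => ((F ^ 2) m = m ∧ F m ≠ m) ∧ ¬ Inc m Q) =
      cnt (fun x => (((F ^ 6) x = x ∧ (F ^ 3) x ≠ x) ∧ Inc x e) ∧
        ∃ m, (F ^ 2) m = m ∧ Inc x m) := by
    refine (cnt_fiber (fun m => join m e) 1 ?_ ?_).trans (mul_one _)
    · rintro m ⟨⟨hm2, hm1⟩, hmQ⟩
      have hne : m ≠ e := fun h => hmQ (h ▸ heQ)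
      have hm6 : (F ^ 6) m = m := by
        rw [show 6 = 2 * 3 by norm_num, pow_mul]
        exact pow_fix hm2 3
      have hm3 : (F ^ 3) m = F m := congrArg F hm2
      refine ⟨⟨⟨by rw [map_join h6, hm6, he6], fun h => ?_⟩, join_inc_right hne⟩,
        m, hm2, join_inc_left hne⟩
      rw [map_join h3, hm3, he3] at h
      have hne' : F m ≠ e := fun h => he2 (by rw [← h]; exact congrArg F hm2)
      have i1 := join_inc_left hne
      have i2 := join_inc_right hne
      have i3 : Inc (join m e) (F m) := h ▸ join_inc_left hne'
      have hfix : F (join m e) = join m e := by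
        rw [eq_join' (Ne.symm hm1) i1 i3, map_join h1, show F (F m) = m from hm2, join_comm]
      by_cases hq : join m e = Q
      · exact hmQ (PolarPlane.symm (hq ▸ i1))
      · refine he1 ?_
        rw [eq_join hq i2 (PolarPlane.symm heQ), map_join h1, hfix, hQ]
    · rintro x ⟨⟨⟨hx6, hx3⟩, hxe⟩, m, hm, hxm⟩
      have hx1 : F x ≠ x := fun h => hx3 (pow_fix h 3)
      have hx2 : (F ^ 2) x ≠ x := by
        intro h
        have hx3' : (F ^ 3) x = F x := congrArg F h
        have hi : Inc (F x) e := by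
          rw [← hx3', ← he3]
          exact (h3.inc_iff _ _).2 hxe
        refine he1 ?_
        rw [eq_join hx1 hi hxe, map_join h1, show F (F x) = x from h, join_comm]
      have hne : ∀ m, (F ^ 2) m = m → m ≠ e := fun m hm h => he2 (h ▸ hm)
      refine cnt_eq_one m fun m' => ?_
      constructor
      · rintro ⟨⟨⟨hm', _⟩, _⟩, rfl⟩
        exact h2.fix_line_unique hx2 hm' hm (join_inc_left (hne _ hm')) hxm
      · rintro rfl
        have hx : join m' e = x := (eq_join' (hne _ hm) hxm hxe).symm
        have hmQ : ¬ Inc m' Q := by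
          intro h
          have hxQ : x = Q := by
            rw [← hx]
            exact (eq_join (hne _ hm) h heQ).symm
          exact hx1 (by rw [hxQ, hQ])
        refine ⟨⟨⟨hm, fun h => hx3 ?_⟩, hmQ⟩, hx⟩
        have hh : (F ^ 3) m' = m' := pow_fix h 3
        rw [← hx, map_join h3, hh, he3]
  have d : cnt (fun x => Hex F x ∧ Inc x e) = cnt (fun x => (((F ^ 6) x = x ∧ (F ^ 3) x ≠ x) ∧
      Inc x e) ∧ ¬ ∃ m, (F ^ 2) m = m ∧ Inc x m) :=
    cnt_congr fun x => by
      unfold Hex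
      push Not
      tauto
  rw [← c, ← d, b] at a
  linear_combination a

/-- The line through opposite points of the orbit is one of the `q ^ 3 - q` lines through `Q` fixed
by `F ^ 3` but not by `F`. -/
theorem cnt_hex_off {F : Equiv.Perm X} {q : ℤ}
    (hF : ∀ k, 1 ≤ k → k ≤ 7 → IsFrob (F ^ k) (q ^ k)) {Q : X} (hQ : F Q = Q) :
    cnt (fun x => Hex F x ∧ ¬ Coll x (F (F (F x))) Q) =
      q ^ 12 - q ^ 10 - q ^ 8 + q ^ 5 + q ^ 4 - q ^ 3
        - (q ^ 3 - q) * (q ^ 6 - q ^ 3 - (q ^ 4 - q ^ 2)) := by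
  have h1 : IsFrob F q := by simpa using hF 1 le_rfl (by norm_num)
  have h3 := hF 3 (by norm_num) (by norm_num)
  have a := cnt_hex hF
  rw [cnt_split _ (fun x => Coll x (F (F (F x))) Q)] at a
  have b : cnt (fun x => Hex F x ∧ Coll x (F (F (F x))) Q) =
      (q ^ 3 - q) * (q ^ 6 - q ^ 3 - (q ^ 4 - q ^ 2)) := by
    rw [← h1.cnt_line_conj h3 (fun x hx => pow_fix hx 3) hQ]
    refine cnt_fiber (fun x => join x (F (F (F x)))) _ ?_ ?_
    · rintro x ⟨hx, hc⟩
      have hne : x ≠ F (F (F x)) := Ne.symm hx.2.1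
      refine ⟨⟨hx.cube_line h1 (inc_join_left hne) (inc_join_right hne), fun h => ?_⟩,
        PolarPlane.symm ((coll_iff hne).1 hc)⟩
      exact hx.not_fix h (inc_join_left hne)
    · intro e he
      rw [← cnt_hex_line hF hQ he]
      refine cnt_congr fun x => ⟨?_, ?_⟩
      · rintro ⟨⟨hx, _⟩, rfl⟩
        exact ⟨hx, inc_join_left (Ne.symm hx.2.1)⟩
      · rintro ⟨hx, hxe⟩
        have hi : Inc (F (F (F x))) e := by
          have := (h3.inc_iff x e).2 hxe
          rwa [he.1.1] at this
        exact ⟨⟨hx, e, hxe, hi, PolarPlane.symm he.2⟩, (eq_join (Ne.symm hx.2.1) hxe hi).symm⟩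
  linear_combination a - b

theorem numTw_six_fix {F : Equiv.Perm X} {q : ℤ}
    (hF : ∀ k, 1 ≤ k → k ≤ 7 → IsFrob (F ^ k) (q ^ k)) :
    numTw (X := X) F ![1, 2, 3, 4, 5, 0, 6] =
      pglCard q * (q ^ 6 + q ^ 5 + q ^ 4 - q ^ 2) := by
  have h1 : IsFrob F q := by simpa using hF 1 le_rfl (by norm_num)
  have h2 := hF 2 (by norm_num) (by norm_num)
  rw [numTw, cnt_snoc, cnt_bij (r := fun w : X × (Fin 6 → X) => F w.1 = w.1 ∧
    (Tw F ![1, 2, 3, 4, 5, 0] w.2 ∧ OffC w.2 w.1)) Prod.swap Prod.swap ?_ ?_ (fun _ _ => rfl)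
      fun _ _ => rfl]
  · rw [cnt_sigma (fun Q => F Q = Q) (fun Q P => Tw F ![1, 2, 3, 4, 5, 0] P ∧ OffC P Q)
      (q ^ 12 - q ^ 10 - q ^ 8 + q ^ 5 + q ^ 4 - q ^ 3
        - (q ^ 3 - q) * (q ^ 6 - q ^ 3 - (q ^ 4 - q ^ 2))) fun Q hQ => ?_, h1.card_fix, pglCard]
    · ring
    · rw [← cnt_hex_off hF hQ]
      have := cnt_cycle (F := F) (n := 6) fun x => Hex F x ∧ ¬ Coll x (F (F (F x))) Q
      rw [cnt_congr (p := fun x => (F ^ 6) x = x ∧ Hex F x ∧ ¬ Coll x (F (F (F x))) Q)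
        (r := fun x => Hex F x ∧ ¬ Coll x (F (F (F x))) Q)
        fun x => ⟨fun h => h.2, fun h => ⟨h.1.1, h⟩⟩] at this
      rw [← this]
      refine cnt_congr fun P => ?_
      rw [tw_six h1 h2]
      constructor
      · rintro ⟨⟨h, hx⟩, ho⟩
        exact ⟨h, hx, (offC_six h1 h2 h hx hQ).1 ho⟩
      · rintro ⟨h, hx, ho⟩
        exact ⟨⟨h, hx⟩, (offC_six h1 h2 h hx hQ).2 ho⟩
  · rintro ⟨P, Q⟩ h
    have := (tw_snoc ![1, 2, 3, 4, 5, 0] ![1, 2, 3, 4, 5, 0, 6] (by decide) (by decide) P Q).1 h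
    exact ⟨this.2.1, this.1, this.2.2⟩
  · rintro ⟨Q, P⟩ ⟨h, h', h''⟩
    exact (tw_snoc ![1, 2, 3, 4, 5, 0] ![1, 2, 3, 4, 5, 0, 6] (by decide) (by decide) P Q).2
      ⟨h', h, h''⟩

/-! ### Seven-cycles -/

theorem Gen.line_ne {F : Equiv.Perm X} {q : ℤ} (hF : IsFrob F q) {n : ℕ} {x : X}
    (h : Gen F (F ^ n) x) : F (join x (F x)) ≠ join x (F x) := fun h' =>
  h.2 _ h' (inc_join_left (gen_ne hF h).symm)

/-- A point on no fixed line and the line through it and its image correspond to each other under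
duality. -/
theorem Gen.dual {F : Equiv.Perm X} {q q' : ℤ} (hF : IsFrob F q) {n : ℕ}
    (hFn : IsFrob (F ^ n) q') {x : X} (h : Gen F (F ^ n) x) : Gen F (F ^ n) (join x (F x)) := by
  have hx := gen_ne hF h
  refine ⟨?_, fun l hl hi => ?_⟩
  · rw [map_join hFn, h.1, (h.map hF).1]
  · have hy := h.line_ne hF
    have h1 : Inc (F (join x (F x))) l := by
      rw [← hl, hF.inc_iff]
      exact hi
    have h2 : Inc (F x) (F (join x (F x))) := by
      rw [hF.inc_iff]
      exact inc_join_left hx.symm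
    have e : F x = l := (PolarPlane.eq_or_eq (inc_join_right hx.symm) (PolarPlane.symm hi) h2
      (PolarPlane.symm h1)).resolve_right hy.symm
    exact gen_ne hF (h.map hF) (by rw [e, hl])

/-- Dualizing twice is applying `F`, so that duality is a bijection of the points of `Gen`. -/
theorem Gen.dual_dual {F : Equiv.Perm X} {q : ℤ} (hF : IsFrob F q) {n : ℕ} {x : X}
    (h : Gen F (F ^ n) x) : join (join x (F x)) (F (join x (F x))) = F x := by
  have hx := gen_ne hF h
  have hy := h.line_ne hF
  refine (eq_join' hy.symm (inc_join_right hx.symm) ?_).symm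
  rw [hF.inc_iff]
  exact inc_join_left hx.symm

theorem Gen.symm {F : Equiv.Perm X} {q : ℤ} (hF : IsFrob F q) {n : ℕ} {x : X}
    (h : Gen F (F ^ n) x) : Gen F (F ^ n) (F.symm x) := by
  refine ⟨?_, fun l hl hi => h.2 l hl ?_⟩
  · apply F.injective
    rw [← Equiv.Perm.mul_apply, ← pow_succ', pow_succ, Equiv.Perm.mul_apply, F.apply_symm_apply,
      h.1]
  · rw [← hF.inc_iff, hl, F.apply_symm_apply] at hi
    exact hi

/-- Duality is a bijection of the points on no fixed line. -/
theorem cnt_dual {F : Equiv.Perm X} {q q' : ℤ} (hF : IsFrob F q) {n : ℕ}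
    (hFn : IsFrob (F ^ n) q') (p : X → Prop) :
    cnt (fun x => Gen F (F ^ n) x ∧ p (join x (F x))) = cnt (fun y => Gen F (F ^ n) y ∧ p y) := by
  have hinv : ∀ y, Gen F (F ^ n) y → join (join (F.symm y) y) (F (join (F.symm y) y)) = y := by
    intro y h
    have := (h.symm hF).dual_dual hF
    rwa [F.apply_symm_apply] at this
  refine cnt_bij (fun x => join x (F x)) (fun y => join (F.symm y) y) ?_ ?_ ?_ ?_
  · exact fun x h => ⟨h.1.dual hF hFn, h.2⟩
  · intro y h
    have h' := (h.1.symm hF).dual hF hFn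
    rw [F.apply_symm_apply] at h'
    exact ⟨h', by rw [hinv y h.1]; exact h.2⟩
  · rintro x ⟨h, _⟩
    have := (h.symm hF).dual_dual hF
    rw [map_join hF, F.apply_symm_apply] at this
    show join (F.symm (join x (F x))) (join x (F x)) = x
    conv_rhs => rw [← this]
    congr 1
    apply F.injective
    rw [F.apply_symm_apply, map_join hF, F.apply_symm_apply]
  · exact fun y h => hinv y h.1

/-- The cyclic orders of the Fano plane with lines `{m, m + 1, m + 3}` and `{m, m + 2, m + 3}` are
exchanged by duality. -/
theorem cnt_fano_dual {F : Equiv.Perm X} {q q' : ℤ} (hF : IsFrob F q) {n : ℕ}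
    (hFn : IsFrob (F ^ n) q') :
    cnt (fun x => Gen F (F ^ n) x ∧ Coll x (F (F x)) (F (F (F x)))) =
      cnt (fun x => Gen F (F ^ n) x ∧ Coll x (F x) (F (F (F x)))) := by
  rw [← cnt_dual hF hFn fun x => Coll x (F (F x)) (F (F (F x)))]
  refine cnt_congr fun x => and_congr_right fun h => ?_
  have hx := gen_ne hF h
  rw [coll_iff hx.symm]
  constructor
  · rintro ⟨p, h0, h2', h3⟩
    have e : F (F (F x)) = p := by
      rw [← h.dual_dual hF, map_join hF, map_join hF]
      exact (eq_join (F.injective.ne (F.injective.ne (h.line_ne hF).symm)) h2' h3).symm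
    rw [e]
    exact PolarPlane.symm h0
  · intro hc
    refine ⟨F (F (F x)), PolarPlane.symm hc, ?_, ?_⟩
    · rw [hF.inc_iff, hF.inc_iff]
      exact join_inc_right hx.symm
    · rw [hF.inc_iff, hF.inc_iff, hF.inc_iff]
      exact join_inc_left hx.symm

/-- Up to rotation the triples in a heptagon are the three progressions and two further ones, the
lines of the two cyclic Fano planes. -/
theorem fin_seven_triple : ∀ i j k : Fin 7, i < j → j < k →
    ∃ m, ({i, j, k} : Finset (Fin 7)) = {m, m + 1, m + 1 + 1} ∨
      ({i, j, k} : Finset (Fin 7)) = {m, m + 1 + 1, m + 1 + 1 + 1 + 1} ∨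
      ({i, j, k} : Finset (Fin 7)) = {m, m + 1 + 1 + 1, m + 1 + 1 + 1 + 1 + 1 + 1} ∨
      ({i, j, k} : Finset (Fin 7)) = {m, m + 1, m + 1 + 1 + 1} ∨
      ({i, j, k} : Finset (Fin 7)) = {m, m + 1 + 1, m + 1 + 1 + 1} := by decide

/-- The steps `1`, `2`, `3` are Frobenius maps of their own, whose orbits have no three consecutive
points on a line. -/
theorem seven_progressions {F : Equiv.Perm X} {q : ℤ}
    (hF : ∀ k, 1 ≤ k → k ≤ 7 → IsFrob (F ^ k) (q ^ k)) {x : X} (h : Gen F (F ^ 7) x) :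
    ¬ Coll x (F x) (F (F x)) ∧ ¬ Coll x (F (F x)) (F (F (F (F x)))) ∧
      ¬ Coll x (F (F (F x))) (F (F (F (F (F (F x)))))) := by
  have h1 : IsFrob F q := by simpa using hF 1 le_rfl (by norm_num)
  have h7 := hF 7 (by norm_num) (by norm_num)
  exact ⟨by simpa using not_coll_progression h1 h7 (a := 1) (by simpa using h1) h (by norm_num),
    not_coll_progression h1 h7 (hF 2 (by norm_num) (by norm_num)) h (by norm_num),
    not_coll_progression h1 h7 (hF 3 (by norm_num) (by norm_num)) h (by norm_num)⟩

/-- Of the triples of an orbit only those that could be lines of a cyclic Fano plane need attention.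
-/
theorem tw_seven {F : Equiv.Perm X} {q : ℤ}
    (hF : ∀ k, 1 ≤ k → k ≤ 7 → IsFrob (F ^ k) (q ^ k)) (P : Fin 7 → X) :
    Tw F ![1, 2, 3, 4, 5, 6, 0] P ↔ (∀ i, F (P i) = P (i + 1)) ∧ (Gen F (F ^ 7) (P 0) ∧
      ¬ Coll (P 0) (F (P 0)) (F (F (F (P 0)))) ∧
      ¬ Coll (P 0) (F (F (P 0))) (F (F (F (P 0))))) := by
  have h1 : IsFrob F q := by simpa using hF 1 le_rfl (by norm_num)
  have hs : ∀ i : Fin 7, (![1, 2, 3, 4, 5, 6, 0] : Fin 7 → Fin 7) i = i + 1 := by decide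
  unfold Tw
  simp only [hs]
  refine and_congr_right fun h => ⟨fun hP => ⟨?_, ?_, ?_⟩, fun hx i j k hij hjk => ?_⟩
  · exact cycle_gen_of_not_coll h1 h (hP 0 1 2 (by decide) (by decide))
  · rw [h, h, h]
    exact hP 0 1 3 (by decide) (by decide)
  · rw [h, h, h]
    exact hP 0 2 3 (by decide) (by decide)
  · obtain ⟨hg, ha, hb⟩ := hx
    obtain ⟨p1, p2, p3⟩ := seven_progressions hF (cycle_gen h1 h hg 0)
    have hm := cycle_gen h1 h hg
    have hA := cycle_induction h (p := fun x => ¬ Coll x (F x) (F (F (F x))))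
      (fun x hx => by rwa [map_coll h1]) ha
    have hB := cycle_induction h (p := fun x => ¬ Coll x (F (F x)) (F (F (F x))))
      (fun x hx => by rwa [map_coll h1]) hb
    have hp := fun i => seven_progressions hF (hm i)
    simp only [h, coll_iff_onLine] at hA hB hp
    rw [coll_iff_onLine]
    obtain ⟨m, hm | hm | hm | hm | hm⟩ := fin_seven_triple i j k hij hjk <;> rw [hm]
    · exact (hp m).1
    · exact (hp m).2.1
    · exact (hp m).2.2
    · exact hA m
    · exact hB m

/-- If three points of a cycle of length `7` at the positions of a line of the Fano plane are
collinear, the cycle is a Fano plane. -/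
theorem fano_of_seven {F : Equiv.Perm X} {q : ℤ}
    (hF : ∀ k, 1 ≤ k → k ≤ 7 → IsFrob (F ^ k) (q ^ k)) {Φ : Prop} (hΦ : FanoIff X Φ) {x : X}
    (h : Gen F (F ^ 7) x) (hc : Coll x (F x) (F (F (F x)))) : Φ := by
  have h1 : IsFrob F q := by simpa using hF 1 le_rfl (by norm_num)
  -- the orbit as a family, with the collinear triples `{m, m + 1, m + 3}`
  let P : Fin 7 → X := fun i => (F ^ (i : ℕ)) x
  have hP : ∀ i, F (P i) = P (i + 1) := by
    intro i
    have h7 : F (F (F (F (F (F (F x)))))) = x := h.1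
    fin_cases i <;> first | rfl | exact h7
  have hg := cycle_gen h1 hP (show Gen F (F ^ 7) (P 0) from h)
  have hA : ∀ i, Coll (P i) (P (i + 1)) (P (i + 1 + 1 + 1)) := by
    have := cycle_induction hP (p := fun x => Coll x (F x) (F (F (F x))))
      (fun x hx => by rwa [map_coll h1]) hc
    simpa only [hP] using this
  have hp : ∀ i, ¬ Coll (P i) (P (i + 1)) (P (i + 1 + 1)) ∧
      ¬ Coll (P i) (P (i + 1 + 1)) (P (i + 1 + 1 + 1 + 1)) ∧
      ¬ Coll (P i) (P (i + 1 + 1 + 1)) (P (i + 1 + 1 + 1 + 1 + 1 + 1)) := by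
    intro i
    have := seven_progressions hF (hg i)
    simpa only [hP] using this
  have hB : ∀ i, ¬ Coll (P i) (P (i + 1 + 1)) (P (i + 1 + 1 + 1)) := by
    intro i hB
    have hne : P i ≠ P (i + 1 + 1 + 1) := (not_coll_ne (hp i).2.2).1
    have hA' := (coll_iff hne).1 (hA i).swap₂₃
    have hB' := (coll_iff hne).1 hB.swap₂₃
    exact (hp i).1 ⟨_, inc_join_left hne, hA', hB'⟩
  have hne : ∀ i j : Fin 7, i ≠ j → P i ≠ P j := by
    have : ∀ i, P i ≠ P (i + 1) ∧ P i ≠ P (i + 1 + 1) ∧ P i ≠ P (i + 1 + 1 + 1) := fun i =>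
      ⟨(not_coll_ne (hp i).1).1, (not_coll_ne (hp i).1).2.1, (not_coll_ne (hp i).2.2).1⟩
    intro i j hij
    rcases (show ∀ i j : Fin 7, i ≠ j → j = i + 1 ∨ j = i + 1 + 1 ∨ j = i + 1 + 1 + 1 ∨
      i = j + 1 ∨ i = j + 1 + 1 ∨ i = j + 1 + 1 + 1 by decide) i j hij with
      rfl | rfl | rfl | rfl | rfl | rfl
    · exact (this _).1
    · exact (this _).2.1
    · exact (this _).2.2
    · exact (this _).1.symm
    · exact (this _).2.1.symm
    · exact (this _).2.2.symm
  -- the frame with labels `2`, `4`, `5`, `6` has the diagonal points with labels `1`, `3`, `0`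
  have hfr : ∀ i j k, i < j → j < k → ¬ Coll ((![P 2, P 4, P 5, P 6] : Fin 4 → X) i)
      ((![P 2, P 4, P 5, P 6] : Fin 4 → X) j) ((![P 2, P 4, P 5, P 6] : Fin 4 → X) k) := by
    have e1 : ¬ Coll (P 2) (P 4) (P 5) := hB 2
    have e2 : ¬ Coll (P 2) (P 4) (P 6) := (hp 2).2.1
    have e3 : ¬ Coll (P 2) (P 5) (P 6) := fun h => (hp 6).2.2 h.swap₂₃.swap₁₂
    have e4 : ¬ Coll (P 4) (P 5) (P 6) := (hp 4).1
    intro i j k hij hjk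
    rcases (show ∀ i j k : Fin 4, i < j → j < k → (i = 0 ∧ j = 1 ∧ k = 2) ∨
      (i = 0 ∧ j = 1 ∧ k = 3) ∨ (i = 0 ∧ j = 2 ∧ k = 3) ∨ (i = 1 ∧ j = 2 ∧ k = 3) by decide)
      i j k hij hjk with ⟨rfl, rfl, rfl⟩ | ⟨rfl, rfl, rfl⟩ | ⟨rfl, rfl, rfl⟩ | ⟨rfl, rfl, rfl⟩
    · exact e1
    · exact e2
    · exact e3
    · exact e4
  have hA4 := hfr
  set A : Fin 4 → X := ![P 2, P 4, P 5, P 6] with hAdef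
  have htw : Tw (Equiv.refl X) id A := ⟨fun _ => rfl, hfr⟩
  have d0 : diag₀ A = P 1 := ((htw.eq_diag_iff (by norm_num) edgePairs_four_mem.1 (P 1)).1
    ⟨(coll_iff (hne 2 4 (by decide))).1 (hA 1).swap₁₂.swap₂₃,
      (coll_iff (hne 5 6 (by decide))).1 (hA 5)⟩).symm
  have d1 : diag₁ A = P 3 := ((htw.eq_diag_iff (by norm_num) edgePairs_four_mem.2.1 (P 3)).1
    ⟨(coll_iff (hne 2 5 (by decide))).1 (hA 2).swap₂₃,
      (coll_iff (hne 4 6 (by decide))).1 (hA 3).swap₁₂.swap₂₃⟩).symm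
  have d2 : diag₂ A = P 0 := ((htw.eq_diag_iff (by norm_num) edgePairs_four_mem.2.2 (P 0)).1
    ⟨(coll_iff (hne 2 6 (by decide))).1 (hA 6).swap₂₃.swap₁₂,
      (coll_iff (hne 4 5 (by decide))).1 (hA 4)⟩).symm
  rw [← hΦ A hA4, d0, d1, d2]
  exact (hA 0).swap₁₂.swap₂₃

/-- `hA` is the number of cycles that are Fano planes, up to the choice of the cyclic order. -/
theorem numTw_seven {F : Equiv.Perm X} {q : ℤ}
    (hF : ∀ k, 1 ≤ k → k ≤ 7 → IsFrob (F ^ k) (q ^ k)) {a : ℤ}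
    (hA : cnt (fun x => Gen F (F ^ 7) x ∧ Coll x (F x) (F (F (F x)))) = pglCard q * a) :
    numTw (X := X) F ![1, 2, 3, 4, 5, 6, 0] =
      pglCard q * (q ^ 6 + q ^ 4 + q ^ 3 + q ^ 2 + 1 - 2 * a) := by
  have h1 : IsFrob F q := by simpa using hF 1 le_rfl (by norm_num)
  have h7 := hF 7 (by norm_num) (by norm_num)
  have hg := cnt_gen h1 h7 fun x hx => pow_fix hx 7
  have hB := cnt_fano_dual h1 h7
  rw [cnt_split _ (fun x => Coll x (F x) (F (F (F x)))), hA,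
    cnt_split (fun x => Gen F (F ^ 7) x ∧ ¬ Coll x (F x) (F (F (F x))))
      (fun x => Coll x (F (F x)) (F (F (F x)))),
    cnt_congr (r := fun x => Gen F (F ^ 7) x ∧ Coll x (F (F x)) (F (F (F x)))), hB, hA] at hg
  · have hc : numTw (X := X) F ![1, 2, 3, 4, 5, 6, 0] = cnt (fun x => (Gen F (F ^ 7) x ∧
        ¬ Coll x (F x) (F (F (F x)))) ∧ ¬ Coll x (F (F x)) (F (F (F x)))) := by
      have := cnt_cycle (F := F) (n := 7) fun x => Gen F (F ^ 7) x ∧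
        ¬ Coll x (F x) (F (F (F x))) ∧ ¬ Coll x (F (F x)) (F (F (F x)))
      rw [cnt_congr (p := fun x => (F ^ 7) x = x ∧ Gen F (F ^ 7) x ∧ _)
        (r := fun x => (Gen F (F ^ 7) x ∧
        ¬ Coll x (F x) (F (F (F x)))) ∧ ¬ Coll x (F (F x)) (F (F (F x))))] at this
      · rw [← this]
        exact cnt_congr fun P => tw_seven hF P
      · exact fun x => ⟨fun h => ⟨⟨h.2.1, h.2.2.1⟩, h.2.2.2⟩, fun h => ⟨h.1.1.1, h.1.1, h.1.2, h.2⟩⟩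
    rw [hc]
    unfold pglCard at *
    linear_combination hg
  · rintro x
    refine ⟨fun h => ⟨h.1.1, h.2⟩, fun h => ⟨⟨h.1, fun h' => ?_⟩, h.2⟩⟩
    have hne : x ≠ F (F (F x)) := (not_coll_ne (seven_progressions hF h.1).2.2).1
    have hA' := (coll_iff hne).1 h'.swap₂₃
    have hB' := (coll_iff hne).1 h.2.swap₂₃
    exact (seven_progressions hF h.1).1 ⟨_, inc_join_left hne, hA', hB'⟩

/-! ### A frame of type `(3, 1)` and a three-cycle -/

theorem coll_of_coll {a b c d : X} (h : a ≠ b) (hc : Coll a b c) (hd : Coll a b d) :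
    Coll a c d :=
  ⟨_, inc_join_left h, (coll_iff h).1 hc, (coll_iff h).1 hd⟩

/-- The points of a line `l`, not fixed itself, that are on no fixed line: each of the fixed lines
meets `l` in one point, and only a fixed point of `l` is met more than once. -/
theorem cnt_gen_line {F F' : Equiv.Perm X} {q q' r : ℤ} (hF : IsFrob F q) (hF' : IsFrob F' q')
    (h : ∀ x, F x = x → F' x = x) {l : X} (hl' : F' l = l) (hl : F l ≠ l)
    (hr : cnt (fun x => F x = x ∧ Inc x l) = r) :
    cnt (fun x => Gen F F' x ∧ Inc x l) = q' - q ^ 2 - q + r * q := by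
  have hne : ∀ m, F m = m → m ≠ l := by
    rintro m hm rfl
    exact hl hm
  have a := hF'.card_line l hl'
  rw [cnt_split _ (fun x => ∃ m, F m = m ∧ Inc x m),
    cnt_split (fun x => (F' x = x ∧ Inc x l) ∧ ∃ m, F m = m ∧ Inc x m) (fun x => F x = x)] at a
  have e1 : cnt (fun x => ((F' x = x ∧ Inc x l) ∧ ∃ m, F m = m ∧ Inc x m) ∧ F x = x) = r := by
    rw [← hr]
    exact cnt_congr fun x => ⟨fun k => ⟨k.2, k.1.1.2⟩,
      fun k => ⟨⟨⟨h x k.1, k.2⟩, hF.exists_line k.1⟩, k.1⟩⟩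
  have e2 : cnt (fun x => (F' x = x ∧ Inc x l) ∧ ¬ ∃ m, F m = m ∧ Inc x m) =
      cnt (fun x => Gen F F' x ∧ Inc x l) := cnt_congr fun x => by
    unfold Gen
    push Not
    tauto
  have b := hF.card_fix
  rw [cnt_split _ (fun m => F (join m l) = join m l)] at b
  have e3 : cnt (fun m => F m = m ∧ F (join m l) = join m l) = r * (q + 1) := by
    rw [← hr]
    refine cnt_fiber (fun m => join m l) _ ?_ ?_
    · rintro m ⟨hm, hm'⟩
      exact ⟨hm', join_inc_right (hne m hm)⟩
    · rintro x ⟨hx, hxl⟩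
      rw [← hF.card_line x hx]
      refine cnt_congr fun m => ⟨?_, ?_⟩
      · rintro ⟨⟨hm, _⟩, rfl⟩
        exact ⟨hm, inc_join_left (hne m hm)⟩
      · rintro ⟨hm, hmx⟩
        have : join m l = x := (eq_join (hne m hm) hmx (PolarPlane.symm hxl)).symm
        exact ⟨⟨hm, by rw [this, hx]⟩, this⟩
  have e4 : cnt (fun m => F m = m ∧ ¬ F (join m l) = join m l) =
      cnt (fun x => ((F' x = x ∧ Inc x l) ∧ ∃ m, F m = m ∧ Inc x m) ∧ ¬ F x = x) := by
    refine (cnt_fiber (fun m => join m l) 1 ?_ ?_).trans (mul_one _)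
    · rintro m ⟨hm, hm'⟩
      exact ⟨⟨⟨by rw [map_join hF', h m hm, hl'], join_inc_right (hne m hm)⟩, m, hm,
        join_inc_left (hne m hm)⟩, hm'⟩
    · rintro x ⟨⟨⟨hx', hxl⟩, m, hm, hxm⟩, hx⟩
      refine cnt_eq_one m fun m' => ?_
      have key : ∀ m', F m' = m' → Inc x m' → join m' l = x := fun m' hm' hi =>
        (eq_join' (hne m' hm') hi hxl).symm
      constructor
      · rintro ⟨⟨hm', _⟩, rfl⟩
        exact hF.fix_line_unique hx hm' hm (join_inc_left (hne _ hm')) hxm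
      · rintro rfl
        exact ⟨⟨hm, by rwa [key m' hm hxm]⟩, key m' hm hxm⟩
  rw [e1, e2] at a
  rw [e3, e4] at b
  linear_combination a - b

/-- The points `x`, `y`, `z` lie on the lines joining `A 3` to `A 1`, `A 2`, `A 0`, and the
triangle `x y z` is circumscribed to the triangle `A 0`, `A 1`, `A 2`; the vertices at `A 3`, for
which the three joining lines meet, are excluded. -/
def Circum (A : Fin 4 → X) (x y z : X) : Prop :=
  (Coll (A 1) (A 3) x ∧ Coll (A 2) (A 3) y ∧ Coll (A 0) (A 3) z) ∧
    (Coll (A 0) x y ∧ Coll (A 1) y z ∧ Coll (A 2) z x) ∧ x ≠ A 3 ∧ y ≠ A 3 ∧ z ≠ A 3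

/-- Every frame has no circumscribed triangle in the sense of `Circum` if `Φ` holds, and exactly
one otherwise. -/
def CircumIff (X : Type*) [PolarPlane X] (Φ : Prop) : Prop :=
  ∀ A : Fin 4 → X, (∀ i j k, i < j → j < k → ¬ Coll (A i) (A j) (A k)) →
    (Φ → ∀ x y z, ¬ Circum A x y z) ∧
    (¬ Φ → ∃ x y z, Circum A x y z ∧ ∀ x' y' z', Circum A x' y' z' → x' = x ∧ y' = y ∧ z' = z)

theorem frame_three_gen {F : Equiv.Perm X} {q : ℤ}
    (hF : ∀ k, 1 ≤ k → k ≤ 7 → IsFrob (F ^ k) (q ^ k)) {P : Fin 4 → X}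
    (hP : Tw F ![1, 2, 0, 3] P) :
    Gen F (F ^ 3) (P 0) ∧ Gen F (F ^ 3) (P 1) ∧ Gen F (F ^ 3) (P 2) := by
  have h1 : IsFrob F q := by simpa using hF 1 le_rfl (by norm_num)
  have e0 : F (P 0) = P 1 := hP.1 0
  have e1 : F (P 1) = P 2 := hP.1 1
  have e2 : F (P 2) = P 0 := hP.1 2
  have h0 : Gen F (F ^ 3) (P 0) := by
    refine ⟨?_, fun l hl hi => ?_⟩
    · show F (F (F (P 0))) = P 0
      rw [e0, e1, e2]
    · have i1 : Inc (P 1) l := by rwa [← e0, ← hl, h1.inc_iff]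
      have i2 : Inc (P 2) l := by rwa [← e1, ← hl, h1.inc_iff]
      exact hP.2 0 1 2 (by decide) (by decide) ⟨l, hi, i1, i2⟩
  have h1' := h0.map h1
  have h2' := h1'.map h1
  rw [e0] at h1' h2'
  rw [e1] at h2'
  exact ⟨h0, h1', h2'⟩

/-- The sides of the triangle `P 0 P 1 P 2` have no fixed points. -/
theorem frame_three_line {F : Equiv.Perm X} {q : ℤ}
    (hF : ∀ k, 1 ≤ k → k ≤ 7 → IsFrob (F ^ k) (q ^ k)) {P : Fin 4 → X}
    (hP : Tw F ![1, 2, 0, 3] P)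
    (k : Fin 4) (hk : k ≠ 3) :
    cnt (fun x => Gen F (F ^ 3) x ∧ Inc x (join (P k) (F (P k)))) = q ^ 3 - q ^ 2 - q := by
  have h1 : IsFrob F q := by simpa using hF 1 le_rfl (by norm_num)
  have h3 := hF 3 (by norm_num) (by norm_num)
  have hg := frame_three_gen hF hP
  have hk : Gen F (F ^ 3) (P k) := by
    fin_cases k
    · exact hg.1
    · exact hg.2.1
    · exact hg.2.2
    · exact absurd rfl hk
  have hd := hk.dual h1 h3
  have := cnt_gen_line h1 h3 (fun x hx => pow_fix hx 3) hd.1 (hk.line_ne h1)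
    (cnt_eq_zero (p := fun x => F x = x ∧ Inc x (join (P k) (F (P k))))
      fun x hx => hd.2 x hx.1 (PolarPlane.symm hx.2))
  linear_combination this

/-- The lines joining the triangle to `P 3` have the fixed point `P 3` only. -/
theorem frame_three_ray {F : Equiv.Perm X} {q : ℤ}
    (hF : ∀ k, 1 ≤ k → k ≤ 7 → IsFrob (F ^ k) (q ^ k)) {P : Fin 4 → X}
    (hP : Tw F ![1, 2, 0, 3] P)
    (k : Fin 4) (hk : k ≠ 3) :
    cnt (fun x => Gen F (F ^ 3) x ∧ Inc x (join (P k) (P 3))) = q ^ 3 - q ^ 2 := by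
  have h1 : IsFrob F q := by simpa using hF 1 le_rfl (by norm_num)
  have h3 := hF 3 (by norm_num) (by norm_num)
  have hg := frame_three_gen hF hP
  have h33 : F (P 3) = P 3 := hP.1 3
  have hne : P k ≠ P 3 := (hP.injective (by norm_num)).ne hk
  have hk : Gen F (F ^ 3) (P k) := by
    fin_cases k
    · exact hg.1
    · exact hg.2.1
    · exact hg.2.2
    · exact absurd rfl hk
  have hl : F (join (P k) (P 3)) ≠ join (P k) (P 3) := fun h => hk.2 _ h (inc_join_left hne)
  have := cnt_gen_line h1 h3 (fun x hx => pow_fix hx 3)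
    (by rw [map_join h3, hk.1, pow_fix h33]) hl
    (cnt_eq_one (p := fun x => F x = x ∧ Inc x (join (P k) (P 3))) (P 3) fun x => ?_)
  · linear_combination this
  · constructor
    · rintro ⟨hx, hi⟩
      by_contra hne'
      refine hl ?_
      rw [eq_join hne' hi (inc_join_right hne), map_join h1, hx, h33]
    · rintro rfl
      exact ⟨h33, inc_join_right hne⟩

/-- The diagonal points are conjugate, so they are on no fixed line unless they are collinear. -/
theorem frame_three_diag {F : Equiv.Perm X} {q : ℤ}
    (hF : ∀ k, 1 ≤ k → k ≤ 7 → IsFrob (F ^ k) (q ^ k)) {P : Fin 4 → X}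
    (hP : Tw F ![1, 2, 0, 3] P)
    {Φ : Prop} (hΦ : FanoIff X Φ) (p : (Fin 4 × Fin 4) × (Fin 4 × Fin 4))
    (hp : p ∈ edgePairs 4) : Gen F (F ^ 3) (diag P p) ↔ ¬ Φ := by
  have h1 : IsFrob F q := by simpa using hF 1 le_rfl (by norm_num)
  have hm := edgePairs_four_mem
  have e0 : F (diag₀ P) = diag₂ P :=
    hP.map_diag h1 (p := ((0, 1), (2, 3))) (r := ((0, 3), (1, 2))) (by decide)
  have e2 : F (diag₂ P) = diag₁ P :=
    hP.map_diag h1 (p := ((0, 3), (1, 2))) (r := ((0, 2), (1, 3))) (by decide)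
  have e1 : F (diag₁ P) = diag₀ P :=
    hP.map_diag h1 (p := ((0, 2), (1, 3))) (r := ((0, 1), (2, 3))) (by decide)
  have h0 : Gen F (F ^ 3) (diag₀ P) ↔ ¬ Φ := by
    rw [← hΦ P hP.2]
    constructor
    · rintro hg ⟨l, i0, i1, i2⟩
      refine hg.2 l (h1.fix_of_inc (gen_ne h1 hg) i0 ?_ ?_) i0
      · rwa [e0]
      · rwa [e0, e2]
    · refine fun hc => ⟨?_, fun l hl i0 => hc ⟨l, i0, ?_⟩⟩
      · show F (F (F (diag₀ P))) = _
        rw [e0, e2, e1]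
      · have i2 : Inc (diag₂ P) l := by rwa [← e0, ← hl, h1.inc_iff]
        exact ⟨by rwa [← e2, ← hl, h1.inc_iff], i2⟩
  have c2 : Gen F (F ^ 3) (diag₀ P) → Gen F (F ^ 3) (diag₂ P) := fun h => e0 ▸ h.map h1
  have c1 : Gen F (F ^ 3) (diag₂ P) → Gen F (F ^ 3) (diag₁ P) := fun h => e2 ▸ h.map h1
  have c0 : Gen F (F ^ 3) (diag₁ P) → Gen F (F ^ 3) (diag₀ P) := fun h => e1 ▸ h.map h1
  rw [show edgePairs 4 = {((0, 1), (2, 3)), ((0, 2), (1, 3)), ((0, 3), (1, 2))} by decide,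
    Finset.mem_insert, Finset.mem_insert, Finset.mem_singleton] at hp
  rcases hp with rfl | rfl | rfl
  · exact h0
  · exact ⟨fun h => h0.1 (c0 h), fun h => c1 (c2 (h0.2 h))⟩
  · exact ⟨fun h => h0.1 (c0 (c1 h)), fun h => c2 (h0.2 h)⟩

/-- The points on no fixed line that are on no line of the frame. -/
theorem frame_three_off {F : Equiv.Perm X} {q : ℤ}
    (hF : ∀ k, 1 ≤ k → k ≤ 7 → IsFrob (F ^ k) (q ^ k)) {P : Fin 4 → X}
    (hP : Tw F ![1, 2, 0, 3] P) {Φ : Prop} [Decidable Φ] (hΦ : FanoIff X Φ) :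
    cnt (fun x => Gen F (F ^ 3) x ∧ OffC P x) =
      q ^ 6 - q ^ 5 - q ^ 4 - 5 * q ^ 3 + 6 * q ^ 2 + 3 * q + 6 + if Φ then 0 else 3 := by
  have h1 : IsFrob F q := by simpa using hF 1 le_rfl (by norm_num)
  have h3 := hF 3 (by norm_num) (by norm_num)
  have hinj := hP.injective (by norm_num)
  have hg := frame_three_gen hF hP
  have h33 : F (P 3) = P 3 := hP.1 3
  have hnq : ¬ Gen F (F ^ 3) (P 3) := fun h => gen_ne h1 h h33
  have e0 : F (P 0) = P 1 := hP.1 0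
  have e1 : F (P 1) = P 2 := hP.1 1
  have e2 : F (P 2) = P 0 := hP.1 2
  -- `F ^ 3` fixes the frame pointwise, so inclusion-exclusion applies to the points it fixes
  have hP3 : Tw (F ^ 3) ![0, 1, 2, 3] P := by
    refine ⟨fun i => ?_, hP.2⟩
    fin_cases i
    · exact hg.1.1
    · exact hg.2.1.1
    · exact hg.2.2.1
    · exact pow_fix h33 3
  have e := cnt_off h3 (by norm_num) (by norm_num) hP3
    (fun x => Gen F (F ^ 3) x ∧ ∀ i, x ≠ P i) fun x hx => ⟨hx.1.1, hx.2⟩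
  have r0 : cnt (fun x => Gen F (F ^ 3) x ∧ OffC P x) =
      cnt (fun x => (Gen F (F ^ 3) x ∧ ∀ i, x ≠ P i) ∧ Off P x) :=
    cnt_congr fun x => by
      rw [hP.offC_iff (by norm_num)]
      exact ⟨fun h => ⟨⟨h.1, off_ne (by norm_num) hP h.2⟩, h.2⟩, fun h => ⟨h.1.1, h.2⟩⟩
  have hsplit : ∀ p : X → Prop, cnt (fun x => (Gen F (F ^ 3) x ∧ ∀ i, x ≠ P i) ∧ p x) =
      cnt (fun x => Gen F (F ^ 3) x ∧ p x) -
        cnt (fun x => (x = P 0 ∨ x = P 1 ∨ x = P 2) ∧ p x) := by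
    intro p
    rw [cnt_split (fun x => Gen F (F ^ 3) x ∧ p x) (fun x => x = P 0 ∨ x = P 1 ∨ x = P 2),
      eq_sub_iff_add_eq, add_comm]
    congr 1 <;> refine cnt_congr fun x => ?_
    · constructor
      · rintro ⟨h, h'⟩
        refine ⟨⟨?_, h'⟩, h⟩
        rcases h with rfl | rfl | rfl
        exacts [hg.1, hg.2.1, hg.2.2]
      · exact fun h => ⟨h.2, h.1.2⟩
    · rw [show (∀ i, x ≠ P i) ↔ x ≠ P 0 ∧ x ≠ P 1 ∧ x ≠ P 2 ∧ x ≠ P 3 from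
        Fin.forall_fin_succ.trans (by simp [Fin.forall_fin_succ])]
      have : Gen F (F ^ 3) x → x ≠ P 3 := by
        rintro h rfl
        exact hnq h
      tauto
  have htwo : ∀ i j : Fin 4, i ≠ j → cnt (fun x => x = P i ∨ x = P j) = 2 := by
    intro i j hij
    rw [cnt_or, cnt_eq_one _ fun _ => Iff.rfl, cnt_eq_one _ fun _ => Iff.rfl]
    · norm_num
    · rintro x rfl
      exact hinj.ne hij
  have hthree : cnt (fun x => x = P 0 ∨ x = P 1 ∨ x = P 2) = 3 := by
    rw [cnt_or, htwo 1 2 (by decide), cnt_eq_one _ fun _ => Iff.rfl]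
    · norm_num
    · rintro x rfl
      have a := hinj.ne (show (0 : Fin 4) ≠ 1 by decide)
      have b := hinj.ne (show (0 : Fin 4) ≠ 2 by decide)
      tauto
  have hon : ∀ i j : Fin 4, i ≠ j → ∀ k, Inc (P k) (join (P i) (P j)) ↔ k = i ∨ k = j :=
    fun i j hij k => hP.inc_line_iff (by norm_num) (e := (i, j)) hij k
  have hmem : ∀ i j : Fin 4, i ≠ j →
      cnt (fun x => (x = P 0 ∨ x = P 1 ∨ x = P 2) ∧ Inc x (join (P i) (P j))) =
        cnt (fun x => (x = P i ∨ x = P j) ∧ x ≠ P 3) := by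
    intro i j hij
    refine cnt_congr fun x => ?_
    constructor
    · rintro ⟨rfl | rfl | rfl, h⟩ <;> rw [hon i j hij] at h <;>
        refine ⟨?_, hinj.ne (by decide)⟩ <;> rcases h with rfl | rfl <;> simp
    · rintro ⟨rfl | rfl, h⟩
      · refine ⟨?_, (hon i j hij _).2 (Or.inl rfl)⟩
        fin_cases i
        exacts [Or.inl rfl, Or.inr (Or.inl rfl), Or.inr (Or.inr rfl), absurd rfl h]
      · refine ⟨?_, (hon i j hij _).2 (Or.inr rfl)⟩
        fin_cases j
        exacts [Or.inl rfl, Or.inr (Or.inl rfl), Or.inr (Or.inr rfl), absurd rfl h]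
  have hside : ∀ k : Fin 4, k ≠ 3 → ∀ j, F (P k) = P j → k ≠ j → j ≠ 3 →
      cnt (fun x => (Gen F (F ^ 3) x ∧ ∀ i, x ≠ P i) ∧ Inc x (join (P k) (P j))) =
        q ^ 3 - q ^ 2 - q - 2 := by
    intro k hk j hj hkj hj3
    have := frame_three_line hF hP k hk
    rw [hj] at this
    rw [hsplit, this, hmem _ _ hkj, ← htwo k j hkj]
    congr 1
    refine cnt_congr fun x => ⟨fun h => h.1, fun h => ⟨h, ?_⟩⟩
    rcases h with rfl | rfl
    exacts [hinj.ne hk, hinj.ne hj3]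
  have hray : ∀ k : Fin 4, k ≠ 3 →
      cnt (fun x => (Gen F (F ^ 3) x ∧ ∀ i, x ≠ P i) ∧ Inc x (join (P k) (P 3))) =
        q ^ 3 - q ^ 2 - 1 := by
    intro k hk
    rw [hsplit, frame_three_ray hF hP k hk, hmem _ _ hk]
    congr 1
    refine cnt_eq_one (P k) fun x => ⟨fun h => h.1.resolve_right h.2, ?_⟩
    rintro rfl
    exact ⟨Or.inl rfl, hinj.ne hk⟩
  have hdiag : ∀ p ∈ edgePairs 4, cnt (fun x => (Gen F (F ^ 3) x ∧ ∀ i, x ≠ P i) ∧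
      Inc x (line P p.1) ∧ Inc x (line P p.2)) = if Φ then 0 else 1 := by
    intro p hp
    rw [← ite_not]
    refine cnt_eq_ite (diag P p) (¬ Φ) fun x => ?_
    rw [hP.eq_diag_iff (by norm_num) hp x, ← frame_three_diag hF hP hΦ p hp]
    constructor
    · rintro ⟨⟨h, _⟩, rfl⟩
      exact ⟨rfl, h⟩
    · rintro ⟨rfl, h⟩
      exact ⟨⟨h, hP.diag_ne (by norm_num) hp⟩, rfl⟩
  have hm := edgePairs_four_mem
  rw [r0, e, show ((edges 4).filter fun e => Carries ![0, 1, 2, 3] e e) =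
      {(0, 1), (0, 2), (0, 3), (1, 2), (1, 3), (2, 3)} by decide,
    show ((edgePairs 4).filter fun p => Carries ![0, 1, 2, 3] p.1 p.1 ∧
      Carries ![0, 1, 2, 3] p.2 p.2) =
        {((0, 1), (2, 3)), ((0, 2), (1, 3)), ((0, 3), (1, 2))} by decide,
    show ((edgePairs 4).filter fun p => Carries ![0, 1, 2, 3] p.1 p.2 ∧
      Carries ![0, 1, 2, 3] p.2 p.1) = ∅ by decide]
  rw [Finset.sum_insert (by decide), Finset.sum_insert (by decide), Finset.sum_insert (by decide),
    Finset.sum_insert (by decide), Finset.sum_insert (by decide), Finset.sum_singleton,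
    Finset.sum_insert (by decide), Finset.sum_insert (by decide), Finset.sum_singleton,
    Finset.sum_empty, hdiag _ hm.1, hdiag _ hm.2.1, hdiag _ hm.2.2]
  simp only [line]
  have s01 := hside 0 (by decide) 1 e0 (by decide) (by decide)
  have s12 := hside 1 (by decide) 2 e1 (by decide) (by decide)
  have s20 := hside 2 (by decide) 0 e2 (by decide) (by decide)
  rw [join_comm] at s20
  rw [s01, s12, s20, hray 0 (by decide), hray 1 (by decide), hray 2 (by decide)]
  have hall := hsplit fun _ => True
  simp only [and_true] at hall
  have hgen := cnt_gen h1 h3 fun x hx => pow_fix hx 3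
  rw [hall, hthree, hgen]
  split_ifs <;> ring

/-- Both the frame and the condition are invariant under rotation, so a unique circumscribed
triangle is permuted by `F`. -/
theorem Circum.map {F : Equiv.Perm X} {q : ℤ} (hF : IsFrob F q) {P : Fin 4 → X}
    (hP : Tw F ![1, 2, 0, 3] P) {x y z : X} (h : Circum P x y z) :
    Circum P (F z) (F x) (F y) := by
  have h33 : F (P 3) = P 3 := hP.1 3
  have e0 : F (P 0) = P 1 := hP.1 0
  have e1 : F (P 1) = P 2 := hP.1 1
  have e2 : F (P 2) = P 0 := hP.1 2
  obtain ⟨⟨a1, a2, a3⟩, ⟨b1, b2, b3⟩, c1, c2, c3⟩ := h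
  rw [← map_coll hF] at a1 a2 a3 b1 b2 b3
  rw [e1, h33] at a1
  rw [e2, h33] at a2
  rw [e0, h33] at a3
  rw [e0] at b1
  rw [e1] at b2
  rw [e2] at b3
  rw [← F.injective.ne_iff, h33] at c1 c2 c3
  exact ⟨⟨a3, a1, a2⟩, ⟨b3, b1, b2⟩, c3, c1, c2⟩

/-- Of the points `x` on no fixed line whose join with `F x` passes through `P 0`, those on a line
of the frame are `P 0`, `P 2` and the first vertex of the circumscribed triangle. -/
theorem not_offC_iff {F : Equiv.Perm X} {q : ℤ}
    (hF : ∀ k, 1 ≤ k → k ≤ 7 → IsFrob (F ^ k) (q ^ k)) {P : Fin 4 → X}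
    (hP : Tw F ![1, 2, 0, 3] P) (x : X) :
    ((Gen F (F ^ 3) x ∧ Coll (P 0) x (F x)) ∧ ¬ OffC P x) ↔
      x = P 0 ∨ x = P 2 ∨ (F (F (F x)) = x ∧ Circum P x (F x) (F (F x))) := by
  have h1 : IsFrob F q := by simpa using hF 1 le_rfl (by norm_num)
  have h3 := hF 3 (by norm_num) (by norm_num)
  have hinj := hP.injective (by norm_num)
  have hg := frame_three_gen hF hP
  have h33 : F (P 3) = P 3 := hP.1 3
  have e0 : F (P 0) = P 1 := hP.1 0
  have e1 : F (P 1) = P 2 := hP.1 1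
  have e2 : F (P 2) = P 0 := hP.1 2
  constructor
  · rintro ⟨⟨hx, hc⟩, ho⟩
    by_cases x0 : x = P 0
    · exact Or.inl x0
    by_cases x2 : x = P 2
    · exact Or.inr (Or.inl x2)
    have f1 : F x ≠ P 1 := by rw [← e0]; exact F.injective.ne x0
    have f0 : F x ≠ P 0 := by rw [← e2]; exact F.injective.ne x2
    have hq : ¬ Coll x (F x) (P 3) := fun h =>
      (hx.dual h1 h3).2 _ h33 (PolarPlane.symm ((coll_iff (gen_ne h1 hx).symm).1 h))
    simp only [OffC, not_forall, not_not] at ho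
    obtain ⟨i, j, hij, hl⟩ := ho
    -- of the six lines of the frame that may contain `x` only `P 1 P 3` is possible
    rcases (show ∀ i j : Fin 4, i < j → (i = 0 ∧ j = 1) ∨ (i = 0 ∧ j = 2) ∨ (i = 0 ∧ j = 3) ∨
      (i = 1 ∧ j = 2) ∨ (i = 1 ∧ j = 3) ∨ (i = 2 ∧ j = 3) by decide) i j hij with
      ⟨rfl, rfl⟩ | ⟨rfl, rfl⟩ | ⟨rfl, rfl⟩ | ⟨rfl, rfl⟩ | ⟨rfl, rfl⟩ | ⟨rfl, rfl⟩
    · have a := coll_of_coll (Ne.symm x0) hl.swap₂₃ hc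
      have b := (map_coll h1 _ _ _).2 hl
      rw [e0, e1] at b
      exact absurd (coll_of_coll f1.symm a.swap₁₂.swap₂₃ b.swap₂₃)
        (hP.not_coll (by decide) (by decide) (by decide))
    · have a := coll_of_coll (Ne.symm x0) hl.swap₂₃ hc
      have b := (map_coll h1 _ _ _).2 hl
      rw [e0, e2] at b
      exact absurd (coll_of_coll f0.symm b.swap₁₂.swap₂₃ a.swap₂₃)
        (hP.not_coll (by decide) (by decide) (by decide))
    · exact absurd (coll_of_coll x0 hc.swap₁₂ hl.swap₂₃.swap₁₂) hq
    · have b := (map_coll h1 _ _ _).2 hl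
      rw [e1, e2] at b
      have a := coll_of_coll f0.symm hc.swap₂₃ b.swap₁₂.swap₂₃
      exact absurd (coll_of_coll (Ne.symm x2) hl.swap₁₂.swap₂₃ a.swap₁₂.swap₂₃.swap₁₂)
        (hP.not_coll (by decide) (by decide) (by decide))
    · refine Or.inr (Or.inr ⟨hx.1, ⟨hl, ?_, ?_⟩, ⟨hc, ?_, ?_⟩, ?_, ?_, ?_⟩)
      · have b := (map_coll h1 _ _ _).2 hl
        rwa [e1, h33] at b
      · have b := (map_coll h1 _ _ _).2 ((map_coll h1 _ _ _).2 hl)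
        rwa [e1, h33, e2, h33] at b
      · have b := (map_coll h1 _ _ _).2 hc
        rwa [e0] at b
      · have b := (map_coll h1 _ _ _).2 ((map_coll h1 _ _ _).2 hc)
        rwa [e0, e1, show F (F (F x)) = x from hx.1] at b
      · rintro rfl
        exact gen_ne h1 hx h33
      · intro h
        exact gen_ne h1 (hx.map h1) (by rw [h, h33])
      · intro h
        exact gen_ne h1 ((hx.map h1).map h1) (by rw [h, h33])
    · have b := (map_coll h1 _ _ _).2 hl
      rw [e2, h33] at b
      exact absurd (coll_of_coll f0 hc.swap₂₃.swap₁₂ b.swap₂₃.swap₁₂).swap₁₂ hq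
  · rintro (rfl | rfl | ⟨hx, hC⟩)
    · exact ⟨⟨hg.1, coll_self_left _ _⟩, fun h =>
        h 0 1 (by decide) (coll_self_left _ _).swap₂₃⟩
    · refine ⟨⟨hg.2.2, ?_⟩, fun h => h 0 2 (by decide) (coll_self_left _ _).swap₂₃.swap₁₂⟩
      rw [e2]
      exact (coll_self_left _ _).swap₂₃
    · obtain ⟨⟨a1, a2, a3⟩, ⟨b1, b2, b3⟩, c1, c2, c3⟩ := hC
      refine ⟨⟨⟨hx, fun l hl hi => ?_⟩, b1⟩, fun h => h 1 3 (by decide) a1⟩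
      have hne : x ≠ F x := by
        intro h
        rw [← h] at a2
        exact hP.not_coll (i := 3) (j := 1) (k := 2) (by decide) (by decide) (by decide)
          (coll_of_coll (Ne.symm c1) a1.swap₁₂.swap₂₃ a2.swap₁₂.swap₂₃)
      have hi' : Inc (F x) l := by rwa [← hl, h1.inc_iff]
      refine hg.1.2 l hl ?_
      have := (coll_iff hne).1 b1.swap₁₂.swap₂₃
      rwa [← eq_join hne hi hi'] at this

/-- Dually, `join x (F x)` is a line through `P 0`; this gives the number of such points `x`, from
which those on the lines of the frame are removed. -/
theorem cnt_frame_three_aligned {F : Equiv.Perm X} {q : ℤ}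
    (hF : ∀ k, 1 ≤ k → k ≤ 7 → IsFrob (F ^ k) (q ^ k)) {Φ : Prop} [Decidable Φ]
    (hC : CircumIff X Φ) {P : Fin 4 → X} (hP : Tw F ![1, 2, 0, 3] P) :
    cnt (fun x => (Gen F (F ^ 3) x ∧ OffC P x) ∧ Coll (P 0) x (F x)) =
      q ^ 3 - q ^ 2 - q - 2 - if Φ then 0 else 1 := by
  have h1 : IsFrob F q := by simpa using hF 1 le_rfl (by norm_num)
  have h3 := hF 3 (by norm_num) (by norm_num)
  have hinj := hP.injective (by norm_num)
  have hg := frame_three_gen hF hP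
  have a : cnt (fun x => Gen F (F ^ 3) x ∧ Coll (P 0) x (F x)) = q ^ 3 - q ^ 2 - q := by
    have e := cnt_dual h1 h3 fun y => Inc y (P 0)
    have := cnt_gen_line h1 h3 (fun x hx => pow_fix hx 3) hg.1.1 (gen_ne h1 hg.1)
      (cnt_eq_zero (p := fun x => F x = x ∧ Inc x (P 0))
        fun x hx => hg.1.2 x hx.1 (PolarPlane.symm hx.2))
    rw [this] at e
    rw [← sub_eq_zero] at *
    rw [← e]
    have : cnt (fun x => Gen F (F ^ 3) x ∧ Coll (P 0) x (F x)) =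
        cnt (fun x => Gen F (F ^ 3) x ∧ Inc (join x (F x)) (P 0)) := by
      refine cnt_congr fun x => and_congr_right fun hx => ?_
      rw [inc_comm, ← coll_iff (gen_ne h1 hx).symm]
      exact ⟨fun h => h.swap₁₂.swap₂₃, fun h => h.swap₂₃.swap₁₂⟩
    rw [this]
    ring
  rw [cnt_split _ (fun x => OffC P x), cnt_congr fun x => not_offC_iff hF hP x] at a
  have b : cnt (fun x => (Gen F (F ^ 3) x ∧ Coll (P 0) x (F x)) ∧ OffC P x) =
      cnt (fun x => (Gen F (F ^ 3) x ∧ OffC P x) ∧ Coll (P 0) x (F x)) :=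
    cnt_congr fun x => by tauto
  have hne : ∀ x, (F (F (F x)) = x ∧ Circum P x (F x) (F (F x))) → x ≠ P 0 ∧ x ≠ P 2 := by
    rintro x ⟨_, hx⟩
    constructor <;> rintro rfl
    · exact hP.not_coll (by decide) (by decide) (by decide) hx.1.1
    · exact hP.not_coll (by decide) (by decide) (by decide) hx.1.1
  have c : cnt (fun x => F (F (F x)) = x ∧ Circum P x (F x) (F (F x))) = if Φ then 0 else 1 := by
    split_ifs with h
    · exact cnt_eq_zero fun x hx => (hC P hP.2).1 h _ _ _ hx.2
    · obtain ⟨x, y, z, h1', h2⟩ := (hC P hP.2).2 h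
      obtain ⟨ex, ey, ez⟩ := h2 _ _ _ (h1'.map h1 hP)
      refine cnt_eq_one x fun x' => ⟨fun h => (h2 _ _ _ h.2).1, ?_⟩
      rintro rfl
      rw [ey, ez]
      exact ⟨ex, h1'⟩
  rw [cnt_or, cnt_or, c, cnt_eq_one _ fun _ => Iff.rfl, cnt_eq_one _ fun _ => Iff.rfl, b] at a
  · linear_combination a
  · rintro x rfl h
    exact (hne _ h).2 rfl
  · rintro x rfl h
    rcases h with h | h
    · exact hinj.ne (by decide) h
    · exact (hne _ h).1 rfl

/-- The type `(3, 3, 1)`: the second triple must avoid the lines of the frame, and its sides the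
points of the frame. -/
theorem numTw_three_three {F : Equiv.Perm X} {q : ℤ}
    (hF : ∀ k, 1 ≤ k → k ≤ 7 → IsFrob (F ^ k) (q ^ k)) {Φ : Prop} [Decidable Φ]
    (hΦ : FanoIff X Φ) (hC : CircumIff X Φ) :
    numTw (X := X) F ![1, 2, 0, 3, 5, 6, 4] = pglCard q * (q ^ 6 - q ^ 5 - q ^ 4 - 8 * q ^ 3
      + 9 * q ^ 2 + 6 * q + 12 + if Φ then 0 else 6) := by
  have h1 : IsFrob F q := by simpa using hF 1 le_rfl (by norm_num)
  have hF3 := hF 3 (by norm_num) (by norm_num)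
  have hc : ∀ A : Fin 4 → X, Tw F ![1, 2, 0, 3] A → cnt (fun u : X × X × X =>
      (F u.1 = u.2.1 ∧ F u.2.1 = u.2.2 ∧ F u.2.2 = u.1) ∧ OffC A u.1 ∧ OffC A u.2.1 ∧
      OffC A u.2.2 ∧ (∀ i, ¬ Coll (A i) u.1 u.2.1) ∧ (∀ i, ¬ Coll (A i) u.2.1 u.2.2) ∧
      (∀ i, ¬ Coll (A i) u.1 u.2.2) ∧ ¬ Coll u.1 u.2.1 u.2.2) =
      q ^ 6 - q ^ 5 - q ^ 4 - 8 * q ^ 3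
      + 9 * q ^ 2 + 6 * q + 12 + if Φ then 0 else 6 := by
    intro A hA
    have h33 : F (A 3) = A 3 := hA.1 3
    have e0 : F (A 0) = A 1 := hA.1 0
    have e1 : F (A 1) = A 2 := hA.1 1
    have e2 : F (A 2) = A 0 := hA.1 2
    rw [cnt_conj_triple fun x y z => OffC A x ∧ OffC A y ∧
      OffC A z ∧ (∀ i, ¬ Coll (A i) x y) ∧ (∀ i, ¬ Coll (A i) y z) ∧
      (∀ i, ¬ Coll (A i) x z) ∧ ¬ Coll x y z]
    have hcyc : ∀ x, Gen F (F ^ 3) x → F (F (F x)) = x := fun x hx => hx.1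
    have hoff : ∀ x, Gen F (F ^ 3) x → OffC A x → OffC A (F x) := by
      intro x hx ho
      rw [hA.offC_iff (by norm_num)] at ho ⊢
      refine hA.off_map h1 (by norm_num) (hA.off_map h1 (by norm_num) ?_)
      rwa [hcyc x hx]
    have hq : ∀ x, Gen F (F ^ 3) x → ¬ Coll (A 3) x (F x) := fun x hx h =>
      (hx.dual h1 hF3).2 _ h33 (PolarPlane.symm
        ((coll_iff (gen_ne h1 hx).symm).1 h.swap₁₂.swap₂₃))
    have hgood : cnt (fun x => (F ^ 3) x = x ∧ OffC A x ∧ OffC A (F x) ∧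
        OffC A (F (F x)) ∧ (∀ i, ¬ Coll (A i) x (F x)) ∧ (∀ i, ¬ Coll (A i) (F x) (F (F x))) ∧
        (∀ i, ¬ Coll (A i) x (F (F x))) ∧ ¬ Coll x (F x) (F (F x))) =
        cnt (fun x => (((Gen F (F ^ 3) x ∧ OffC A x) ∧ ¬ Coll (A 0) x (F x)) ∧
          ¬ Coll (A 1) x (F x)) ∧ ¬ Coll (A 2) x (F x)) := by
      refine cnt_congr fun x => ⟨?_, ?_⟩
      · rintro ⟨h0, ho, _, _, hs, _, _, hcoll⟩
        refine ⟨⟨⟨⟨⟨h0, fun l hl hxl => hcoll ⟨l, hxl, ?_⟩⟩, ho⟩, hs 0⟩, hs 1⟩, hs 2⟩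
        have step : ∀ y, Inc y l → Inc (F y) l := by
          intro y hy
          rw [← h1.inc_iff, hl] at hy
          exact hy
        exact ⟨step _ hxl, step _ (step _ hxl)⟩
      · rintro ⟨⟨⟨⟨hx, ho⟩, s0⟩, s1⟩, s2⟩
        have hx1 := hx.map h1
        have hs : ∀ i, ¬ Coll (A i) x (F x) := by
          intro i
          fin_cases i
          exacts [s0, s1, s2, hq x hx]
        -- the frame is permuted, so that the conditions on the sides are conjugate
        have hconj : ∀ y, (∀ i, ¬ Coll (A i) y (F y)) → ∀ i, ¬ Coll (A i) (F y) (F (F y)) := by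
          intro y hy i
          obtain ⟨j, rfl⟩ := (Finite.injective_iff_surjective.1 (hA.label_injective (by norm_num))) i
          rw [← hA.1, map_coll h1]
          exact hy j
        refine ⟨hx.1, ho, hoff _ hx ho, hoff _ hx1 (hoff _ hx ho), hs, hconj _ hs, fun i hi => ?_,
          by simpa using not_coll_progression h1 hF3 (a := 1) (by simpa using h1) hx (by norm_num)⟩
        refine hconj _ (hconj _ hs) i ?_
        rw [hcyc x hx]
        exact hi.swap₂₃
    -- the three points of the cycle contribute equally
    have hrot : ∀ i j, F (A i) = A j →
        cnt (fun x => (Gen F (F ^ 3) x ∧ OffC A x) ∧ Coll (A i) x (F x)) =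
        cnt (fun x => (Gen F (F ^ 3) x ∧ OffC A x) ∧ Coll (A j) x (F x)) := by
      intro i j hij
      refine cnt_bij F (fun x => F (F x)) ?_ ?_ ?_ ?_
      · rintro x ⟨⟨h, ho⟩, hc⟩
        refine ⟨⟨h.map h1, hoff _ h ho⟩, ?_⟩
        rwa [← hij, map_coll h1]
      · rintro x ⟨⟨h, ho⟩, hc⟩
        refine ⟨⟨(h.map h1).map h1, hoff _ (h.map h1) (hoff _ h ho)⟩, ?_⟩
        rw [← map_coll h1, hij, hcyc x h]
        exact hc
      · exact fun x h => hcyc x h.1.1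
      · exact fun x h => hcyc x h.1.1
    -- the contributions are disjoint, since `x` is on no line of the frame
    have hdisj : ∀ i j : Fin 4, i < j → ∀ x, OffC A x → Coll (A i) x (F x) →
        Coll (A j) x (F x) → F x ≠ x → False := by
      intro i j hij x ho hi hj hne
      exact ho i j hij (coll_of_coll (Ne.symm hne) hi.swap₁₂.swap₂₃ hj.swap₁₂.swap₂₃).swap₁₂.swap₂₃
    rw [hgood]
    have t := frame_three_off hF hA hΦ
    rw [cnt_split _ (fun x => Coll (A 0) x (F x)),
      cnt_split (fun x => (Gen F (F ^ 3) x ∧ OffC A x) ∧ ¬ Coll (A 0) x (F x))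
        (fun x => Coll (A 1) x (F x)),
      cnt_split (fun x => ((Gen F (F ^ 3) x ∧ OffC A x) ∧ ¬ Coll (A 0) x (F x)) ∧
        ¬ Coll (A 1) x (F x)) (fun x => Coll (A 2) x (F x)),
      cnt_congr (p := fun x => ((Gen F (F ^ 3) x ∧ OffC A x) ∧ ¬ Coll (A 0) x (F x)) ∧
        Coll (A 1) x (F x)) (r := fun x => (Gen F (F ^ 3) x ∧ OffC A x) ∧ Coll (A 1) x (F x)),
      cnt_congr (p := fun x => (((Gen F (F ^ 3) x ∧ OffC A x) ∧ ¬ Coll (A 0) x (F x)) ∧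
        ¬ Coll (A 1) x (F x)) ∧ Coll (A 2) x (F x))
        (r := fun x => (Gen F (F ^ 3) x ∧ OffC A x) ∧ Coll (A 2) x (F x)),
      ← hrot 1 2 e1, ← hrot 0 1 e0, cnt_frame_three_aligned hF hC hA] at t
    · split_ifs at t ⊢ <;> linear_combination t
    · intro x
      refine ⟨fun h => ⟨h.1.1.1, h.2⟩, fun h => ⟨⟨⟨h.1, fun h' => ?_⟩, fun h' => ?_⟩, h.2⟩⟩
      · exact hdisj 0 2 (by decide) x h.1.2 h' h.2 (gen_ne h1 h.1.1)
      · exact hdisj 1 2 (by decide) x h.1.2 h' h.2 (gen_ne h1 h.1.1)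
    · intro x
      refine ⟨fun h => ⟨h.1.1, h.2⟩, fun h => ⟨⟨h.1, fun h' => ?_⟩, h.2⟩⟩
      exact hdisj 0 1 (by decide) x h.1.2 h' h.2 (gen_ne h1 h.1.1)
  have hs := cnt_sigma _ _ _ hc
  rw [← numTw_frame_three hF, numTw, cnt_snoc_three, numTw, ← hs]
  exact cnt_congr fun u => tw_snoc_snoc_snoc ![1, 2, 0, 3] ![1, 2, 0, 3, 5, 6, 4] (by decide)
    (by decide) (by decide) (by decide) _ _ _ _

end plane

/-! ### The Frobenius of the projective plane -/

section frobenius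

variable (k K : Type*) [Field k] [Fintype k] [Field K] [Algebra k K]

theorem frobVec_iterate (n : ℕ) (v : Fin 3 → K) (i : Fin 3) :
    (frobVec k K)^[n] v i = v i ^ Fintype.card k ^ n := by
  induction n generalizing v with
  | zero => simp
  | succ n ih =>
    rw [Function.iterate_succ_apply, ih, pow_succ', pow_mul]
    rfl

theorem frobVec_iterate_ne_zero (n : ℕ) {v : Fin 3 → K} (hv : v ≠ 0) :
    (frobVec k K)^[n] v ≠ 0 := by
  intro h
  refine hv ((Function.Injective.iterate (frobVec_injective k K) n) (h.trans ?_))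
  exact (Function.iterate_fixed (map_zero (frobVec k K)) n).symm

theorem frob_iterate_mk (n : ℕ) (v : Fin 3 → K) (hv : v ≠ 0) :
    (frob k K)^[n] (Projectivization.mk K v hv) =
      Projectivization.mk K ((frobVec k K)^[n] v) (frobVec_iterate_ne_zero k K n hv) := by
  induction n generalizing v with
  | zero => rfl
  | succ n ih =>
    rw [Function.iterate_succ_apply, frob, Projectivization.map_mk]
    exact ih _ _

theorem frob_orthogonal (a b : ℙ K (Fin 3 → K)) :
    (frob k K a).orthogonal (frob k K b) ↔ a.orthogonal b := by
  induction a with | h v hv =>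
  induction b with | h w hw =>
  rw [frob, Projectivization.map_mk, Projectivization.map_mk, Projectivization.orthogonal_mk,
    Projectivization.orthogonal_mk]
  have : frobVec k K v ⬝ᵥ frobVec k K w = FiniteField.frobeniusAlgHom k K (v ⬝ᵥ w) := by
    rw [dotProduct, dotProduct, map_sum]
    exact Finset.sum_congr rfl fun i _ => (map_mul (FiniteField.frobeniusAlgHom k K) _ _).symm
  rw [this, map_eq_zero]

/-- The elements of `K` fixed by the `q ^ n`-power map, for `q = #k`. -/
def fixField (n : ℕ) : Subfield K :=
  RingHom.eqLocusField ((FiniteField.frobeniusAlgHom k K : K →+* K) ^ n) (RingHom.id K)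

theorem mem_fixField {n : ℕ} {c : K} : c ∈ fixField k K n ↔ c ^ Fintype.card k ^ n = c := by
  have : ∀ n (c : K), ((FiniteField.frobeniusAlgHom k K : K →+* K) ^ n) c =
      c ^ Fintype.card k ^ n := by
    intro n
    induction n with
    | zero => simp
    | succ n ih =>
      intro c
      rw [pow_succ, RingHom.mul_def, RingHom.comp_apply, ih, pow_succ', pow_mul]
      rfl
  rw [fixField, RingHom.mem_eqLocusField, this, RingHom.id_apply]

theorem card_fixField [IsAlgClosed K] {n : ℕ} (hn : n ≠ 0) :
    Nat.card (fixField k K n) = Fintype.card k ^ n := by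
  obtain ⟨p, hp⟩ := CharP.exists k
  have : CharP K p := charP_of_injective_algebraMap (algebraMap k K).injective p
  obtain ⟨m, _, hm⟩ := FiniteField.card k p
  have hQ : 1 < Fintype.card k ^ n := Nat.one_lt_pow hn Fintype.one_lt_card
  open Polynomial in
  have hsep : (X ^ (Fintype.card k ^ n) - X : K[X]).Separable :=
    galois_poly_separable p _ (dvd_pow (hm ▸ dvd_pow_self p m.ne_zero) hn)
  have hc := Polynomial.card_rootSet_eq_natDegree (K := K) hsep (IsAlgClosed.splits _)
  rw [FiniteField.X_pow_card_sub_X_natDegree_eq K hQ] at hc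
  rw [← hc, ← Nat.card_eq_fintype_card]
  refine Nat.card_congr (Equiv.subtypeEquivRight fun c => ?_)
  rw [Polynomial.mem_rootSet_of_ne (FiniteField.X_pow_card_sub_X_ne_zero K hQ), mem_fixField]
  simp [sub_eq_zero]

/-- The inclusion of the vectors with coordinates in a subfield. -/
def inclVec (L : Subfield K) : (Fin 3 → L) →ₛₗ[algebraMap L K] (Fin 3 → K) where
  toFun v i := v i
  map_add' _ _ := rfl
  map_smul' _ _ := rfl

theorem inclVec_apply (L : Subfield K) (v : Fin 3 → L) (i : Fin 3) :
    inclVec K L v i = v i := rfl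

theorem inclVec_injective (L : Subfield K) : Function.Injective (inclVec K L) := fun v w h => by
  funext i
  exact Subtype.ext (congrFun h i)

/-- The inclusion of the plane over a subfield. -/
def incl (L : Subfield K) : ℙ L (Fin 3 → L) → ℙ K (Fin 3 → K) :=
  Projectivization.map (inclVec K L) (inclVec_injective K L)

theorem incl_orthogonal (L : Subfield K) (a b : ℙ L (Fin 3 → L)) :
    (incl K L a).orthogonal (incl K L b) ↔ a.orthogonal b := by
  induction a with | h v hv =>
  induction b with | h w hw =>
  rw [incl, Projectivization.map_mk, Projectivization.map_mk, Projectivization.orthogonal_mk,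
    Projectivization.orthogonal_mk]
  have : inclVec K L v ⬝ᵥ inclVec K L w = ((v ⬝ᵥ w : L) : K) := by
    simp [dotProduct, inclVec_apply]
  rw [this, ZeroMemClass.coe_eq_zero]

theorem incl_injective (L : Subfield K) : Function.Injective (incl K L) := by
  intro a b h
  induction a with | h v hv =>
  induction b with | h w hw =>
  rw [incl, Projectivization.map_mk, Projectivization.map_mk,
    Projectivization.mk_eq_mk_iff_crossProduct_eq_zero] at h
  rw [Projectivization.mk_eq_mk_iff_crossProduct_eq_zero]
  refine inclVec_injective K L ?_
  rw [map_zero, ← h]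
  funext i
  fin_cases i <;> simp [inclVec_apply, cross_apply]

/-- The points fixed by a power of the Frobenius are those with coordinates in its fixed field. -/
theorem frob_iterate_eq_iff (n : ℕ) (x : ℙ K (Fin 3 → K)) :
    (frob k K)^[n] x = x ↔ ∃ y, incl K (fixField k K n) y = x := by
  constructor
  · intro h
    induction x with | h v hv =>
    -- normalise a non-zero coordinate to `1`
    obtain ⟨i, hi⟩ : ∃ i, v i ≠ 0 := by
      by_contra! hcon
      exact hv (funext hcon)
    rw [frob_iterate_mk, Projectivization.mk_eq_mk_iff'] at h
    obtain ⟨c, hc⟩ := h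
    have hci : ∀ j, c * v j = v j ^ Fintype.card k ^ n := fun j => by
      rw [← frobVec_iterate, ← hc]
      rfl
    have hmem : ∀ j, (v i)⁻¹ * v j ∈ fixField k K n := by
      intro j
      have hc0 : c ≠ 0 := by
        rintro rfl
        have := hci i
        rw [zero_mul] at this
        exact hi (pow_eq_zero_iff (pow_ne_zero _ Fintype.card_ne_zero) |>.1 this.symm)
      rw [mem_fixField, mul_pow, inv_pow, ← hci, ← hci]
      field_simp
    refine ⟨Projectivization.mk _ (fun j => ⟨_, hmem j⟩) ?_, ?_⟩
    · intro h0
      have := congrArg Subtype.val (congrFun h0 i)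
      simp [hi] at this
    · rw [incl, Projectivization.map_mk, Projectivization.mk_eq_mk_iff']
      exact ⟨(v i)⁻¹, rfl⟩
  · rintro ⟨y, rfl⟩
    induction y with | h v hv =>
    rw [incl, Projectivization.map_mk, frob_iterate_mk]
    congr 1
    funext i
    rw [frobVec_iterate]
    exact (mem_fixField k K).1 (v i).2

theorem frob_iterate_orthogonal (n : ℕ) (a b : ℙ K (Fin 3 → K)) :
    ((frob k K)^[n] a).orthogonal ((frob k K)^[n] b) ↔ a.orthogonal b := by
  induction n generalizing a b with
  | zero => rfl
  | succ n ih => rw [Function.iterate_succ_apply, Function.iterate_succ_apply, ih, frob_orthogonal]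

/-- The order of the symmetric group on seven letters. -/
@[irreducible] def period : ℕ := 5040

theorem period_eq : period = 5040 := by rw [period]

theorem period_sub_one : period - 1 + 1 = period := by rw [period]

/-- The points of the plane over `K` that are defined over the extension of degree `period` of
`k`. They form a finite plane that contains every point of an arc with seven points. -/
def FinPlane : Type _ := {x : ℙ K (Fin 3 → K) // (frob k K)^[period] x = x}

variable {k K} in
theorem line_unique_orthogonal {a b l m : ℙ K (Fin 3 → K)} (h : a ≠ b) (al : a.orthogonal l)
    (bl : b.orthogonal l) (am : a.orthogonal m) (bm : b.orthogonal m) : l = m :=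
  (Configuration.ofField.eq_or_eq_of_orthogonal al bl am bm).resolve_left h

instance : PolarPlane (FinPlane k K) where
  Inc a b := a.1.orthogonal b.1
  symm := Projectivization.orthogonal_comm.1
  exists_line {a b} hab := by
    classical
    have hne : a.1 ≠ b.1 := Subtype.coe_injective.ne hab
    have h1 := Projectivization.orthogonal_cross_left hne
    have h2 := Projectivization.orthogonal_cross_right hne
    refine ⟨⟨Projectivization.cross a.1 b.1, line_unique_orthogonal hne ?_ ?_ h1 h2⟩, h1, h2⟩
    · have := (frob_iterate_orthogonal k K period _ _).2 h1
      rwa [a.2] at this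
    · have := (frob_iterate_orthogonal k K period _ _).2 h2
      rwa [b.2] at this
  eq_or_eq h1 h2 h3 h4 :=
    (Configuration.ofField.eq_or_eq_of_orthogonal h1 h2 h3 h4).imp Subtype.ext Subtype.ext

theorem inc_def (a b : FinPlane k K) : Inc a b ↔ a.1.orthogonal b.1 := Iff.rfl

/-- The Frobenius as a permutation of the points of the finite plane. -/
def frobPerm : Equiv.Perm (FinPlane k K) where
  toFun x := ⟨frob k K x.1, by
    rw [← Function.iterate_succ_apply, Function.iterate_succ_apply', x.2]⟩
  invFun x := ⟨(frob k K)^[period - 1] x.1, by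
    rw [← Function.iterate_add_apply, add_comm, Function.iterate_add_apply, x.2]⟩
  left_inv x := Subtype.ext (by
    show (frob k K)^[period - 1] (frob k K x.1) = x.1
    rw [← Function.iterate_succ_apply, Nat.succ_eq_add_one, period_sub_one, x.2])
  right_inv x := Subtype.ext (by
    show frob k K ((frob k K)^[period - 1] x.1) = x.1
    rw [← Function.iterate_succ_apply' (frob k K), Nat.succ_eq_add_one, period_sub_one, x.2])

theorem frobPerm_pow (n : ℕ) (x : FinPlane k K) :
    ((frobPerm k K ^ n) x).1 = (frob k K)^[n] x.1 := by
  induction n generalizing x with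
  | zero => rfl
  | succ n ih =>
    rw [pow_succ, Equiv.Perm.mul_apply, ih, Function.iterate_succ_apply]
    rfl

/-- The points over the extension of degree `n`, as points of the finite plane. -/
def toFinPlane {n : ℕ} (hn : n ∣ period) (y : ℙ (fixField k K n) (Fin 3 → fixField k K n)) :
    FinPlane k K :=
  ⟨incl K _ y, by
    obtain ⟨m, hm⟩ := hn
    rw [hm, Function.iterate_mul]
    exact Function.iterate_fixed ((frob_iterate_eq_iff k K n _).2 ⟨y, rfl⟩) m⟩

theorem toFinPlane_injective {n : ℕ} (hn : n ∣ period) :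
    Function.Injective (toFinPlane k K hn) := fun _ _ h =>
  incl_injective K _ (congrArg Subtype.val h)

theorem frobPerm_pow_eq_iff {n : ℕ} (hn : n ∣ period) (x : FinPlane k K) :
    (frobPerm k K ^ n) x = x ↔ ∃ y, toFinPlane k K hn y = x := by
  have e : (frobPerm k K ^ n) x = x ↔ (frob k K)^[n] x.1 = x.1 := by
    rw [← frobPerm_pow]
    exact Subtype.ext_iff
  rw [e, frob_iterate_eq_iff]
  exact exists_congr fun y => (Subtype.ext_iff (a1 := toFinPlane k K hn y)).symm

theorem cnt_of_injective {α β : Type*} [Fintype α] [Fintype β] {f : α → β}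
    (hf : Function.Injective f) {p : α → Prop} {r : β → Prop}
    (h : ∀ b, r b ↔ ∃ a, f a = b ∧ p a) : cnt r = cnt p := by
  symm
  refine (cnt_fiber f 1 (fun a ha => (h _).2 ⟨a, rfl, ha⟩) fun b hb => ?_).trans (mul_one _)
  obtain ⟨a, rfl, ha⟩ := (h b).1 hb
  refine cnt_eq_one a fun a' => ⟨fun h => hf h.2, ?_⟩
  rintro rfl
  exact ⟨ha, rfl⟩

variable [IsAlgClosed K]

theorem finite_fixField {n : ℕ} (hn : n ≠ 0) : Finite (fixField k K n) :=
  Nat.finite_of_card_ne_zero (by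
    rw [card_fixField k K hn]
    exact pow_ne_zero _ Fintype.card_ne_zero)

instance : Finite (FinPlane k K) := by
  have := finite_fixField k K (n := period) (by norm_num [period_eq])
  refine Finite.of_surjective (toFinPlane k K dvd_rfl) fun x => ?_
  exact (frobPerm_pow_eq_iff k K dvd_rfl x).1 (Subtype.ext ((frobPerm_pow k K _ x).trans x.2))

noncomputable instance : Fintype (FinPlane k K) := Fintype.ofFinite _

/-- The numbers of points of the plane over a finite field, and of its lines. -/
theorem card_plane (L : Type*) [Field L] [Finite L] :
    (Nat.card (ℙ L (Fin 3 → L)) : ℤ) = (Nat.card L : ℤ) ^ 2 + Nat.card L + 1 ∧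
    ∀ l : ℙ L (Fin 3 → L), (Nat.card {x : ℙ L (Fin 3 → L) // x.orthogonal l} : ℤ) =
      Nat.card L + 1 := by
  classical
  have : Fintype (ℙ L (Fin 3 → L)) := Fintype.ofFinite _
  have h := Projectivization.card_of_finrank L (Fin 3 → L) (n := 3) (by simp)
  rw [Finset.sum_range_succ, Finset.sum_range_succ, Finset.sum_range_one] at h
  have h' := Configuration.ProjectivePlane.card_points (ℙ L (Fin 3 → L)) (ℙ L (Fin 3 → L))
  rw [← Nat.card_eq_fintype_card, h] at h'
  refine ⟨by rw [h]; push_cast; ring, fun l => ?_⟩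
  -- the order is read off from the number of points
  have hl := Configuration.ProjectivePlane.pointCount_eq (P := ℙ L (Fin 3 → L)) l
  have : Configuration.ProjectivePlane.order (ℙ L (Fin 3 → L)) (ℙ L (Fin 3 → L)) = Nat.card L := by
    nlinarith
  rw [this] at hl
  exact_mod_cast hl

/-- The fixed points of `φ ^ n` form the plane over the field with `q ^ n` elements. -/
theorem isFrob_frobPerm {n : ℕ} (h1 : n ≠ 0) (hn : n ∣ period) :
    IsFrob (frobPerm k K ^ n) ((Fintype.card k : ℤ) ^ n) := by
  have := finite_fixField k K h1
  have hq : (Nat.card (fixField k K n) : ℤ) = (Fintype.card k : ℤ) ^ n := by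
    rw [card_fixField k K h1]
    push_cast
    rfl
  obtain ⟨hP, hL⟩ := card_plane (fixField k K n)
  have : Fintype (ℙ (fixField k K n) (Fin 3 → fixField k K n)) := Fintype.ofFinite _
  rw [hq] at hP hL
  refine ⟨?_, fun a b => ?_, ?_, fun l hl => ?_⟩
  · exact one_lt_pow₀ (by exact_mod_cast Fintype.one_lt_card) h1
  · rw [inc_def, inc_def, frobPerm_pow, frobPerm_pow, frob_iterate_orthogonal]
  · rw [← hP, cnt_of_injective (toFinPlane_injective k K hn) (p := fun _ => True) fun x => by
      simpa using frobPerm_pow_eq_iff k K hn x, cnt_eq_natCard]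
    simp
  · obtain ⟨m, rfl⟩ := (frobPerm_pow_eq_iff k K hn l).1 hl
    rw [← hL m, cnt_of_injective (toFinPlane_injective k K hn) (p := fun x => x.orthogonal m)
      fun x => ?_, cnt_eq_natCard]
    rw [frobPerm_pow_eq_iff k K hn]
    constructor
    · rintro ⟨⟨y, rfl⟩, hy⟩
      exact ⟨y, rfl, (incl_orthogonal K _ _ _).1 hy⟩
    · rintro ⟨y, rfl, hy⟩
      exact ⟨⟨y, rfl⟩, (incl_orthogonal K _ _ _).2 hy⟩

theorem isFrob_frobPerm_pow (n : ℕ) (h1 : 1 ≤ n) (h7 : n ≤ 7) :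
    IsFrob (frobPerm k K ^ n) ((Fintype.card k : ℤ) ^ n) :=
  isFrob_frobPerm k K (by omega) (by rw [period_eq]; interval_cases n <;> norm_num)

instance : Nontrivial (FinPlane k K) := by
  by_contra h
  rw [not_nontrivial_iff_subsingleton] at h
  have h1 := (isFrob_frobPerm_pow k K 1 le_rfl (by norm_num)).card_fix
  have h2 : cnt (fun x : FinPlane k K => (frobPerm k K ^ 1) x = x) ≤ 1 := by
    rw [cnt_eq_natCard]
    exact_mod_cast Finite.card_le_one_iff_subsingleton.2 inferInstance
  have := (isFrob_frobPerm_pow k K 1 le_rfl (by norm_num)).one_lt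
  nlinarith

end frobenius

/-! ### Coordinates with respect to a frame -/

section coordinates

open Matrix

variable {k K : Type*} [Field k] [Fintype k] [Field K] [Algebra k K] [IsAlgClosed K]

/-- `a` is the point with coordinate vector `x` in the basis formed by the rows of `U`. -/
def Coords (U : Matrix (Fin 3) (Fin 3) K) (a : FinPlane k K) (x : Fin 3 → K) : Prop :=
  ∃ h, a.1 = Projectivization.mk K (x ᵥ* U) h

theorem exists_coords {U : Matrix (Fin 3) (Fin 3) K} (hU : U.det ≠ 0) (a : FinPlane k K) :
    ∃ x, Coords U a x := by
  obtain ⟨a, ha⟩ := a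
  induction a with | h v hv =>
  have e : (v ᵥ* U⁻¹) ᵥ* U = v := by
    rw [vecMul_vecMul, nonsing_inv_mul _ (isUnit_iff_ne_zero.2 hU), vecMul_one]
  exact ⟨v ᵥ* U⁻¹, by rwa [e], by simp only [e]⟩

theorem Coords.eq_of_smul {U : Matrix (Fin 3) (Fin 3) K} {a b : FinPlane k K} {x y : Fin 3 → K}
    (ha : Coords U a x) (hb : Coords U b y) (c : K) (h : x = c • y) : a = b := by
  obtain ⟨h1, ha⟩ := ha
  obtain ⟨h2, hb⟩ := hb
  refine Subtype.ext ?_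
  rw [ha, hb, Projectivization.mk_eq_mk_iff']
  exact ⟨c, by rw [h, smul_vecMul]⟩

theorem coll_iff_det {a b c : FinPlane k K} {u v w : Fin 3 → K} (hu : u ≠ 0) (hv : v ≠ 0)
    (hw : w ≠ 0) (ha : a.1 = Projectivization.mk K u hu) (hb : b.1 = Projectivization.mk K v hv)
    (hc : c.1 = Projectivization.mk K w hw) : Coll a b c ↔ (of ![u, v, w]).det = 0 := by
  rw [← exists_mulVec_eq_zero_iff]
  have key : ∀ l : Fin 3 → K, of ![u, v, w] *ᵥ l = 0 ↔ u ⬝ᵥ l = 0 ∧ v ⬝ᵥ l = 0 ∧ w ⬝ᵥ l = 0 := by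
    intro l
    rw [funext_iff]
    simp [Fin.forall_fin_succ, mulVec]
  constructor
  · rintro ⟨⟨l, hl⟩, h1, h2, h3⟩
    induction l with | h l hl0 =>
    change a.1.orthogonal _ at h1
    change b.1.orthogonal _ at h2
    change c.1.orthogonal _ at h3
    rw [ha, Projectivization.orthogonal_mk] at h1
    rw [hb, Projectivization.orthogonal_mk] at h2
    rw [hc, Projectivization.orthogonal_mk] at h3
    exact ⟨l, hl0, (key l).2 ⟨h1, h2, h3⟩⟩
  · rintro ⟨l, hl0, hl⟩
    obtain ⟨h1, h2, h3⟩ := (key l).1 hl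
    by_cases hab : a = b
    · rw [hab]
      exact coll_self_left _ _
    · have e : (join a b).1 = Projectivization.mk K l hl0 := by
        refine line_unique_orthogonal (Subtype.coe_injective.ne hab) (inc_join_left hab)
          (inc_join_right hab) ?_ ?_
        · rwa [ha, Projectivization.orthogonal_mk]
        · rwa [hb, Projectivization.orthogonal_mk]
      rw [coll_iff hab, inc_def, e, hc, Projectivization.orthogonal_mk]
      exact h3

theorem Coords.coll_iff {U : Matrix (Fin 3) (Fin 3) K} (hU : U.det ≠ 0) {a b c : FinPlane k K}
    {x y z : Fin 3 → K} (ha : Coords U a x) (hb : Coords U b y) (hc : Coords U c z) :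
    Coll a b c ↔ x 0 * y 1 * z 2 - x 0 * y 2 * z 1 - x 1 * y 0 * z 2 + x 1 * y 2 * z 0
      + x 2 * y 0 * z 1 - x 2 * y 1 * z 0 = 0 := by
  obtain ⟨h1, ha⟩ := ha
  obtain ⟨h2, hb⟩ := hb
  obtain ⟨h3, hc⟩ := hc
  have e : of ![x ᵥ* U, y ᵥ* U, z ᵥ* U] = of ![x, y, z] * U := by
    ext i j
    fin_cases i <;> rfl
  rw [coll_iff_det h1 h2 h3 ha hb hc, e, det_mul, mul_eq_zero, or_iff_left hU, det_fin_three]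
  rfl

/-- Coordinates in which a frame is the standard one. -/
theorem exists_frame_coords {A : Fin 4 → FinPlane k K}
    (hA : ∀ i j l, i < j → j < l → ¬ Coll (A i) (A j) (A l)) :
    ∃ U : Matrix (Fin 3) (Fin 3) K, U.det ≠ 0 ∧ Coords U (A 0) ![1, 0, 0] ∧
      Coords U (A 1) ![0, 1, 0] ∧ Coords U (A 2) ![0, 0, 1] ∧ Coords U (A 3) ![1, 1, 1] := by
  have hr : ∀ i, ∃ v, ∃ h : v ≠ 0, (A i).1 = Projectivization.mk K v h := fun i =>
    ⟨(A i).1.rep, (A i).1.rep_nonzero, ((A i).1.mk_rep).symm⟩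
  choose v hv hA' using hr
  set V : Matrix (Fin 3) (Fin 3) K := of ![v 0, v 1, v 2] with hVdef
  have hV : V.det ≠ 0 := by
    rw [hVdef, Ne, ← coll_iff_det (hv 0) (hv 1) (hv 2) (hA' 0) (hA' 1) (hA' 2)]
    exact hA 0 1 2 (by decide) (by decide)
  have row : ∀ x : Fin 3 → K, x ᵥ* V = x 0 • v 0 + x 1 • v 1 + x 2 • v 2 := by
    intro x
    funext j
    simp [vecMul, dotProduct, Fin.sum_univ_three, V]
  have c0 : Coords V (A 0) ![1, 0, 0] := by
    have : ![1, 0, 0] ᵥ* V = v 0 := by rw [row]; simp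
    exact ⟨by rw [this]; exact hv 0, by simp only [this]; exact hA' 0⟩
  have c1 : Coords V (A 1) ![0, 1, 0] := by
    have : ![0, 1, 0] ᵥ* V = v 1 := by rw [row]; simp
    exact ⟨by rw [this]; exact hv 1, by simp only [this]; exact hA' 1⟩
  have c2 : Coords V (A 2) ![0, 0, 1] := by
    have : ![0, 0, 1] ᵥ* V = v 2 := by rw [row]; simp
    exact ⟨by rw [this]; exact hv 2, by simp only [this]; exact hA' 2⟩
  obtain ⟨x, c3⟩ := exists_coords hV (A 3)
  have n0 := hA 1 2 3 (by decide) (by decide)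
  have n1 := hA 0 2 3 (by decide) (by decide)
  have n2 := hA 0 1 3 (by decide) (by decide)
  rw [c1.coll_iff hV c2 c3] at n0
  rw [c0.coll_iff hV c2 c3] at n1
  rw [c0.coll_iff hV c1 c3] at n2
  simp at n0 n1 n2
  -- rescale the basis, so that the coordinates of the last point become `1`
  have row' : ∀ y : Fin 3 → K, y ᵥ* (diagonal x * V) = (fun i => y i * x i) ᵥ* V := by
    intro y
    rw [← vecMul_vecMul]
    congr 1
    funext i
    rw [vecMul_diagonal]
  have hc : ∀ (a : FinPlane k K) (y z : Fin 3 → K) (c : K), Coords V a z → c ≠ 0 →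
      (fun i => y i * x i) = c • z → Coords (diagonal x * V) a y := by
    rintro a y z c ⟨h, ha⟩ hc0 e
    have e' : y ᵥ* (diagonal x * V) = c • (z ᵥ* V) := by rw [row', e, smul_vecMul]
    refine ⟨by rw [e']; exact smul_ne_zero hc0 h, ?_⟩
    rw [ha, Projectivization.mk_eq_mk_iff']
    refine ⟨c⁻¹, ?_⟩
    rw [e', smul_smul, inv_mul_cancel₀ hc0, one_smul]
  refine ⟨diagonal x * V, ?_, hc _ _ _ (x 0) c0 n0 ?_, hc _ _ _ (x 1) c1 n1 ?_,
    hc _ _ _ (x 2) c2 n2 ?_, hc _ _ _ 1 c3 one_ne_zero ?_⟩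
  · rw [det_mul, det_diagonal, Fin.prod_univ_three]
    exact mul_ne_zero (mul_ne_zero (mul_ne_zero n0 n1) n2) hV
  all_goals
    funext i
    fin_cases i <;> simp

variable (k K) in
theorem two_eq_zero_iff : (2 : K) = 0 ↔ Even (Fintype.card k) := by
  obtain ⟨p, hp⟩ := CharP.exists k
  have hK : CharP K p := charP_of_injective_algebraMap (algebraMap k K).injective p
  obtain ⟨m, hm, e⟩ := FiniteField.card k p
  have h := CharP.cast_eq_zero_iff K p 2
  push_cast at h
  rw [h, e, Nat.even_pow, Nat.prime_dvd_prime_iff_eq hm Nat.prime_two, hm.even_iff]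
  simp [m.ne_zero]

variable (k K) in
theorem frobVec_iterate_add (n : ℕ) (v w : Fin 3 → K) :
    (frobVec k K)^[n] (v + w) = (frobVec k K)^[n] v + (frobVec k K)^[n] w := by
  induction n generalizing v w with
  | zero => rfl
  | succ n ih => simp only [Function.iterate_succ_apply, map_add, ih]

theorem Coords.frob_eq {U : Matrix (Fin 3) (Fin 3) K} {a : FinPlane k K} {x : Fin 3 → K}
    (h : Coords U a x) : ∃ c : K, (frobVec k K)^[period] (x ᵥ* U) = c • (x ᵥ* U) := by
  obtain ⟨h1, ha⟩ := h
  have := a.2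
  rw [ha, frob_iterate_mk, Projectivization.mk_eq_mk_iff'] at this
  obtain ⟨c, hc⟩ := this
  exact ⟨c, hc.symm⟩

/-- The points with coordinates `0`, `1`, `-1` in a basis adapted to a frame are defined over
the same field as the frame: the Frobenius acts on such a basis by a common scalar. -/
theorem exists_of_coords {A : Fin 4 → FinPlane k K} {U : Matrix (Fin 3) (Fin 3) K}
    (hU : U.det ≠ 0) (h0 : Coords U (A 0) ![1, 0, 0]) (h1 : Coords U (A 1) ![0, 1, 0])
    (h2 : Coords U (A 2) ![0, 0, 1]) (h3 : Coords U (A 3) ![1, 1, 1]) {x : Fin 3 → K}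
    (hx : x ≠ 0) (hx' : ∀ i, x i = 0 ∨ x i = 1 ∨ x i = -1) : ∃ a : FinPlane k K, Coords U a x := by
  have row : ∀ x : Fin 3 → K, x ᵥ* U = x 0 • U 0 + x 1 • U 1 + x 2 • U 2 := by
    intro x
    funext j
    simp [vecMul, dotProduct, Fin.sum_univ_three]
  have inj : ∀ x y : Fin 3 → K, x ᵥ* U = y ᵥ* U → x = y := by
    intro x y h
    have := congrArg (· ᵥ* U⁻¹) h
    simpa [vecMul_vecMul, mul_nonsing_inv _ (isUnit_iff_ne_zero.2 hU)] using this
  obtain ⟨c0, e0⟩ := h0.frob_eq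
  obtain ⟨c1, e1⟩ := h1.frob_eq
  obtain ⟨c2, e2⟩ := h2.frob_eq
  obtain ⟨c, e3⟩ := h3.frob_eq
  rw [row] at e0 e1 e2
  simp only [cons_val_zero, cons_val_one, cons_val, one_smul, zero_smul, add_zero, zero_add]
    at e0 e1 e2
  have e : ![c0, c1, c2] = ![c, c, c] := by
    refine inj _ _ ?_
    have : ![1, 1, 1] ᵥ* U = U 0 + U 1 + U 2 := by rw [row]; simp
    rw [this, frobVec_iterate_add, frobVec_iterate_add, e0, e1, e2] at e3
    rw [row, row]
    simpa [smul_add] using e3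
  have hc0 : c0 = c := congrFun e 0
  have hc1 : c1 = c := congrFun e 1
  have hc2 : c2 = c := congrFun e 2
  rw [hc0] at e0
  rw [hc1] at e1
  rw [hc2] at e2
  have hsmul : ∀ (d : K) (v : Fin 3 → K), (d = 0 ∨ d = 1 ∨ d = -1) →
      (frobVec k K)^[period] (d • v) = d • (frobVec k K)^[period] v := by
    have z : (frobVec k K)^[period] 0 = 0 := Function.iterate_fixed (map_zero (frobVec k K)) _
    rintro d v (rfl | rfl | rfl)
    · rw [zero_smul, zero_smul, z]
    · rw [one_smul, one_smul]
    · rw [neg_one_smul, neg_one_smul, eq_neg_iff_add_eq_zero, ← frobVec_iterate_add,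
        neg_add_cancel, z]
  have hne : x ᵥ* U ≠ 0 := fun h => hx (inj _ _ (h.trans (zero_vecMul U).symm))
  refine ⟨⟨Projectivization.mk K _ hne, ?_⟩, hne, rfl⟩
  rw [frob_iterate_mk, Projectivization.mk_eq_mk_iff']
  refine ⟨c, ?_⟩
  rw [row, frobVec_iterate_add, frobVec_iterate_add, hsmul _ _ (hx' 0), hsmul _ _ (hx' 1),
    hsmul _ _ (hx' 2), e0, e1, e2]
  simp only [smul_add, smul_smul, mul_comm]

end coordinates

/-! ### Diagonal points and circumscribed triangles in coordinates -/

section configurations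

open Matrix

variable (k K : Type*) [Field k] [Fintype k] [Field K] [Algebra k K] [IsAlgClosed K]

/-- In coordinates adapted to the frame the diagonal points are `(1 : 1 : 0)`, `(1 : 0 : 1)` and `(0
: 1 : 1)`, whose determinant is `-2`. -/
theorem fanoIff_finPlane : FanoIff (FinPlane k K) (Even (Fintype.card k)) := by
  intro A hA
  have hT : Tw (Equiv.refl _) id A := ⟨fun _ => rfl, hA⟩
  obtain ⟨U, hU, h0, h1, h2, h3⟩ := exists_frame_coords hA
  have inj := hT.injective (by norm_num)
  have hd : ∀ (i j l m : Fin 4) (d : FinPlane k K), ((i, j), (l, m)) ∈ edgePairs 4 →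
      Coll (A i) (A j) d → Coll (A l) (A m) d → d = diag A ((i, j), (l, m)) := by
    intro i j l m d hp c1 c2
    have hp' := mem_edgePairs hp
    refine (hT.eq_diag_iff (by norm_num) hp d).1 ⟨?_, ?_⟩
    · exact (coll_iff (inj.ne hp'.1.ne)).1 c1
    · exact (coll_iff (inj.ne hp'.2.1.ne)).1 c2
  obtain ⟨d0, c0⟩ := exists_of_coords hU h0 h1 h2 h3 (x := ![1, 1, 0])
    (fun h => one_ne_zero (congrFun h 0)) (by intro i; fin_cases i <;> simp)
  obtain ⟨d1, c1⟩ := exists_of_coords hU h0 h1 h2 h3 (x := ![1, 0, 1])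
    (fun h => one_ne_zero (congrFun h 0)) (by intro i; fin_cases i <;> simp)
  obtain ⟨d2, c2⟩ := exists_of_coords hU h0 h1 h2 h3 (x := ![0, 1, 1])
    (fun h => one_ne_zero (congrFun h 1)) (by intro i; fin_cases i <;> simp)
  have e0 : d0 = diag₀ A := by
    refine hd 0 1 2 3 d0 (by decide) ?_ ?_
    · rw [h0.coll_iff hU h1 c0]; simp
    · rw [h2.coll_iff hU h3 c0]; simp
  have e1 : d1 = diag₁ A := by
    refine hd 0 2 1 3 d1 (by decide) ?_ ?_
    · rw [h0.coll_iff hU h2 c1]; simp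
    · rw [h1.coll_iff hU h3 c1]; simp
  have e2 : d2 = diag₂ A := by
    refine hd 0 3 1 2 d2 (by decide) ?_ ?_
    · rw [h0.coll_iff hU h3 c2]; simp
    · rw [h1.coll_iff hU h2 c2]; simp
  rw [← e0, ← e1, ← e2, c0.coll_iff hU c1 c2, ← two_eq_zero_iff k K, ← neg_eq_zero (a := (2 : K))]
  have : (-2 : K) = -1 - 1 := by ring
  simp [this]

variable {k K} in
/-- In coordinates adapted to the frame, the vertices of a circumscribed triangle are
`(1 : -1 : 1)`, `(1 : 1 : -1)` and `(1 : -1 : -1)`, and `2 ≠ 0`. -/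
theorem Circum.coords {A : Fin 4 → FinPlane k K} {U : Matrix (Fin 3) (Fin 3) K}
    (hU : U.det ≠ 0) (h0 : Coords U (A 0) ![1, 0, 0]) (h1 : Coords U (A 1) ![0, 1, 0])
    (h2 : Coords U (A 2) ![0, 0, 1]) (h3 : Coords U (A 3) ![1, 1, 1]) {x y z : FinPlane k K}
    (h : Circum A x y z) : (2 : K) ≠ 0 ∧ (∃ c, Coords U x ![c, -c, c]) ∧
      (∃ c, Coords U y ![c, c, -c]) ∧ ∃ c, Coords U z ![c, -c, -c] := by
  obtain ⟨⟨hx, hy, hz⟩, ⟨hxy, hyz, hzx⟩, x3, y3, z3⟩ := h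
  obtain ⟨u, cx⟩ := exists_coords hU x
  obtain ⟨v, cy⟩ := exists_coords hU y
  obtain ⟨w, cz⟩ := exists_coords hU z
  rw [h1.coll_iff hU h3 cx] at hx
  rw [h2.coll_iff hU h3 cy] at hy
  rw [h0.coll_iff hU h3 cz] at hz
  rw [h0.coll_iff hU cx cy] at hxy
  rw [h1.coll_iff hU cy cz] at hyz
  rw [h2.coll_iff hU cz cx] at hzx
  have hu : u = ![u 0, u 1, u 0] := by
    funext i
    fin_cases i
    · rfl
    · rfl
    · simp at hx ⊢
      linear_combination -hx
  have hv : v = ![v 0, v 0, v 2] := by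
    funext i
    fin_cases i
    · rfl
    · simp at hy ⊢
      linear_combination hy
    · rfl
  have hw : w = ![w 0, w 2, w 2] := by
    funext i
    fin_cases i
    · rfl
    · simp at hz ⊢
      linear_combination -hz
    · rfl
  have hone : ∀ c : K, ![c, c, c] = c • ![(1 : K), 1, 1] := fun c => by simp
  rw [hu] at cx hxy hzx
  rw [hv] at cy hxy hyz
  rw [hw] at cz hyz hzx
  generalize u 0 = a at *
  generalize u 1 = b at *
  generalize v 0 = c at *
  generalize v 2 = d at *
  generalize w 0 = e at *
  generalize w 2 = f at *
  simp at hxy hyz hzx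
  have nx : a ≠ b := by
    rintro rfl
    exact x3 (cx.eq_of_smul h3 _ (hone _))
  have ny : c ≠ d := by
    rintro rfl
    exact y3 (cy.eq_of_smul h3 _ (hone _))
  have nz : e ≠ f := by
    rintro rfl
    exact z3 (cz.eq_of_smul h3 _ (hone _))
  have ha : a ≠ 0 := by
    rintro rfl
    have hd : d = 0 := (mul_eq_zero.1 (by linear_combination hxy : b * d = 0)).resolve_left nx.symm
    have he : e = 0 := (mul_eq_zero.1 (by linear_combination hzx : b * e = 0)).resolve_left nx.symm
    subst hd he
    exact mul_ne_zero ny nz.symm (by linear_combination -hyz)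
  have h4 : f * d = e * c := mul_left_cancel₀ ha (by linear_combination e * hxy - d * hzx)
  have he : e = -f := mul_left_cancel₀ (sub_ne_zero.2 ny)
    (by linear_combination -h4 - hyz)
  have hf : f ≠ 0 := by
    rintro rfl
    exact nz (by rw [he, neg_zero])
  have hd : d = -c := mul_left_cancel₀ hf (by linear_combination -hyz + d * he)
  have hc : c ≠ 0 := by
    rintro rfl
    exact ny (by rw [hd, neg_zero])
  have hb : b = -a := mul_left_cancel₀ hc (by linear_combination -hxy + b * hd)
  subst hd he hb
  exact ⟨fun h2 => nx (by linear_combination a * h2), ⟨_, cx⟩, ⟨_, cy⟩, -f, by rwa [neg_neg]⟩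

/-- By `Circum.coords` the triangle is unique, and the points named there do form one if `2 ≠ 0`. -/
theorem circumIff_finPlane : CircumIff (FinPlane k K) (Even (Fintype.card k)) := by
  intro A hA
  obtain ⟨U, hU, h0, h1, h2, h3⟩ := exists_frame_coords hA
  rw [← two_eq_zero_iff k K]
  refine ⟨fun h x y z hc => (hc.coords hU h0 h1 h2 h3).1 h, fun h => ?_⟩
  -- the triangle of `Circum.coords`
  obtain ⟨x, cx⟩ := exists_of_coords hU h0 h1 h2 h3 (x := ![1, -1, 1])
    (fun h => one_ne_zero (congrFun h 0)) (by intro i; fin_cases i <;> simp)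
  obtain ⟨y, cy⟩ := exists_of_coords hU h0 h1 h2 h3 (x := ![1, 1, -1])
    (fun h => one_ne_zero (congrFun h 0)) (by intro i; fin_cases i <;> simp)
  obtain ⟨z, cz⟩ := exists_of_coords hU h0 h1 h2 h3 (x := ![1, -1, -1])
    (fun h => one_ne_zero (congrFun h 0)) (by intro i; fin_cases i <;> simp)
  refine ⟨x, y, z, ⟨⟨?_, ?_, ?_⟩, ⟨?_, ?_, ?_⟩, ?_, ?_, ?_⟩, fun x' y' z' hc => ?_⟩
  · rw [h1.coll_iff hU h3 cx]; simp
  · rw [h2.coll_iff hU h3 cy]; simp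
  · rw [h0.coll_iff hU h3 cz]; simp
  · rw [h0.coll_iff hU cx cy]; simp
  · rw [h1.coll_iff hU cy cz]; simp
  · rw [h2.coll_iff hU cz cx]; simp
  · intro e
    have := (h0.coll_iff hU h3 cx).1 (e ▸ (coll_self_left _ _).swap₂₃.swap₁₂)
    simp at this
    exact h (by linear_combination this)
  · intro e
    have := (h0.coll_iff hU h3 cy).1 (e ▸ (coll_self_left _ _).swap₂₃.swap₁₂)
    simp at this
    exact h (by linear_combination -this)
  · intro e
    have := (h1.coll_iff hU h3 cz).1 (e ▸ (coll_self_left _ _).swap₂₃.swap₁₂)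
    simp at this
    exact h (by linear_combination this)
  · obtain ⟨-, ⟨a, ca⟩, ⟨b, cb⟩, c, cc⟩ := hc.coords hU h0 h1 h2 h3
    exact ⟨ca.eq_of_smul cx a (by simp), cb.eq_of_smul cy b (by simp), cc.eq_of_smul cz c (by simp)⟩

end configurations

/-! ### Conjugate Fano planes in characteristic two -/

section conjugateFano

open Matrix

variable {k K : Type*} [Field k] [Fintype k] [Field K] [Algebra k K] [IsAlgClosed K]

/-- Collinearity as linear dependence of representatives. -/
theorem coll_iff_exists {a b c : FinPlane k K} {u v w : Fin 3 → K} (hu : u ≠ 0) (hv : v ≠ 0)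
    (hw : w ≠ 0) (ha : a.1 = Projectivization.mk K u hu) (hb : b.1 = Projectivization.mk K v hv)
    (hc : c.1 = Projectivization.mk K w hw) :
    Coll a b c ↔ ∃ r : Fin 3 → K, r ≠ 0 ∧ ∀ i, r 0 * u i + r 1 * v i + r 2 * w i = 0 := by
  rw [coll_iff_det hu hv hw ha hb hc, ← exists_vecMul_eq_zero_iff]
  refine exists_congr fun r => and_congr_right fun _ => ?_
  rw [funext_iff]
  refine forall_congr' fun i => ?_
  simp [vecMul, dotProduct, Fin.sum_univ_three]

theorem exists_algebraMap_eq {c : K} (hc : c ^ Fintype.card k = c) : ∃ a, algebraMap k K a = c := by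
  have hmem : ∀ a, algebraMap k K a ∈ fixField k K 1 := fun a => by
    rw [mem_fixField, pow_one, ← map_pow, FiniteField.pow_card]
  have hf := finite_fixField k K one_ne_zero
  have hb : Function.Bijective fun a : k => (⟨_, hmem a⟩ : fixField k K 1) := by
    refine Function.Injective.bijective_of_nat_card_le
      (fun a b h => (algebraMap k K).injective (congrArg Subtype.val h)) ?_
    rw [card_fixField k K one_ne_zero, pow_one, Nat.card_eq_fintype_card]
  obtain ⟨a, ha⟩ := hb.2 ⟨c, by rwa [mem_fixField, pow_one]⟩
  exact ⟨a, congrArg Subtype.val ha⟩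

/-- A point lies on no line defined over `k` exactly if its coordinates are linearly independent
over `k`. -/
theorem no_line_iff_linearIndependent {x : FinPlane k K} {v : Fin 3 → K} (hv : v ≠ 0)
    (hx : x.1 = Projectivization.mk K v hv) :
    (∀ l, frobPerm k K l = l → ¬ Inc x l) ↔ LinearIndependent k v := by
  rw [Fintype.linearIndependent_iff]
  have hsum : ∀ g : Fin 3 → k, ∑ i, g i • v i = v ⬝ᵥ fun i => algebraMap k K (g i) := fun g =>
    Finset.sum_congr rfl fun i _ => by rw [Algebra.smul_def, mul_comm]
  constructor
  · intro h g hg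
    by_contra! hne
    have hm : (fun i => algebraMap k K (g i)) ≠ 0 := by
      intro h0
      obtain ⟨i, hi⟩ := hne
      exact hi ((map_eq_zero (algebraMap k K)).1 (congrFun h0 i))
    have hfix : frob k K (Projectivization.mk K _ hm) = Projectivization.mk K _ hm := by
      rw [frob, Projectivization.map_mk]
      congr 1
      funext i
      change algebraMap k K (g i) ^ Fintype.card k = _
      rw [← map_pow, FiniteField.pow_card]
    refine h ⟨Projectivization.mk K _ hm, Function.iterate_fixed hfix _⟩ (Subtype.ext hfix) ?_
    change x.1.orthogonal _
    rw [hx, Projectivization.orthogonal_mk, ← hsum, hg]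
  · rintro h ⟨l, hl⟩ hfix hxl
    have hfix' : (frob k K)^[1] l = l := congrArg Subtype.val hfix
    obtain ⟨m, hml⟩ := (frob_iterate_eq_iff k K 1 l).1 hfix'
    have hxl : x.1.orthogonal l := hxl
    rw [← hml] at hxl
    induction m with | h m hm =>
    rw [incl, Projectivization.map_mk, hx, Projectivization.orthogonal_mk] at hxl
    have hmi : ∀ i, ∃ a, algebraMap k K a = m i := fun i =>
      exists_algebraMap_eq (by simpa using (mem_fixField k K).1 (m i).2)
    choose g hg using hmi
    have := h g (by
      rw [hsum, ← hxl]
      congr 1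
      exact funext hg)
    refine hm (funext fun i => Subtype.ext ?_)
    rw [← hg, this i, map_zero]
    rfl

variable (k K) in
/-- The kernel of `φ ^ 3 + φ + 1`, for the Frobenius `φ` of `K` over `k`. -/
def sevenKer : Submodule k K where
  carrier := {w | FiniteField.frobeniusAlgHom k K (FiniteField.frobeniusAlgHom k K
    (FiniteField.frobeniusAlgHom k K w)) + FiniteField.frobeniusAlgHom k K w + w = 0}
  zero_mem' := by simp
  add_mem' {a b} ha hb := by
    simp only [Set.mem_ofPred_eq, map_add] at *
    linear_combination ha + hb
  smul_mem' c a ha := by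
    simp only [Set.mem_ofPred_eq, map_smul] at *
    rw [← smul_add, ← smul_add, ha, smul_zero]

theorem mem_sevenKer {w : K} : w ∈ sevenKer k K ↔ FiniteField.frobeniusAlgHom k K
    (FiniteField.frobeniusAlgHom k K (FiniteField.frobeniusAlgHom k K w)) +
      FiniteField.frobeniusAlgHom k K w + w = 0 := Iff.rfl

/-- In characteristic two, `X ^ 3 + X + 1` divides `X ^ 7 - 1`. -/
theorem frob_seven_of_mem_sevenKer (h2 : (2 : K) = 0) {w : K} (hw : w ∈ sevenKer k K) :
    w ^ Fintype.card k ^ 7 = w := by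
  rw [mem_sevenKer] at hw
  have e : w ^ Fintype.card k ^ 7 = (FiniteField.frobeniusAlgHom k K)^[7] w := by
    rw [FiniteField.coe_frobeniusAlgHom, pow_iterate]
  rw [e]
  generalize FiniteField.frobeniusAlgHom k K = φ at hw
  have h3 : φ (φ (φ w)) = φ w + w := by linear_combination hw - (φ w + w) * h2
  simp only [Function.iterate_succ_apply, Function.iterate_zero_apply, h3, map_add]
  linear_combination (φ (φ w) + φ w) * h2

/-- The elements are the roots of the separable polynomial `X ^ (q ^ 3) + X ^ q + X`. -/
theorem card_sevenKer (h2 : (2 : K) = 0) : Nat.card (sevenKer k K) = Fintype.card k ^ 3 := by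
  have hq : 1 < Fintype.card k := Fintype.one_lt_card
  have hq0 : (Fintype.card k : K) = 0 := by
    obtain ⟨m, hm⟩ := (two_eq_zero_iff k K).1 h2
    rw [hm]
    push_cast
    linear_combination (m : K) * h2
  open Polynomial in
  set P : K[X] := X ^ (Fintype.card k ^ 3) + (X ^ Fintype.card k + X) with hP
  have hlt : Fintype.card k < Fintype.card k ^ 3 := lt_self_pow₀ hq (by norm_num)
  have hd2 : (Polynomial.X ^ Fintype.card k + Polynomial.X : Polynomial K).natDegree =
      Fintype.card k := by
    rw [Polynomial.natDegree_add_eq_left_of_natDegree_lt, Polynomial.natDegree_X_pow]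
    rwa [Polynomial.natDegree_X_pow, Polynomial.natDegree_X]
  have hdeg : P.natDegree = Fintype.card k ^ 3 := by
    rw [hP, Polynomial.natDegree_add_eq_left_of_natDegree_lt, Polynomial.natDegree_X_pow]
    rwa [Polynomial.natDegree_X_pow, hd2]
  have hP0 : P ≠ 0 := by
    intro h
    rw [h, Polynomial.natDegree_zero] at hdeg
    exact absurd hdeg.symm (pow_ne_zero _ Fintype.card_ne_zero)
  -- the derivative is `1`, as `q = 0` in `K`
  have hder : Polynomial.derivative P = 1 := by
    rw [hP]
    simp [Polynomial.derivative_X_pow, hq0]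
  have hsep : P.Separable := by
    rw [Polynomial.separable_def, hder]
    exact isCoprime_one_right
  have hc := Polynomial.card_rootSet_eq_natDegree (K := K) hsep (IsAlgClosed.splits _)
  rw [hdeg] at hc
  rw [← hc, ← Nat.card_eq_fintype_card]
  refine Nat.card_congr (Equiv.subtypeEquivRight fun w => ?_)
  rw [Polynomial.mem_rootSet_of_ne hP0, mem_sevenKer]
  simp only [FiniteField.coe_frobeniusAlgHom, hP, map_add, map_pow, Polynomial.aeval_X, ← pow_mul]
  ring_nf

theorem finite_sevenKer (h2 : (2 : K) = 0) : Finite (sevenKer k K) :=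
  Nat.finite_of_card_ne_zero (by
    rw [card_sevenKer h2]
    exact pow_ne_zero _ Fintype.card_ne_zero)

theorem finrank_sevenKer (h2 : (2 : K) = 0) : Module.finrank k (sevenKer k K) = 3 := by
  have := finite_sevenKer (k := k) h2
  have h := Module.natCard_eq_pow_finrank (K := k) (V := sevenKer k K)
  rw [card_sevenKer h2, Nat.card_eq_fintype_card] at h
  exact (Nat.pow_right_injective Fintype.one_lt_card h).symm

/-- Bases of a three-dimensional space correspond to the elements of `GL₃`. -/
theorem card_bases_sevenKer (h2 : (2 : K) = 0) :
    (Nat.card {v : Fin 3 → sevenKer k K // LinearIndependent k v} : ℤ) =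
      pglCard (Fintype.card k) * ((Fintype.card k : ℤ) - 1) := by
  have := finite_sevenKer (k := k) h2
  have h3 := finrank_sevenKer (k := k) h2
  have hle : ∀ i ≤ 3, Fintype.card k ^ i ≤ Fintype.card k ^ 3 := fun i hi =>
    Nat.pow_le_pow_right Fintype.card_pos hi
  rw [card_linearIndependent (by rw [h3]), h3, Fin.prod_univ_three]
  simp only [Fin.val_zero, Fin.val_one, Fin.val_two]
  push_cast [hle 0 (by norm_num), hle 1 (by norm_num), hle 2 (by norm_num)]
  rw [pglCard]
  ring

end conjugateFano

section conjugateFano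

open Matrix

variable {k K : Type*} [Field k] [Fintype k] [Field K] [Algebra k K] [IsAlgClosed K]

theorem frobPerm_mk {x : FinPlane k K} {v : Fin 3 → K} {hv : v ≠ 0}
    (hx : x.1 = Projectivization.mk K v hv) :
    ∃ h, (frobPerm k K x).1 =
      Projectivization.mk K (fun i => FiniteField.frobeniusAlgHom k K (v i)) h := by
  refine ⟨fun h => hv (frobVec_injective k K (h.trans (map_zero (frobVec k K)).symm)), ?_⟩
  change frob k K x.1 = _
  rw [hx]
  rfl

/-- A point `x` on no `k`-rational line with `φ ^ 7 x = x`, such that `x`, `φ x`, `φ ^ 3 x` are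
collinear, has a representative with coordinates in `sevenKer k K`. -/
theorem exists_sevenKer_rep (h2 : (2 : K) = 0) {x : FinPlane k K}
    (hx : Gen (frobPerm k K) (frobPerm k K ^ 7) x)
    (hc : Coll x (frobPerm k K x) (frobPerm k K (frobPerm k K (frobPerm k K x)))) :
    ∃ (v : Fin 3 → K) (h : v ≠ 0), (∀ i, v i ∈ sevenKer k K) ∧ x.1 = Projectivization.mk K v h := by
  have hF := isFrob_frobPerm_pow k K
  have h1 : IsFrob (frobPerm k K) (Fintype.card k : ℤ) := by simpa using hF 1 le_rfl (by norm_num)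
  have hn := (seven_progressions hF hx).1
  have hne := (not_coll_ne (seven_progressions hF hx).2.2).1
  have hn' := hn
  rw [← map_coll h1] at hn'
  have h7 : ((frobPerm k K ^ 7) x) = x := hx.1
  obtain ⟨v, hv, hxv⟩ : ∃ v, ∃ h : v ≠ 0, x.1 = Projectivization.mk K v h :=
    ⟨x.1.rep, x.1.rep_nonzero, x.1.mk_rep.symm⟩
  obtain ⟨g1, e1⟩ := frobPerm_mk hxv
  obtain ⟨g2, e2⟩ := frobPerm_mk e1
  obtain ⟨g3, e3⟩ := frobPerm_mk e2
  rw [coll_iff_exists hv g1 g2 hxv e1 e2] at hn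
  rw [coll_iff_exists g1 g2 g3 e1 e2 e3] at hn'
  rw [coll_iff_exists hv g1 g3 hxv e1 e3] at hc
  have e7 : ∃ c : K, ∀ i, (FiniteField.frobeniusAlgHom k K)^[7] (v i) = c * v i := by
    have e := frobPerm_pow k K 7 x
    rw [h7, hxv, frob_iterate_mk, eq_comm, Projectivization.mk_eq_mk_iff'] at e
    obtain ⟨c, hc⟩ := e
    refine ⟨c, fun i => ?_⟩
    rw [FiniteField.coe_frobeniusAlgHom, pow_iterate]
    change v i ^ Fintype.card k ^ 7 = _
    rw [← frobVec_iterate, ← hc]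
    rfl
  have hne' : ∀ a b : K, b ≠ 0 → ∃ i, a * v i + b * FiniteField.frobeniusAlgHom k K
      (FiniteField.frobeniusAlgHom k K (FiniteField.frobeniusAlgHom k K (v i))) ≠ 0 := by
    intro a b hb
    by_contra! hcon
    refine hne (Subtype.ext ?_).symm
    rw [e3, hxv, Projectivization.mk_eq_mk_iff']
    refine ⟨-(b⁻¹ * a), funext fun i => ?_⟩
    have := hcon i
    simp only [Pi.smul_apply, smul_eq_mul]
    field_simp
    linear_combination -this
  have hφ : ∀ c, FiniteField.frobeniusAlgHom k K c = c ^ Fintype.card k := fun _ => rfl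
  have hmem : ∀ w, w ∈ sevenKer k K ↔ _ := fun w => mem_sevenKer
  generalize FiniteField.frobeniusAlgHom k K = φ at *
  replace hn : ∀ a b c : K, (∀ i, a * v i + b * φ (v i) + c * φ (φ (v i)) = 0) →
      a = 0 ∧ b = 0 ∧ c = 0 := by
    intro a b c h
    by_contra hcon
    refine hn ⟨![a, b, c], fun h0 => hcon ⟨congrFun h0 0, congrFun h0 1, congrFun h0 2⟩, h⟩
  replace hn' : ∀ a b c : K, (∀ i, a * φ (v i) + b * φ (φ (v i)) + c * φ (φ (φ (v i))) = 0) →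
      a = 0 ∧ b = 0 ∧ c = 0 := by
    intro a b c h
    by_contra hcon
    refine hn' ⟨![a, b, c], fun h0 => hcon ⟨congrFun h0 0, congrFun h0 1, congrFun h0 2⟩, h⟩
  obtain ⟨r, hr, hrel⟩ := hc
  have r2 : r 2 ≠ 0 := by
    intro h0
    obtain ⟨a0, a1, -⟩ := hn (r 0) (r 1) 0 fun i => by
      have := hrel i
      rw [h0] at this
      linear_combination this
    refine hr (funext fun i => ?_)
    fin_cases i <;> assumption
  have r1 : r 1 ≠ 0 := by
    intro h0
    obtain ⟨i, hi⟩ := hne' (r 0) (r 2) r2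
    refine hi ?_
    have := hrel i
    rw [h0] at this
    linear_combination this
  have r0 : r 0 ≠ 0 := by
    intro h0
    refine r2 (hn' (r 1) 0 (r 2) fun i => ?_).2.2
    have := hrel i
    rw [h0] at this
    linear_combination this
  -- rescale the representative, so that the first two coefficients of the relation agree
  have hq : 0 < Fintype.card k - 1 := Nat.sub_pos_of_lt Fintype.one_lt_card
  obtain ⟨m, hm⟩ := IsAlgClosed.exists_pow_nat_eq (r 0 / r 1) hq
  have m0 : m ≠ 0 := by
    rintro rfl
    rw [zero_pow hq.ne'] at hm
    exact div_ne_zero r0 r1 hm.symm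
  have hm' : r 1 * φ m = r 0 * m := by
    rw [hφ, ← Nat.succ_pred_eq_of_pos (Fintype.card_pos (α := k)), pow_succ, Nat.pred_eq_sub_one,
      hm]
    field_simp
  obtain ⟨u, hu⟩ : ∃ u : Fin 3 → K, ∀ i, v i = m * u i := ⟨fun i => m⁻¹ * v i, fun i => by
    field_simp⟩
  have φm0 : φ m ≠ 0 := (map_ne_zero φ).2 m0
  have φφm0 : φ (φ m) ≠ 0 := (map_ne_zero φ).2 φm0
  have φφφm0 : φ (φ (φ m)) ≠ 0 := (map_ne_zero φ).2 φφm0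
  simp only [hu, map_mul] at hrel e7 hn
  replace hn : ∀ a b c : K, (∀ i, a * u i + b * φ (u i) + c * φ (φ (u i)) = 0) →
      a = 0 ∧ b = 0 ∧ c = 0 := by
    intro a b c h
    have := hn (a / m) (b / φ m) (c / φ (φ m)) fun i => by
      have := h i
      field_simp
      linear_combination this
    simpa [m0, φm0, φφm0] using this
  -- the relation `φ ^ 3 u = g (φ u + u)`
  obtain ⟨g, hg⟩ : ∃ g, ∀ i, φ (φ (φ (u i))) = g * (φ (u i) + u i) := by
    refine ⟨r 0 * m / (r 2 * φ (φ (φ m))), fun i => ?_⟩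
    have := hrel i
    field_simp
    linear_combination this - φ (u i) * hm' - r 0 * m * (u i + φ (u i)) * h2
  have g0 : g ≠ 0 := by
    rintro rfl
    refine one_ne_zero (hn 1 0 0 fun i => ?_).1
    have : φ (φ (φ (u i))) = 0 := by rw [hg, zero_mul]
    simp only [map_eq_zero] at this
    rw [this]
    simp
  have h4 : ∀ i, φ (φ (φ (φ (u i)))) = φ g * (φ (φ (u i)) + φ (u i)) := fun i => by
    rw [hg, map_mul, map_add]
  have h7' : ∀ i, φ (φ (φ (φ (φ (φ (φ (u i))))))) = φ (φ (φ (φ g))) *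
      (φ (φ g) * (g * (φ (u i) + u i) + φ (φ (u i))) + φ g * (φ (φ (u i)) + φ (u i))) := fun i => by
    rw [hg i]
    simp only [map_mul, map_add, h4]
    rw [hg]
  -- compare coefficients in `φ ^ 7 u = c u`
  obtain ⟨c, hc⟩ := e7
  simp only [Function.iterate_succ_apply, Function.iterate_zero_apply, map_mul, h7'] at hc
  set M := φ (φ (φ (φ (φ (φ (φ m)))))) with hM
  have M0 : M * φ (φ (φ (φ g))) ≠ 0 := by
    simp only [hM, ne_eq, mul_eq_zero, map_eq_zero, m0, g0, or_self, not_false_eq_true]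
  set G := φ (φ (φ (φ g))) with hG
  obtain ⟨-, c1, c2⟩ := hn (M * G * (φ (φ g) * g) - c * m) (M * G * (φ (φ g) * g + φ g))
    (M * G * (φ (φ g) + φ g)) fun i => by linear_combination hc i
  replace c1 := (mul_eq_zero.1 c1).resolve_left M0
  replace c2 := (mul_eq_zero.1 c2).resolve_left M0
  rw [← map_add, map_eq_zero] at c2
  have gφ : φ g = g := by linear_combination c2 - g * h2
  rw [gφ, gφ] at c1
  have g1 : g = 1 := mul_left_cancel₀ g0 (by linear_combination c1 - g * h2)
  have hum : ∀ i, u i = m⁻¹ * v i := fun i => by rw [hu]; field_simp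
  have hu0 : u ≠ 0 := by
    rintro rfl
    exact hv (funext fun i => by rw [hu]; simp)
  refine ⟨u, hu0, fun i => ?_, ?_⟩
  · rw [hmem, hg, g1]
    linear_combination (φ (u i) + u i) * h2
  · rw [hxv, Projectivization.mk_eq_mk_iff']
    exact ⟨m, funext fun i => (hu i).symm⟩

/-- The points of `exists_sevenKer_rep` are as many as the collineations defined over `k`: each
comes from `#k - 1` bases of the three-dimensional space `sevenKer k K`. -/
theorem cnt_conjugate_fano (h2 : (2 : K) = 0) :
    cnt (fun x => Gen (frobPerm k K) (frobPerm k K ^ 7) x ∧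
      Coll x (frobPerm k K x) (frobPerm k K (frobPerm k K (frobPerm k K x)))) =
        pglCard (Fintype.card k) := by
  classical
  have := finite_sevenKer (k := k) h2
  have : Fintype (sevenKer k K) := Fintype.ofFinite _
  have hq : (Fintype.card k : ℤ) - 1 ≠ 0 := by
    have : (1 : ℤ) < Fintype.card k := by exact_mod_cast Fintype.one_lt_card
    omega
  have hfix : ∀ (v : Fin 3 → sevenKer k K) (h : (fun i => (v i : K)) ≠ 0),
      (frob k K)^[7] (Projectivization.mk K _ h) = Projectivization.mk K _ h := by
    intro v h
    rw [frob_iterate_mk]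
    congr 1
    funext i
    rw [frobVec_iterate]
    exact frob_seven_of_mem_sevenKer h2 (v i).2
  have hfix' : ∀ (v : Fin 3 → sevenKer k K) (h : (fun i => (v i : K)) ≠ 0),
      (frob k K)^[period] (Projectivization.mk K _ h) = Projectivization.mk K _ h := by
    intro v h
    rw [period_eq, show 5040 = 7 * 720 by norm_num, Function.iterate_mul]
    exact Function.iterate_fixed (hfix v h) _
  let f : (Fin 3 → sevenKer k K) → FinPlane k K := fun v =>
    if h : (fun i => (v i : K)) ≠ 0 then ⟨_, hfix' v h⟩ else Classical.arbitrary _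
  have hf : ∀ v (h : (fun i => (v i : K)) ≠ 0), (f v).1 = Projectivization.mk K _ h :=
    fun v h => congrArg Subtype.val (dif_pos h)
  have hind : ∀ v : Fin 3 → sevenKer k K, LinearIndependent k v ↔
      LinearIndependent k fun i => (v i : K) := fun v =>
    ((sevenKer k K).subtype.linearIndependent_iff (Submodule.ker_subtype _)).symm
  have hnz : ∀ v : Fin 3 → sevenKer k K, LinearIndependent k v → (fun i => (v i : K)) ≠ 0 :=
    fun v hv h => ((hind v).1 hv).ne_zero 0 (congrFun h 0)
  refine mul_right_cancel₀ hq ?_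
  rw [← card_bases_sevenKer h2, ← cnt_eq_natCard]
  symm
  refine cnt_fiber f _ (fun v hv => ?_) fun x hx => ?_
  · have h := hnz v hv
    refine ⟨⟨?_, ?_⟩, ?_⟩
    · refine Subtype.ext ?_
      rw [frobPerm_pow, hf v h, hfix]
    · exact (no_line_iff_linearIndependent h (hf v h)).2 ((hind v).1 hv)
    · obtain ⟨g1, e1⟩ := frobPerm_mk (hf v h)
      obtain ⟨g2, e2⟩ := frobPerm_mk e1
      obtain ⟨g3, e3⟩ := frobPerm_mk e2
      rw [coll_iff_exists h g1 g3 (hf v h) e1 e3]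
      refine ⟨![1, 1, 1], fun h => one_ne_zero (congrFun h 0), fun i => ?_⟩
      have := mem_sevenKer.1 (v i).2
      simp only [cons_val_zero, cons_val_one, cons_val]
      linear_combination this
  · obtain ⟨v, hv, hmem, hxv⟩ := exists_sevenKer_rep h2 hx.1 hx.2
    have hvi := (no_line_iff_linearIndependent hv hxv).1 hx.1.2
    -- the other representatives of `x` are the multiples of `v` by elements of `k`
    have h1 : IsFrob (frobPerm k K) (Fintype.card k : ℤ) := by
      simpa using isFrob_frobPerm_pow k K 1 le_rfl (by norm_num)
    have hne := gen_ne h1 hx.1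
    let v' : Fin 3 → sevenKer k K := fun i => ⟨v i, hmem i⟩
    have hv' : v' ≠ 0 := fun h => hv (funext fun i => congrArg Subtype.val (congrFun h i))
    have hcard : cnt (fun _ : kˣ => True) = (Fintype.card k : ℤ) - 1 := by
      rw [cnt_eq_natCard, Nat.card_congr (Equiv.subtypeUnivEquiv fun _ => trivial), Nat.card_units,
        Nat.card_eq_fintype_card, Nat.cast_sub Fintype.card_pos, Nat.cast_one]
    rw [← hcard]
    refine cnt_of_injective (f := fun c : kˣ => (c : k) • v')
      (fun c d h => Units.ext (smul_left_injective k hv' h)) fun w => ?_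
    constructor
    · rintro ⟨hw, rfl⟩
      have e := hf w (hnz w hw)
      rw [hxv, eq_comm, Projectivization.mk_eq_mk_iff'] at e
      obtain ⟨c, hc⟩ := e
      have hc' : ∀ i, (w i : K) = c * v i := fun i => (congrFun hc i).symm
      have hrel : ∀ i, FiniteField.frobeniusAlgHom k K (FiniteField.frobeniusAlgHom k K
          (FiniteField.frobeniusAlgHom k K c)) * (FiniteField.frobeniusAlgHom k K (v i) + v i) =
          FiniteField.frobeniusAlgHom k K c * FiniteField.frobeniusAlgHom k K (v i) + c * v i := by
        intro i
        have a := mem_sevenKer.1 (w i).2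
        have b := mem_sevenKer.1 (hmem i)
        rw [hc'] at a
        simp only [map_mul] at a
        linear_combination -a + FiniteField.frobeniusAlgHom k K (FiniteField.frobeniusAlgHom k K
          (FiniteField.frobeniusAlgHom k K c)) * b
      obtain ⟨g1, e1⟩ := frobPerm_mk hxv
      have hne' : ∀ a : K, ∃ i, FiniteField.frobeniusAlgHom k K (v i) ≠ a * v i := by
        intro a
        by_contra! hcon
        refine hne (Subtype.ext ?_)
        rw [e1, hxv, Projectivization.mk_eq_mk_iff']
        exact ⟨a, funext fun i => (hcon i).symm⟩
      have hφ : ∀ c, FiniteField.frobeniusAlgHom k K c = c ^ Fintype.card k := fun _ => rfl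
      obtain ⟨j, hj⟩ : ∃ j, v j ≠ 0 := by
        by_contra! hcon
        exact hv (funext hcon)
      have h3 : FiniteField.frobeniusAlgHom k K (FiniteField.frobeniusAlgHom k K
          (FiniteField.frobeniusAlgHom k K c)) = FiniteField.frobeniusAlgHom k K c := by
        by_contra h0
        have h0 := sub_ne_zero.2 h0
        obtain ⟨i, hi⟩ := hne' ((c - FiniteField.frobeniusAlgHom k K (FiniteField.frobeniusAlgHom k K
          (FiniteField.frobeniusAlgHom k K c))) / (FiniteField.frobeniusAlgHom k K
          (FiniteField.frobeniusAlgHom k K (FiniteField.frobeniusAlgHom k K c)) -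
            FiniteField.frobeniusAlgHom k K c))
        refine hi ?_
        rw [div_mul_eq_mul_div, eq_div_iff h0]
        linear_combination hrel i
      have hcc : FiniteField.frobeniusAlgHom k K c = c := by
        have := hrel j
        rw [h3] at this
        exact mul_right_cancel₀ hj (by linear_combination this)
      obtain ⟨a, ha⟩ := exists_algebraMap_eq (hφ c ▸ hcc)
      have ha0 : a ≠ 0 := by
        rintro rfl
        rw [map_zero] at ha
        refine hnz w hw (funext fun i => ?_)
        rw [hc', ← ha, zero_mul]
        rfl
      refine ⟨Units.mk0 a ha0, funext fun i => Subtype.ext ?_, trivial⟩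
      rw [hc', ← ha, ← Algebra.smul_def]
      rfl
    · rintro ⟨c, rfl, -⟩
      have hc0 : algebraMap k K c ≠ 0 := (map_ne_zero _).2 c.ne_zero
      have hval : (fun i => (((c : k) • v') i : K)) = algebraMap k K c • v := by
        funext i
        exact Algebra.smul_def _ _
      have hw0 : (fun i => (((c : k) • v') i : K)) ≠ 0 := hval ▸ smul_ne_zero hc0 hv
      have e : f ((c : k) • v') = x := by
        refine Subtype.ext ?_
        rw [hf _ hw0, hxv, Projectivization.mk_eq_mk_iff']
        exact ⟨_, hval.symm⟩
      refine ⟨?_, e⟩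
      rw [hind]
      exact (no_line_iff_linearIndependent hw0 (e ▸ hf _ hw0)).1 hx.1.2

end conjugateFano

/-! ### Labelled and unlabelled arcs -/

section labelling

theorem cycleType_permCongr' {α β : Type*} [Fintype α] [DecidableEq α] [Fintype β] [DecidableEq β]
    (e : α ≃ β) (σ : Equiv.Perm α) : (e.permCongr σ).cycleType = σ.cycleType := by
  have := Equiv.Perm.cycleType_extendDomain (p := fun _ : β => True)
    (e.trans (Equiv.Set.univ β).symm) (g := σ)
  rw [← this]
  congr 1

theorem parts_permCongr {α β : Type*} [Fintype α] [DecidableEq α] [Fintype β] [DecidableEq β]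
    (e : α ≃ β) (σ : Equiv.Perm α) : (e.permCongr σ).partition.parts = σ.partition.parts := by
  rw [Equiv.Perm.parts_partition, Equiv.Perm.parts_partition, ← Equiv.Perm.sum_cycleType,
    ← Equiv.Perm.sum_cycleType, cycleType_permCongr', Fintype.card_congr e]

variable {k K : Type*} [Field k] [Fintype k] [Field K] [Algebra k K]

/-- The cycle type of the Frobenius on `S` is that of `σ` exactly if the points of `S` can be
labelled so that the Frobenius permutes the labels through `σ`. -/
theorem hasFrobCycleType_iff {n : ℕ} (σ : Equiv.Perm (Fin n)) (S : Finset (ℙ K (Fin 3 → K))) :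
    HasFrobCycleType k S σ.partition.parts ↔
      ∃ e : Fin n ≃ {a // a ∈ S}, ∀ i, frob k K (e i) = e (σ i) := by
  classical
  constructor
  · rintro ⟨τ, hτ, hp⟩
    have hc : Fintype.card {a // a ∈ S} = n := by
      have h1 := τ.partition.parts_sum
      rw [hp, σ.partition.parts_sum, Fintype.card_fin] at h1
      exact h1.symm
    let e₀ : Fin n ≃ {a // a ∈ S} := (finCongr hc.symm).trans (Fintype.equivFin _).symm
    have hconj : IsConj σ (e₀.symm.permCongr τ) := by
      rw [Equiv.Perm.partition_eq_of_isConj]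
      refine Nat.Partition.ext ?_
      rw [parts_permCongr, ← hp]
    obtain ⟨g, hg⟩ := isConj_iff.1 hconj
    refine ⟨(Equiv.trans g e₀ : Fin n ≃ _), fun i => ?_⟩
    have h := congrArg e₀ (Equiv.congr_fun (mul_inv_eq_iff_eq_mul.1 hg) i)
    simp only [Equiv.Perm.mul_apply, Equiv.permCongr_apply, Equiv.apply_symm_apply,
      Equiv.symm_symm] at h
    exact (hτ _).symm.trans (congrArg Subtype.val h.symm)
  · rintro ⟨e, he⟩
    refine ⟨e.permCongr σ, fun a => ?_, ?_⟩
    · rw [Equiv.permCongr_apply, ← he, Equiv.apply_symm_apply]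
    · convert parts_permCongr e σ

variable [IsAlgClosed K]

theorem coll_iff_collinear (a b c : FinPlane k K) : Coll a b c ↔ Collinear a.1 b.1 c.1 := by
  constructor
  · rintro ⟨l, h⟩
    exact ⟨l.1, h⟩
  · rintro ⟨l, h1, h2, h3⟩
    by_cases hab : a = b
    · rw [hab]
      exact coll_self_left _ _
    · have e : (join a b).1 = l :=
        line_unique_orthogonal (Subtype.coe_injective.ne hab) (inc_join_left hab)
          (inc_join_right hab) h1 h2
      rw [coll_iff hab, inc_def, e]
      exact h3

variable (k K) in
/-- The inclusion of the finite plane. -/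
def finPlaneEmb : FinPlane k K ↪ ℙ K (Fin 3 → K) := ⟨Subtype.val, Subtype.coe_injective⟩

/-- The points of an arc with seven points lie in the finite plane. -/
theorem exists_finPlane_of_arc {lam : Multiset ℕ} {S : Finset (ℙ K (Fin 3 → K))}
    (h : S ∈ arcs k K 7 lam) : ∃ T : Finset (FinPlane k K), T.map (finPlaneEmb k K) = S := by
  classical
  obtain ⟨hS, σ, hσ, -⟩ := h
  have hpow : ∀ (n : ℕ) (a : {a // a ∈ S}), ((σ ^ n) a).1 = (frob k K)^[n] a.1 := by
    intro n
    induction n with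
    | zero => exact fun a => rfl
    | succ n ih =>
      intro a
      rw [pow_succ, Equiv.Perm.mul_apply, ih, hσ, Function.iterate_succ_apply]
  have hfix : ∀ a ∈ S, (frob k K)^[period] a = a := by
    intro a ha
    -- the order of a permutation of seven points divides `7!`
    have hc : Fintype.card (Equiv.Perm {a // a ∈ S}) = period := by
      rw [Fintype.card_perm, Fintype.card_coe, hS.card_eq, period_eq]
      rfl
    have := hpow period ⟨a, ha⟩
    rw [← hc, pow_card_eq_one, hc] at this
    exact this.symm
  refine ⟨S.attach.map ⟨fun a => ⟨a.1, hfix a.1 a.2⟩, fun a b h => Subtype.ext (by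
    simpa using congrArg Subtype.val h)⟩, ?_⟩
  ext a
  constructor
  · intro h
    obtain ⟨t, ht, rfl⟩ := Finset.mem_map.1 h
    obtain ⟨b, -, rfl⟩ := Finset.mem_map.1 ht
    exact b.2
  · intro ha
    exact Finset.mem_map.2 ⟨⟨a, hfix a ha⟩,
      Finset.mem_map.2 ⟨⟨a, ha⟩, Finset.mem_attach _ _, rfl⟩, rfl⟩

theorem finite_arcs (lam : Multiset ℕ) : (arcs k K 7 lam).Finite :=
  (Set.finite_range fun T : Finset (FinPlane k K) => T.map (finPlaneEmb k K)).subset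
    fun _ h => exists_finPlane_of_arc h

open Classical in
/-- Arcs with the cycle type of `σ` are the images of the arcs labelled so that `F` acts through
`σ`. -/
theorem map_mem_arcs_iff (σ : Equiv.Perm (Fin 7)) (T : Finset (FinPlane k K)) :
    T.map (finPlaneEmb k K) ∈ arcs k K 7 σ.partition.parts ↔
      ∃ P, Tw (frobPerm k K) σ P ∧ Finset.univ.image P = T := by
  constructor
  · rintro ⟨hS, hσ⟩
    obtain ⟨e, he⟩ := (hasFrobCycleType_iff σ _).1 hσ
    have hP : ∀ i, ∃ t ∈ T, t.1 = (e i).1 := fun i => Finset.mem_map.1 (e i).2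
    choose P hPT hP using hP
    have hPe : ∀ i j, i < j → (P i).1 ≠ (P j).1 := fun i j hij h =>
      hij.ne (e.injective (Subtype.ext ((hP i).symm.trans (h.trans (hP j)))))
    refine ⟨P, ⟨fun i => Subtype.ext ?_, fun i j l hij hjl hc => ?_⟩, ?_⟩
    · rw [hP, ← he, ← hP]
      rfl
    · have hm : ∀ i, (P i).1 ∈ T.map (finPlaneEmb k K) := fun i =>
        Finset.mem_map_of_mem (finPlaneEmb k K) (hPT i)
      exact hS.not_collinear _ (hm i) _ (hm j) _ (hm l) (hPe i j hij) (hPe i l (hij.trans hjl))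
        (hPe j l hjl) ((coll_iff_collinear _ _ _).1 hc)
    · ext t
      rw [Finset.mem_image]
      constructor
      · rintro ⟨i, -, rfl⟩
        exact hPT i
      · intro ht
        obtain ⟨i, hi⟩ := e.surjective ⟨t.1, Finset.mem_map_of_mem (finPlaneEmb k K) ht⟩
        exact ⟨i, Finset.mem_univ _, Subtype.ext (by rw [hP, hi])⟩
  · rintro ⟨P, hP, rfl⟩
    have inj := hP.injective (by norm_num)
    have hmem : ∀ a, a ∈ (Finset.univ.image P).map (finPlaneEmb k K) ↔ ∃ i, (P i).1 = a := by
      intro a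
      simp only [Finset.mem_map, Finset.mem_image, Finset.mem_univ, true_and]
      exact ⟨fun ⟨_, ⟨i, hi⟩, h⟩ => ⟨i, hi ▸ h⟩, fun ⟨i, h⟩ => ⟨_, ⟨i, rfl⟩, h⟩⟩
    have hfrob : ∀ i, frob k K (P i).1 = (P (σ i)).1 := fun i => congrArg Subtype.val (hP.1 i)
    refine ⟨⟨?_, ?_, ?_⟩, (hasFrobCycleType_iff σ _).2 ?_⟩
    · rw [Finset.card_map, Finset.card_image_of_injective _ inj, Finset.card_univ, Fintype.card_fin]
    · intro a ha
      obtain ⟨i, rfl⟩ := (hmem a).1 ha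
      exact (hmem _).2 ⟨σ i, (hfrob i).symm⟩
    · intro a ha b hb c hc hab hac hbc hcol
      obtain ⟨i, rfl⟩ := (hmem a).1 ha
      obtain ⟨j, rfl⟩ := (hmem b).1 hb
      obtain ⟨l, rfl⟩ := (hmem c).1 hc
      exact hP.not_coll (fun h => hab (by rw [h])) (fun h => hac (by rw [h]))
        (fun h => hbc (by rw [h])) ((coll_iff_collinear _ _ _).2 hcol)
    · refine ⟨Equiv.ofBijective (fun i => ⟨(P i).1, (hmem _).2 ⟨i, rfl⟩⟩) ⟨fun i j h => ?_, ?_⟩,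
        fun i => hfrob i⟩
      · have h' : (P i).1 = (P j).1 := Subtype.mk.inj h
        exact inj (Subtype.ext h')
      · rintro ⟨a, ha⟩
        obtain ⟨i, rfl⟩ := (hmem a).1 ha
        exact ⟨i, rfl⟩

/-- Every arc on which the Frobenius has the cycle type of `σ` has as many labellings on which it
acts through `σ` as there are permutations commuting with `σ`. -/
theorem numTw_eq_ncard_mul (σ : Equiv.Perm (Fin 7)) :
    numTw (frobPerm k K) σ = ((arcs k K 7 σ.partition.parts).ncard : ℤ) *
      Nat.card (Subgroup.centralizer {σ}) := by
  classical
  have hr : ((arcs k K 7 σ.partition.parts).ncard : ℤ) =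
      cnt fun T : Finset (FinPlane k K) =>
        T.map (finPlaneEmb k K) ∈ arcs k K 7 σ.partition.parts := by
    rw [cnt_eq_natCard]
    have himg : arcs k K 7 σ.partition.parts = (Finset.map (finPlaneEmb k K)) ''
        {T | T.map (finPlaneEmb k K) ∈ arcs k K 7 σ.partition.parts} := by
      ext S
      constructor
      · intro h
        obtain ⟨T, rfl⟩ := exists_finPlane_of_arc h
        exact ⟨T, h, rfl⟩
      · rintro ⟨T, h, rfl⟩
        exact h
    conv_lhs => rw [himg]
    rw [Set.ncard_image_of_injective _ (Finset.map_injective _)]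
    rfl
  rw [hr]
  refine cnt_fiber (fun P => Finset.univ.image P) _
    (fun P hP => (map_mem_arcs_iff σ _).2 ⟨P, hP, rfl⟩) fun T hT => ?_
  obtain ⟨P, hP, rfl⟩ := (map_mem_arcs_iff σ T).1 hT
  have inj := hP.injective (by norm_num)
  have hone : (Nat.card (Subgroup.centralizer {σ}) : ℤ) =
      cnt fun _ : Subgroup.centralizer {σ} => True := by
    rw [cnt_eq_natCard, Nat.card_congr (Equiv.subtypeUnivEquiv fun _ => trivial)]
  rw [hone]
  refine cnt_of_injective (f := fun g : Subgroup.centralizer {σ} => P ∘ g.1)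
    (fun g h e => Subtype.ext (Equiv.ext fun i => inj (congrFun e i))) fun Q => ?_
  constructor
  · rintro ⟨hQ, himg⟩
    have hQP : ∀ i, ∃ j, P j = Q i := fun i => by
      have : Q i ∈ Finset.univ.image P := himg ▸ Finset.mem_image_of_mem _ (Finset.mem_univ i)
      simpa using this
    choose g hg using hQP
    have ginj : Function.Injective g := fun i j h =>
      hQ.injective (by norm_num) (by rw [← hg i, ← hg j, h])
    refine ⟨⟨Equiv.ofBijective g (Finite.injective_iff_bijective.1 ginj), ?_⟩, funext hg, trivial⟩
    rw [Subgroup.mem_centralizer_singleton_iff]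
    refine Equiv.ext fun i => inj ?_
    change P (g (σ i)) = P (σ (g i))
    rw [hg, ← hQ.1, ← hP.1, hg]
  · rintro ⟨⟨g, hg⟩, rfl, -⟩
    rw [Subgroup.mem_centralizer_singleton_iff] at hg
    refine ⟨⟨fun i => ?_, fun i j l hij hjl => ?_⟩, ?_⟩
    · have := Equiv.congr_fun hg i
      change frobPerm k K (P (g i)) = P (g (σ i))
      rw [hP.1]
      exact congrArg P this.symm
    · exact hP.not_coll (g.injective.ne hij.ne) (g.injective.ne (hij.trans hjl).ne)
        (g.injective.ne hjl.ne)
    · rw [← Finset.image_image]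
      congr 1
      simp

end labelling

/-! ### Normalised counts -/

section counts

open Matrix in
theorem natCard_projGenLinGroup (k : Type*) [Field k] [Fintype k] :
    (Nat.card (ProjGenLinGroup (Fin 3) k) : ℤ) = pglCard (Fintype.card k) := by
  have hinj : Function.Injective (GeneralLinearGroup.scalar (Fin 3) (R := k)) := by
    intro a b h
    have := congrArg (fun g : GL (Fin 3) k => g.1 0 0) h
    exact Units.ext (by simpa [GeneralLinearGroup.scalar] using this)
  have hc : Nat.card (Subgroup.center (GL (Fin 3) k)) = Fintype.card k - 1 := by
    rw [GeneralLinearGroup.center_eq_range_scalar,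
      Nat.card_congr (MonoidHom.ofInjective hinj).symm.toEquiv, Nat.card_units,
      Nat.card_eq_fintype_card]
  have h := Subgroup.card_eq_card_quotient_mul_card_subgroup (Subgroup.center (GL (Fin 3) k))
  have hle : ∀ i ≤ 3, Fintype.card k ^ i ≤ Fintype.card k ^ 3 := fun i hi =>
    Nat.pow_le_pow_right Fintype.card_pos hi
  rw [card_GL_field, hc, Fin.prod_univ_three] at h
  have h' := congrArg (Nat.cast : ℕ → ℤ) h
  simp only [Fin.val_zero, Fin.val_one, Fin.val_two] at h'
  push_cast [hle 0 (by norm_num), hle 1 (by norm_num), hle 2 (by norm_num),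
    Nat.cast_sub Fintype.card_pos] at h'
  have hq : (Fintype.card k : ℤ) - 1 ≠ 0 := by
    have : (1 : ℤ) < Fintype.card k := by exact_mod_cast Fintype.one_lt_card
    omega
  refine mul_right_cancel₀ hq (Eq.trans h'.symm ?_)
  rw [pglCard]
  ring

variable (k K : Type*) [Field k] [Fintype k] [Field K] [Algebra k K] [IsAlgClosed K]

/-- The passage from labelled arcs to the normalised count, for the cycle type `lam` whose parts
other than `1` are `mu`; `c` is the order of the centralizer. -/
theorem count7_eq (σ : Equiv.Perm (Fin 7)) {mu : Multiset ℕ} (lam : Multiset ℕ)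
    (hmu : σ.cycleType = mu) (hlam : mu + Multiset.replicate (7 - mu.sum) 1 = lam) (c : ℕ)
    (hc : (7 - mu.sum).factorial * mu.prod * (∏ n ∈ mu.toFinset, (mu.count n).factorial) = c)
    {N : ℤ} (h : numTw (frobPerm k K) σ = pglCard (Fintype.card k) * N) :
    count7 k K lam = 1 / c * N := by
  have hp : σ.partition.parts = lam := by
    rw [Equiv.Perm.parts_partition, ← Equiv.Perm.sum_cycleType, hmu, Fintype.card_fin, hlam]
  have hc' : Nat.card (Subgroup.centralizer {σ}) = c := by
    rw [Equiv.Perm.nat_card_centralizer, hmu, Fintype.card_fin, hc]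
  have hc0 : (c : ℚ) ≠ 0 := by
    rw [← hc']
    exact_mod_cast Nat.card_pos.ne'
  have hG := natCard_projGenLinGroup k
  have hG0 : (Nat.card (Matrix.ProjGenLinGroup (Fin 3) k) : ℚ) ≠ 0 := by
    have : Finite (Matrix.ProjGenLinGroup (Fin 3) k) :=
      Quotient.finite _
    exact_mod_cast Nat.card_pos.ne'
  rw [numTw_eq_ncard_mul, hc', hp, ← hG] at h
  have h' : ((arcs k K 7 lam).ncard : ℚ) * c = Nat.card (Matrix.ProjGenLinGroup (Fin 3) k) * N := by
    exact_mod_cast h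
  rw [count7]
  field_simp
  linear_combination h'

end counts

end PlaneArcs

theorem theorem1p21 (F K : Type*) [Field F] [Fintype F] [Field K] [Algebra F K]
    [IsAlgClosure F K] (q : ℕ) (hq : Fintype.card F = q) :
    -- the sets being counted are finite
    (∀ lam : Multiset ℕ, (PlaneArcs.arcs F K 7 lam).Finite) ∧
    -- characteristic 2: the five exceptional cycle types
    (Even q →
      PlaneArcs.count7 F K {1, 1, 1, 1, 1, 1, 1} =
        1 / 5040 * ((q : ℚ) ^ 6 - 28 * (q : ℚ) ^ 5 + 323 * (q : ℚ) ^ 4 - 1952 * (q : ℚ) ^ 3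
          + 6462 * (q : ℚ) ^ 2 - 11004 * (q : ℚ) + 7440) ∧
      PlaneArcs.count7 F K {2, 2, 1, 1, 1} =
        1 / 48 * ((q : ℚ) ^ 6 - 4 * (q : ℚ) ^ 5 - (q : ℚ) ^ 4 + 16 * (q : ℚ) ^ 3
          - 6 * (q : ℚ) ^ 2 - 12 * (q : ℚ)) ∧
      PlaneArcs.count7 F K {3, 3, 1} =
        1 / 18 * ((q : ℚ) ^ 6 - (q : ℚ) ^ 5 - (q : ℚ) ^ 4 - 8 * (q : ℚ) ^ 3
          + 9 * (q : ℚ) ^ 2 + 6 * (q : ℚ) + 12) ∧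
      PlaneArcs.count7 F K {4, 2, 1} =
        1 / 8 * ((q : ℚ) ^ 6 - 3 * (q : ℚ) ^ 4) ∧
      PlaneArcs.count7 F K {7} =
        1 / 7 * ((q : ℚ) ^ 6 + (q : ℚ) ^ 4 + (q : ℚ) ^ 3 + (q : ℚ) ^ 2 - 1)) ∧
    -- odd characteristic: the same five cycle types, with different constant terms
    (Odd q →
      PlaneArcs.count7 F K {1, 1, 1, 1, 1, 1, 1} =
        1 / 5040 * ((q : ℚ) ^ 6 - 28 * (q : ℚ) ^ 5 + 323 * (q : ℚ) ^ 4 - 1952 * (q : ℚ) ^ 3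
          + 6462 * (q : ℚ) ^ 2 - 11004 * (q : ℚ) + 7470) ∧
      PlaneArcs.count7 F K {2, 2, 1, 1, 1} =
        1 / 48 * ((q : ℚ) ^ 6 - 4 * (q : ℚ) ^ 5 - (q : ℚ) ^ 4 + 16 * (q : ℚ) ^ 3
          - 6 * (q : ℚ) ^ 2 - 12 * (q : ℚ) + 6) ∧
      PlaneArcs.count7 F K {3, 3, 1} =
        1 / 18 * ((q : ℚ) ^ 6 - (q : ℚ) ^ 5 - (q : ℚ) ^ 4 - 8 * (q : ℚ) ^ 3
          + 9 * (q : ℚ) ^ 2 + 6 * (q : ℚ) + 18) ∧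
      PlaneArcs.count7 F K {4, 2, 1} =
        1 / 8 * ((q : ℚ) ^ 6 - 3 * (q : ℚ) ^ 4 + 2) ∧
      PlaneArcs.count7 F K {7} =
        1 / 7 * ((q : ℚ) ^ 6 + (q : ℚ) ^ 4 + (q : ℚ) ^ 3 + (q : ℚ) ^ 2 + 1)) ∧
    -- the other ten cycle types: one polynomial for every prime power, even or odd
    (PlaneArcs.count7 F K {2, 1, 1, 1, 1, 1} =
        1 / 240 * ((q : ℚ) ^ 6 - 10 * (q : ℚ) ^ 5 + 41 * (q : ℚ) ^ 4 - 86 * (q : ℚ) ^ 3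
          + 90 * (q : ℚ) ^ 2 - 36 * (q : ℚ)) ∧
      PlaneArcs.count7 F K {2, 2, 2, 1} =
        1 / 48 * ((q : ℚ) ^ 6 - 2 * (q : ℚ) ^ 5 - 11 * (q : ℚ) ^ 4 + 18 * (q : ℚ) ^ 3
          + 38 * (q : ℚ) ^ 2 - 36 * (q : ℚ) - 48) ∧
      PlaneArcs.count7 F K {3, 1, 1, 1, 1} =
        1 / 72 * ((q : ℚ) ^ 6 - (q : ℚ) ^ 5 - (q : ℚ) ^ 4 + (q : ℚ) ^ 3) ∧
      PlaneArcs.count7 F K {3, 2, 1, 1} =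
        1 / 12 * ((q : ℚ) ^ 6 - (q : ℚ) ^ 5 - (q : ℚ) ^ 4 + (q : ℚ) ^ 3) ∧
      PlaneArcs.count7 F K {3, 2, 2} =
        1 / 24 * ((q : ℚ) ^ 6 - (q : ℚ) ^ 5 - (q : ℚ) ^ 4 + (q : ℚ) ^ 3) ∧
      PlaneArcs.count7 F K {4, 1, 1, 1} =
        1 / 24 * ((q : ℚ) ^ 6 + 2 * (q : ℚ) ^ 5 - (q : ℚ) ^ 4 - 2 * (q : ℚ) ^ 3) ∧
      PlaneArcs.count7 F K {4, 3} =
        1 / 12 * ((q : ℚ) ^ 6 - (q : ℚ) ^ 5 - (q : ℚ) ^ 4 + (q : ℚ) ^ 3) ∧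
      PlaneArcs.count7 F K {5, 1, 1} =
        1 / 10 * ((q : ℚ) ^ 6 + 2 * (q : ℚ) ^ 5 + 3 * (q : ℚ) ^ 4 + 3 * (q : ℚ) ^ 3
          + 2 * (q : ℚ) ^ 2 + (q : ℚ)) ∧
      PlaneArcs.count7 F K {5, 2} =
        1 / 10 * ((q : ℚ) ^ 6 + (q : ℚ) ^ 4 - (q : ℚ) ^ 3 - (q : ℚ)) ∧
      PlaneArcs.count7 F K {6, 1} =
        1 / 6 * ((q : ℚ) ^ 6 + (q : ℚ) ^ 5 + (q : ℚ) ^ 4 - (q : ℚ) ^ 2)) := by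
  subst hq
  have : IsAlgClosed K := IsAlgClosure.isAlgClosed F
  have hF := PlaneArcs.isFrob_frobPerm_pow F K
  have h1 : PlaneArcs.IsFrob (PlaneArcs.frobPerm F K) (Fintype.card F : ℤ) := by simpa using hF 1 le_rfl (by norm_num)
  have h2 := hF 2 (by norm_num) (by norm_num)
  have hΦ := PlaneArcs.fanoIff_finPlane F K
  have hC := PlaneArcs.circumIff_finPlane F K
  refine ⟨PlaneArcs.finite_arcs, fun he => ?_, fun ho => ?_, ?_⟩
  · have hA : _ = PlaneArcs.pglCard (Fintype.card F) * 1 :=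
      (PlaneArcs.cnt_conjugate_fano (k := F) (K := K)
        ((PlaneArcs.two_eq_zero_iff F K).2 he)).trans (mul_one _).symm
    refine ⟨?_, ?_, ?_, ?_, ?_⟩
    · exact (PlaneArcs.count7_eq F K
        ⟨![0, 1, 2, 3, 4, 5, 6], ![0, 1, 2, 3, 4, 5, 6], by decide, by decide⟩
        (mu := 0) {1, 1, 1, 1, 1, 1, 1} (by decide +kernel) (by decide) 5040 (by decide)
        (PlaneArcs.numTw_id h1 hΦ)).trans (by
        rw [if_pos he]; push_cast; ring)
    · exact (PlaneArcs.count7_eq F K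
        ⟨![1, 0, 3, 2, 4, 5, 6], ![1, 0, 3, 2, 4, 5, 6], by decide, by decide⟩
        (mu := {2, 2}) {2, 2, 1, 1, 1} (by decide +kernel) (by decide) 48 (by decide)
        (PlaneArcs.numTw_two_two h1 h2 hΦ)).trans (by
        rw [if_pos he]; push_cast; ring)
    · exact (PlaneArcs.count7_eq F K
        ⟨![1, 2, 0, 3, 5, 6, 4], ![2, 0, 1, 3, 6, 4, 5], by decide, by decide⟩
        (mu := {3, 3}) {3, 3, 1} (by decide +kernel) (by decide) 18 (by decide)
        (PlaneArcs.numTw_three_three hF hΦ hC)).trans (by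
        rw [if_pos he]; push_cast; ring)
    · exact (PlaneArcs.count7_eq F K
        ⟨![1, 2, 3, 0, 4, 6, 5], ![3, 0, 1, 2, 4, 6, 5], by decide, by decide⟩
        (mu := {4, 2}) {4, 2, 1} (by decide +kernel) (by decide) 8 (by decide)
        (PlaneArcs.numTw_four_two hF hΦ)).trans (by
        rw [if_pos he]; push_cast; ring)
    · exact (PlaneArcs.count7_eq F K
        ⟨![1, 2, 3, 4, 5, 6, 0], ![6, 0, 1, 2, 3, 4, 5], by decide, by decide⟩
        (mu := {7}) {7} (by decide +kernel) (by decide) 7 (by decide)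
        (PlaneArcs.numTw_seven hF hA)).trans (by
        push_cast; ring)
  · have hn : ¬ Even (Fintype.card F) := Nat.not_even_iff_odd.2 ho
    -- in odd characteristic no orbit is a Fano plane
    have hA : PlaneArcs.cnt (fun x => PlaneArcs.Gen (PlaneArcs.frobPerm F K)
        (PlaneArcs.frobPerm F K ^ 7) x ∧ PlaneArcs.Coll x (PlaneArcs.frobPerm F K x)
          (PlaneArcs.frobPerm F K (PlaneArcs.frobPerm F K (PlaneArcs.frobPerm F K x)))) =
        PlaneArcs.pglCard (Fintype.card F) * 0 := by
      rw [mul_zero]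
      exact PlaneArcs.cnt_eq_zero fun x hx => hn (PlaneArcs.fano_of_seven hF hΦ hx.1 hx.2)
    refine ⟨?_, ?_, ?_, ?_, ?_⟩
    · exact (PlaneArcs.count7_eq F K
        ⟨![0, 1, 2, 3, 4, 5, 6], ![0, 1, 2, 3, 4, 5, 6], by decide, by decide⟩
        (mu := 0) {1, 1, 1, 1, 1, 1, 1} (by decide +kernel) (by decide) 5040 (by decide)
        (PlaneArcs.numTw_id h1 hΦ)).trans (by
        rw [if_neg hn]; push_cast; ring)
    · exact (PlaneArcs.count7_eq F K
        ⟨![1, 0, 3, 2, 4, 5, 6], ![1, 0, 3, 2, 4, 5, 6], by decide, by decide⟩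
        (mu := {2, 2}) {2, 2, 1, 1, 1} (by decide +kernel) (by decide) 48 (by decide)
        (PlaneArcs.numTw_two_two h1 h2 hΦ)).trans (by
        rw [if_neg hn]; push_cast; ring)
    · exact (PlaneArcs.count7_eq F K
        ⟨![1, 2, 0, 3, 5, 6, 4], ![2, 0, 1, 3, 6, 4, 5], by decide, by decide⟩
        (mu := {3, 3}) {3, 3, 1} (by decide +kernel) (by decide) 18 (by decide)
        (PlaneArcs.numTw_three_three hF hΦ hC)).trans (by
        rw [if_neg hn]; push_cast; ring)
    · exact (PlaneArcs.count7_eq F K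
        ⟨![1, 2, 3, 0, 4, 6, 5], ![3, 0, 1, 2, 4, 6, 5], by decide, by decide⟩
        (mu := {4, 2}) {4, 2, 1} (by decide +kernel) (by decide) 8 (by decide)
        (PlaneArcs.numTw_four_two hF hΦ)).trans (by
        rw [if_neg hn]; push_cast; ring)
    · exact (PlaneArcs.count7_eq F K
        ⟨![1, 2, 3, 4, 5, 6, 0], ![6, 0, 1, 2, 3, 4, 5], by decide, by decide⟩
        (mu := {7}) {7} (by decide +kernel) (by decide) 7 (by decide)
        (PlaneArcs.numTw_seven hF hA)).trans (by
        push_cast; ring)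
  · refine ⟨?_, ?_, ?_, ?_, ?_, ?_, ?_, ?_, ?_, ?_⟩
    · exact (PlaneArcs.count7_eq F K
        ⟨![1, 0, 2, 3, 4, 5, 6], ![1, 0, 2, 3, 4, 5, 6], by decide, by decide⟩
        (mu := {2}) {2, 1, 1, 1, 1, 1} (by decide +kernel) (by decide) 240 (by decide)
        (PlaneArcs.numTw_two h1 h2)).trans (by
        push_cast; ring)
    · exact (PlaneArcs.count7_eq F K
        ⟨![1, 0, 3, 2, 4, 6, 5], ![1, 0, 3, 2, 4, 6, 5], by decide, by decide⟩
        (mu := {2, 2, 2}) {2, 2, 2, 1} (by decide +kernel) (by decide) 48 (by decide)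
        (PlaneArcs.numTw_two_two_two h1 h2 hΦ)).trans (by
        push_cast; ring)
    · exact (PlaneArcs.count7_eq F K
        ⟨![0, 1, 2, 3, 5, 6, 4], ![0, 1, 2, 3, 6, 4, 5], by decide, by decide⟩
        (mu := {3}) {3, 1, 1, 1, 1} (by decide +kernel) (by decide) 72 (by decide)
        (PlaneArcs.numTw_three_fix hF)).trans (by
        push_cast; ring)
    · exact (PlaneArcs.count7_eq F K
        ⟨![1, 0, 2, 3, 5, 6, 4], ![1, 0, 2, 3, 6, 4, 5], by decide, by decide⟩
        (mu := {3, 2}) {3, 2, 1, 1} (by decide +kernel) (by decide) 12 (by decide)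
        (PlaneArcs.numTw_three_two hF)).trans (by
        push_cast; ring)
    · exact (PlaneArcs.count7_eq F K
        ⟨![1, 0, 3, 2, 5, 6, 4], ![1, 0, 3, 2, 6, 4, 5], by decide, by decide⟩
        (mu := {3, 2, 2}) {3, 2, 2} (by decide +kernel) (by decide) 24 (by decide)
        (PlaneArcs.numTw_three_two_two hF)).trans (by
        push_cast; ring)
    · exact (PlaneArcs.count7_eq F K
        ⟨![1, 2, 3, 0, 4, 5, 6], ![3, 0, 1, 2, 4, 5, 6], by decide, by decide⟩
        (mu := {4}) {4, 1, 1, 1} (by decide +kernel) (by decide) 24 (by decide)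
        (PlaneArcs.numTw_four hF)).trans (by
        push_cast; ring)
    · exact (PlaneArcs.count7_eq F K
        ⟨![1, 2, 3, 0, 5, 6, 4], ![3, 0, 1, 2, 6, 4, 5], by decide, by decide⟩
        (mu := {4, 3}) {4, 3} (by decide +kernel) (by decide) 12 (by decide)
        (PlaneArcs.numTw_four_three hF)).trans (by
        push_cast; ring)
    · exact (PlaneArcs.count7_eq F K
        ⟨![1, 2, 3, 4, 0, 5, 6], ![4, 0, 1, 2, 3, 5, 6], by decide, by decide⟩
        (mu := {5}) {5, 1, 1} (by decide +kernel) (by decide) 10 (by decide)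
        (PlaneArcs.numTw_five_fix hF)).trans (by
        push_cast; ring)
    · exact (PlaneArcs.count7_eq F K
        ⟨![1, 2, 3, 4, 0, 6, 5], ![4, 0, 1, 2, 3, 6, 5], by decide, by decide⟩
        (mu := {5, 2}) {5, 2} (by decide +kernel) (by decide) 10 (by decide)
        (PlaneArcs.numTw_five_two hF)).trans (by
        push_cast; ring)
    · exact (PlaneArcs.count7_eq F K
        ⟨![1, 2, 3, 4, 5, 0, 6], ![5, 0, 1, 2, 3, 4, 6], by decide, by decide⟩
        (mu := {6}) {6, 1} (by decide +kernel) (by decide) 6 (by decide)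
        (PlaneArcs.numTw_six_fix hF)).trans (by
        push_cast; ring)
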